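/- **Setting.** A weighted CNF $\varphi$ is a finite set of clauses (finite sets of literals) with weights in $\mathbb N\cup\{\infty\}$; the cost of an assignment is the total weight of the clauses it falsifies. It is *binary* if every clause has at most two literals; Max2SAT asks, given a binary $\varphi$, for an assignment of minimum cost and for this cost. QUBO asks, given integers $w_i$ and $w_{ij}$ ($1\le i<j\le n$), for a vector $x\in\{0,1\}^n$ that minimizes $H(x)=\sum_i w_ix_i+\sum_{i<j}w_{ij}x_ix_j$, and for the minimum; $H$ is given by its terms with nonzero coefficient. The incidence graph of a formula (Hamiltonian) has as vertices its clauses (terms) and the variables occurring in them, and connects every variable with the clauses (terms) that contain it. Its treewidth is the incidence treewidth $\mathrm{itw}$. The size $|\varphi|$ (resp. $|H|$) is the number of occurrences of variables in clauses (terms), plus the number of clauses (terms), plus one. Running times are on a uniform-cost random access machine with integer registers and arrays whose only arithmetic operations are addition and subtraction. **Theorem.** Max2SAT and QUBO can be solved in time $O(2^{\mathrm{itw}(\varphi)}\,|\varphi|)$ when, as usual for dynamic programming over tree decompositions, the input contains, besides the instance, a tree decomposition of its incidence graph of minimum width $\mathrm{itw}(\varphi)$ with at most $|\varphi|$ nodes;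 every instance has such a decomposition. More generally, for each of the two problems there are an algorithm and a constant $C$ such that for every instance $\varphi$ (binary formula or Hamiltonian) and every tree decomposition $(T,\mathrm{bag})$ of its incidence graph, of any width $k$ and with any number $N$ of nodes, the algorithm, given $\varphi$ and $(T,\mathrm{bag})$, computes an optimal assignment (a ground state) and the optimum value in at most $C\cdot 2^{k}\cdot(|\varphi|+N)$ steps. (The width of a decomposition is the size of its largest bag minus one, or $0$ if all bags are empty.) -/

import Mathlib

/-! ### Machine model

A random access machine with uniform cost, presented as structured programs. A program mentions
finitely many registers and finitely many arrays of integers; the only arithmetic operations are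
addition and subtraction, and every elementary operation, comparisons included, costs one step. -/

/-- Programs. Registers and arrays are named by natural numbers. -/
inductive Program : Type
  | skip : Program
  /-- `r := z` -/
  | const (r : ℕ) (z : ℤ) : Program
  /-- `r := a + b` -/
  | add (r a b : ℕ) : Program
  /-- `r := a - b` -/
  | sub (r a b : ℕ) : Program
  /-- `r := arr[i]`, where the address is the content of register `i` -/
  | load (r arr i : ℕ) : Program
  /-- `arr[i] := a`, where the address is the content of register `i` -/
  | store (arr i a : ℕ) : Program
  | seq (p q : Program) : Program
  /-- `if a < b then p else q` -/
  | ifLT (a b : ℕ) (p q : Program) : Program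
  /-- `while a < b do p` -/
  | whileLT (a b : ℕ) (p : Program) : Program

/-- The contents of all registers and of all cells of all arrays. -/
structure MachineState where
  reg : ℕ → ℤ
  mem : ℕ → ℤ → ℤ

namespace MachineState

/-- Overwrite register `r`. -/
def setReg (s : MachineState) (r : ℕ) (z : ℤ) : MachineState :=
  { s with reg := Function.update s.reg r z }

/-- Overwrite cell `i` of array `arr`. -/
def setMem (s : MachineState) (arr : ℕ) (i z : ℤ) : MachineState :=
  { s with mem := Function.update s.mem arr (Function.update (s.mem arr) i z) }

/-- Initial state: the input words are in the cells `0, 1, 2, …` of array `0`; all other cells and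
all registers contain `0`. -/
def init (input : List ℤ) : MachineState where
  reg _ := 0
  mem arr i := if arr = 0 ∧ 0 ≤ i then input.getD i.toNat 0 else 0

end MachineState

/-- `Exec p s t s'`: started in state `s`, the program `p` halts after exactly `t` steps in
state `s'`. -/
inductive Exec : Program → MachineState → ℕ → MachineState → Prop
  | skip (s) : Exec .skip s 1 s
  | const (s r z) : Exec (.const r z) s 1 (s.setReg r z)
  | add (s r a b) : Exec (.add r a b) s 1 (s.setReg r (s.reg a + s.reg b))
  | sub (s r a b) : Exec (.sub r a b) s 1 (s.setReg r (s.reg a - s.reg b))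
  | load (s r arr i) : Exec (.load r arr i) s 1 (s.setReg r (s.mem arr (s.reg i)))
  | store (s arr i a) : Exec (.store arr i a) s 1 (s.setMem arr (s.reg i) (s.reg a))
  | seq {p q s₁ s₂ s₃ t₁ t₂} (h₁ : Exec p s₁ t₁ s₂) (h₂ : Exec q s₂ t₂ s₃) :
      Exec (.seq p q) s₁ (t₁ + t₂) s₃
  | ifTrue {a b p q s s' t} (hab : s.reg a < s.reg b) (h : Exec p s t s') :
      Exec (.ifLT a b p q) s (t + 1) s'
  | ifFalse {a b p q s s' t} (hab : ¬ s.reg a < s.reg b) (h : Exec q s t s') :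
      Exec (.ifLT a b p q) s (t + 1) s'
  | whileTrue {a b p s₁ s₂ s₃ t₁ t₂} (hab : s₁.reg a < s₁.reg b) (h₁ : Exec p s₁ t₁ s₂)
      (h₂ : Exec (.whileLT a b p) s₂ t₂ s₃) : Exec (.whileLT a b p) s₁ (t₁ + t₂ + 1) s₃
  | whileFalse {a b p s} (hab : ¬ s.reg a < s.reg b) : Exec (.whileLT a b p) s 1 s

/-- On the given input, `p` halts within `T` steps in a state that satisfies `good`. -/
def SolvesWithin (p : Program) (input : List ℤ) (T : ℕ) (good : MachineState → Prop) : Prop :=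
  ∃ t s, Exec p (MachineState.init input) t s ∧ t ≤ T ∧ good s

/-! ### Tree decompositions and treewidth -/

/-- A (rooted) tree decomposition of `G`. The nodes of the tree are `0, …, numNodes - 1`, the root
is `0`, and the nodes are numbered such that the parent of every other node precedes it (every
finite rooted tree has such a numbering). -/
structure TreeDecomposition {V : Type} (G : SimpleGraph V) where
  numNodes : ℕ
  numNodes_pos : 0 < numNodes
  parent : Fin numNodes → Fin numNodes
  parent_root : ∀ t, t.val = 0 → parent t = t
  parent_lt : ∀ t, t.val ≠ 0 → parent t < t
  bag : Fin numNodes → Finset V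
  /-- The nodes whose bag contains `v` induce a nonempty connected subgraph of the tree. -/
  connectedness : ∀ v, ((SimpleGraph.fromRel fun s t => parent t = s).induce
    {t | v ∈ bag t}).Connected
  covering : ∀ u v, G.Adj u v → ∃ t, u ∈ bag t ∧ v ∈ bag t

namespace TreeDecomposition

variable {V : Type} {G : SimpleGraph V}

/-- The size of a largest bag, minus one (and `0` if all bags are empty). -/
def width (D : TreeDecomposition G) : ℕ :=
  (Finset.univ.sup fun t => (D.bag t).card) - 1

end TreeDecomposition

/-- The treewidth of a finite graph: the minimum width of a tree decomposition. -/
noncomputable def treewidth {V : Type} (G : SimpleGraph V) : ℕ :=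
  sInf {w | ∃ D : TreeDecomposition G, D.width = w}

/-! ### Incidence graphs -/

/-- The variables that occur in a finite family `S` of objects, where `c ∈ S` contains exactly the
variables in `sc c`. -/
def occurringVars {κ : Type} (S : Finset κ) (sc : κ → Finset ℕ) : Finset ℕ :=
  S.biUnion sc

/-- Vertices of the incidence graph: the occurring variables and the members of `S`. -/
abbrev IncidenceVertex {κ : Type} (S : Finset κ) (sc : κ → Finset ℕ) : Type :=
  {x : ℕ // x ∈ occurringVars S sc} ⊕ {c : κ // c ∈ S}

/-- The incidence graph connects every variable with the members of `S` that contain it. -/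
def incidenceGraph {κ : Type} (S : Finset κ) (sc : κ → Finset ℕ) :
    SimpleGraph (IncidenceVertex S sc) :=
  SimpleGraph.fromRel fun u v =>
    match u, v with
    | Sum.inl x, Sum.inr c => x.val ∈ sc c.val
    | _, _ => False

/-! ### Encodings as sequences of words -/

/-- `l` lists the elements of `S`, each once, in some order. -/
def ListingOf {α : Type} (l : List α) (S : Finset α) : Prop :=
  l.Nodup ∧ ∀ a, a ∈ l ↔ a ∈ S

/-- The length of a list, followed by the encodings of its entries. -/
def encodeList {α : Type} (f : α → List ℤ) (l : List α) : List ℤ :=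
  (l.length : ℤ) :: l.flatMap f

/-- A variable is encoded by its name, the member number `j` of the listing `cs` of `S`
by `-(j + 1)`. -/
def encodeVertex {κ : Type} [DecidableEq κ] {S : Finset κ} {sc : κ → Finset ℕ} (cs : List κ) :
    IncidenceVertex S sc → ℤ
  | Sum.inl x => (x.val : ℤ)
  | Sum.inr c => -((cs.idxOf c.val : ℤ) + 1)

/-- The list of nodes; each is given by its parent and the list of the elements of its bag, in the
order `bags t`. -/
def encodeDecomposition {κ : Type} [DecidableEq κ] {S : Finset κ} {sc : κ → Finset ℕ}
    (cs : List κ) (D : TreeDecomposition (incidenceGraph S sc))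
    (bags : Fin D.numNodes → List (IncidenceVertex S sc)) : List ℤ :=
  encodeList
    (fun t => ((D.parent t).val : ℤ) :: encodeList (fun v => [encodeVertex cs v]) (bags t))
    (List.finRange D.numNodes)

/-! ### Weighted CNF formulas and MaxSAT -/

/-- A literal: a variable together with its sign (`true` for `x`, `false` for `¬ x`). -/
abbrev Literal : Type := ℕ × Bool

/-- A clause is a finite set of literals. -/
abbrev Clause : Type := Finset Literal

/-- A weighted CNF: a finite set of clauses with weights in `ℕ ∪ {∞}` (values of `weight` outside
of `clauses` are irrelevant). -/
structure WCNF where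
  clauses : Finset Clause
  weight : Clause → ℕ∞

/-- The variables of a clause. -/
def Clause.vars (c : Clause) : Finset ℕ := c.image Prod.fst

/-- `β` satisfies one of the literals of `c`. -/
def Clause.Sat (c : Clause) (β : ℕ → Bool) : Prop := ∃ l ∈ c, β l.1 = l.2

namespace WCNF

/-- Every clause contains at most two literals, i.e. the formula is an instance of Max2SAT. -/
def IsBinary (φ : WCNF) : Prop := ∀ c ∈ φ.clauses, c.card ≤ 2

open Classical in
/-- The total weight of the clauses falsified by `β` (only the values of `β` on the variables of
the formula matter). -/
noncomputable def cost (φ : WCNF) (β : ℕ → Bool) : ℕ∞ :=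
  ∑ c ∈ φ.clauses with ¬ Clause.Sat c β, φ.weight c

/-- The minimum cost of an assignment. -/
noncomputable def optCost (φ : WCNF) : ℕ∞ := ⨅ β : ℕ → Bool, φ.cost β

/-- The size of the formula: the number of literal occurrences plus the number of clauses
plus one. -/
def size (φ : WCNF) : ℕ := (∑ c ∈ φ.clauses, (c.card + 1)) + 1

/-- The incidence graph of the formula. -/
abbrev incGraph (φ : WCNF) : SimpleGraph (IncidenceVertex φ.clauses Clause.vars) :=
  incidenceGraph φ.clauses Clause.vars

/-- The incidence treewidth of the formula. -/
noncomputable def itw (φ : WCNF) : ℕ := treewidth φ.incGraph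

end WCNF

/-- The literals `x` and `¬ x` are encoded by `x + 1` and `-(x + 1)`. -/
def encodeLiteral (l : Literal) : ℤ := if l.2 then (l.1 : ℤ) + 1 else -((l.1 : ℤ) + 1)

/-- A finite number is encoded by itself, `∞` by `-1`. -/
def encodeWeight : ℕ∞ → ℤ
  | some k => ((k : ℕ) : ℤ)
  | none => -1

/-- The list of clauses in the order `cs`; each is given by the list of its literals, in the
order `lits c`, and its weight. -/
def WCNF.encode (φ : WCNF) (cs : List Clause) (lits : Clause → List Literal) : List ℤ :=
  encodeList
    (fun c => encodeList (fun l => [encodeLiteral l]) (lits c) ++ [encodeWeight (φ.weight c)]) cs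

/-- The assignment (or 0-1 vector) that is stored in array `1`. -/
def MachineState.outputAssignment (s : MachineState) (x : ℕ) : Bool :=
  decide (s.mem 1 (x : ℤ) = 1)

/-- Array `1` contains an optimal assignment and register `0` contains the optimal cost. -/
def WCNF.IsSolution (φ : WCNF) (s : MachineState) : Prop :=
  φ.cost s.outputAssignment = φ.optCost ∧ s.reg 0 = encodeWeight φ.optCost

/-- Given the formula (with clauses and literals in an arbitrary order) and the tree decomposition
`D` of its incidence graph (with the elements of the bags in an arbitrary order), the program `P`
finds an optimal assignment and its cost within `T` steps. -/
def WCNF.SolvedWithin (φ : WCNF) (P : Program) (D : TreeDecomposition φ.incGraph) (T : ℕ) : Prop :=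
  ∀ (cs : List Clause) (lits : Clause → List Literal)
    (bags : Fin D.numNodes → List (IncidenceVertex φ.clauses Clause.vars)),
    ListingOf cs φ.clauses → (∀ c ∈ φ.clauses, ListingOf (lits c) c) →
    (∀ t, ListingOf (bags t) (D.bag t)) →
    SolvesWithin P (φ.encode cs lits ++ encodeDecomposition cs D bags) T φ.IsSolution

/-! ### Quadratic unconstrained binary optimization -/

/-- A Hamiltonian in `n` binary variables, given by an upper triangular integer matrix: `w i i` is
the coefficient of `x i`, and for `i < j` the entry `w i j` is the coefficient of `x i * x j`.
The entries `w i j` with `j < i` are irrelevant. -/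
structure Qubo where
  n : ℕ
  w : Fin n → Fin n → ℤ

namespace Qubo

/-- The value of the Hamiltonian. -/
def energy (H : Qubo) (x : Fin H.n → Bool) : ℤ :=
  (∑ i, H.w i i * (if x i then 1 else 0)) +
    ∑ i, ∑ j ∈ Finset.univ.filter (fun j => i < j),
      H.w i j * (if x i then 1 else 0) * (if x j then 1 else 0)

/-- The terms of the Hamiltonian: `(i, i)` for a linear term, `(i, j)` with `i < j` for a quadratic
one, in both cases with a nonzero coefficient. -/
def terms (H : Qubo) : Finset (Fin H.n × Fin H.n) :=
  Finset.univ.filter fun p => p.1 ≤ p.2 ∧ H.w p.1 p.2 ≠ 0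

/-- The one or two variables of a term. -/
def termVars {n : ℕ} (p : Fin n × Fin n) : Finset ℕ := {p.1.val, p.2.val}

/-- The size of the Hamiltonian: the number of variable occurrences in terms plus the number of
terms plus one. -/
def size (H : Qubo) : ℕ := (∑ p ∈ H.terms, ((termVars p).card + 1)) + 1

/-- The incidence graph of the Hamiltonian. -/
abbrev incGraph (H : Qubo) : SimpleGraph (IncidenceVertex H.terms termVars) :=
  incidenceGraph H.terms termVars

/-- The incidence treewidth of the Hamiltonian. -/
noncomputable def itw (H : Qubo) : ℕ := treewidth H.incGraph

/-- The number of variables, followed by the list of terms in the order `ts`. -/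
def encode (H : Qubo) (ts : List (Fin H.n × Fin H.n)) : List ℤ :=
  (H.n : ℤ) :: encodeList (fun p => [(p.1.val : ℤ), (p.2.val : ℤ), H.w p.1 p.2]) ts

/-- Array `1` contains a ground state and register `0` contains its energy. -/
def IsSolution (H : Qubo) (s : MachineState) : Prop :=
  (∀ y, H.energy (fun i => s.outputAssignment i.val) ≤ H.energy y) ∧
    s.reg 0 = H.energy (fun i => s.outputAssignment i.val)

/-- Given the Hamiltonian (with terms in an arbitrary order) and the tree decomposition `D` of its
incidence graph (with the elements of the bags in an arbitrary order), the program `P` finds a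
ground state and its energy within `T` steps. -/
def SolvedWithin (H : Qubo) (P : Program) (D : TreeDecomposition H.incGraph) (T : ℕ) : Prop :=
  ∀ (ts : List (Fin H.n × Fin H.n))
    (bags : Fin D.numNodes → List (IncidenceVertex H.terms termVars)),
    ListingOf ts H.terms → (∀ t, ListingOf (bags t) (D.bag t)) →
    SolvesWithin P (H.encode ts ++ encodeDecomposition ts D bags) T H.IsSolution

end Qubo

/-! ### A language of counting loops, compiled to the machine -/

namespace MachineState

/-! The argument is elimination of variables along a tree, with two points that need care: the width
must not grow when passing from the incidence graph to the variables alone, and the time per node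
must be proportional to the table size, without a polynomial factor in the width.

For the first point, every constraint (clause or term) has at most two variables `u` and `v`. In all
bags the vertex of the constraint is replaced by `u`, which contracts the edge between them. Bags do
not become larger, and the nodes of a variable still form a subtree, because the nodes of each
contracted vertex form a subtree that meets the one of the variable (`exists_hub`,
`treeData_decomposes`). Some bag contains the constraint and `v`, hence after the replacement both
`u` and `v`; the table of the constraint, with at most four entries, is hung below that node. An
empty clause has no variable and is given a private negative pseudo-variable.

The result is a `TableTree`: constraints come first, then the nodes of the decomposition in reverse
order, then an empty root, so that children precede parents. Eliminating a node minimizes its table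
over the variables that its parent does not share, adds the minima to the parent's table, and
records the minimizers. `TableTree.Push.invariant` states that the remaining sum is a lower bound
for the original objective and is attained by undoing the recorded eliminations. At the empty root
the sum is a single number, the minimum (`minimize_spec`).

For the second point, an assignment of a bag is a binary number, and passing to the shared variables
means clearing the other digits. The resulting number is a sum of fixed coefficients over the digits
of an index of the child, and also over those of an index of the parent (`lin_parentCoef`). All
these sums are tabulated by doubling in time `O(2 ^ b)` for a bag of size `b` (`linearTable_spec`).
Computing the coefficients is only quadratic in the bag sizes, and `(k + 3) ^ 2 ≤ 16 * 2 ^ k`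
absorbs that.

Infinite weights are replaced by one plus the sum of the finite weights, so a cost is infinite
exactly when the replaced cost reaches this bound (`WCNF.cost_cases`). The algorithms are written
with counting loops and compiled with a bound on the running time (`Cmd.code_exec`). A decomposition
of minimum width with few nodes arises by keeping only the root and one topmost node for every
vertex (`TreeDecomposition.exists_numNodes_le`). -/

@[simp] theorem setReg_reg (s : MachineState) (r r' : ℕ) (z : ℤ) :
    (s.setReg r z).reg r' = if r' = r then z else s.reg r' := by
  simp [setReg, Function.update_apply]

@[simp] theorem setReg_mem (s : MachineState) (r : ℕ) (z : ℤ) : (s.setReg r z).mem = s.mem := rfl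

@[simp] theorem setMem_reg (s : MachineState) (a : ℕ) (i z : ℤ) :
    (s.setMem a i z).reg = s.reg := rfl

@[simp] theorem setMem_mem (s : MachineState) (a a' : ℕ) (i z : ℤ) :
    (s.setMem a i z).mem a' = if a' = a then Function.update (s.mem a) i z else s.mem a' := by
  by_cases h : a' = a
  · subst h; simp [setMem]
  · simp [setMem, h]

/-- The states agree on the registers below `U` and on the memory. -/
def Agree (U : ℕ) (s s' : MachineState) : Prop :=
  (∀ r < U, s.reg r = s'.reg r) ∧ s.mem = s'.mem

end MachineState

/-- Integer expressions over registers and arrays. -/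
inductive Exp : Type
  | reg (r : ℕ) : Exp
  | lit (z : ℤ) : Exp
  | add (a b : Exp) : Exp
  | sub (a b : Exp) : Exp
  | cell (arr : ℕ) (i : Exp) : Exp

namespace Exp

instance : Add Exp := ⟨Exp.add⟩
instance : Sub Exp := ⟨Exp.sub⟩

def eval (s : MachineState) : Exp → ℤ
  | reg r => s.reg r
  | lit z => z
  | add a b => a.eval s + b.eval s
  | sub a b => a.eval s - b.eval s
  | cell arr i => s.mem arr (i.eval s)

@[simp] theorem eval_reg (s r) : (reg r).eval s = s.reg r := rfl
@[simp] theorem eval_lit (s z) : (lit z).eval s = z := rfl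
@[simp] theorem eval_add (s) (a b : Exp) : (a + b).eval s = a.eval s + b.eval s := rfl
@[simp] theorem eval_sub (s) (a b : Exp) : (a - b).eval s = a.eval s - b.eval s := rfl
@[simp] theorem eval_cell (s arr i) : (cell arr i).eval s = s.mem arr (i.eval s) := rfl

/-- A register costs two steps because the machine has no copy instruction: the target is cleared
and the register is added to it. -/
def cost : Exp → ℕ
  | reg _ => 2
  | lit _ => 1
  | add a b => a.cost + b.cost + 1
  | sub a b => a.cost + b.cost + 1
  | cell _ i => i.cost + 1

@[simp] theorem cost_reg (r) : (reg r).cost = 2 := rfl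
@[simp] theorem cost_lit (z) : (lit z).cost = 1 := rfl
@[simp] theorem cost_add (a b : Exp) : (a + b).cost = a.cost + b.cost + 1 := rfl
@[simp] theorem cost_sub (a b : Exp) : (a - b).cost = a.cost + b.cost + 1 := rfl
@[simp] theorem cost_cell (arr i) : (cell arr i).cost = i.cost + 1 := rfl

/-- All registers are below `U`. -/
def regsBelow (U : ℕ) : Exp → Bool
  | reg r => decide (r < U)
  | lit _ => true
  | add a b => a.regsBelow U && b.regsBelow U
  | sub a b => a.regsBelow U && b.regsBelow U
  | cell _ i => i.regsBelow U

/-- Code that leaves the value of the expression in register `d`, without touching the registers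
below `d`. -/
def code (d : ℕ) : Exp → Program
  | reg r => .seq (.const d 0) (.add d d r)
  | lit z => .const d z
  | add a b => .seq (.seq (a.code d) (b.code (d + 1))) (.add d d (d + 1))
  | sub a b => .seq (.seq (a.code d) (b.code (d + 1))) (.sub d d (d + 1))
  | cell arr i => .seq (i.code d) (.load d arr d)

theorem eval_congr {U : ℕ} {s s' : MachineState} (h : s.Agree U s') (e : Exp)
    (he : e.regsBelow U = true) : e.eval s = e.eval s' := by
  induction e with
  | reg r => exact h.1 r (by simpa [regsBelow] using he)
  | lit z => rfl
  | add a b iha ihb =>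
    simp only [regsBelow, Bool.and_eq_true] at he
    simp [eval, iha he.1, ihb he.2]
  | sub a b iha ihb =>
    simp only [regsBelow, Bool.and_eq_true] at he
    simp [eval, iha he.1, ihb he.2]
  | cell arr i ih => simp [eval, ih he, h.2]

/-- The registers from `d` on serve as a stack. The second operand is computed at `d + 1`, so the
first one survives in `d`, and the registers that expressions read lie below `U ≤ d`. The step count
is exact. -/
theorem code_exec {U : ℕ} (e : Exp) (he : e.regsBelow U = true) (d : ℕ) (hd : U ≤ d)
    (s : MachineState) : ∃ s', Exec (e.code d) s e.cost s' ∧ s'.reg d = e.eval s ∧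
      (∀ r < d, s'.reg r = s.reg r) ∧ s'.mem = s.mem := by
  induction e generalizing d s with
  | reg r =>
    have hr : r < U := by simpa [regsBelow] using he
    refine ⟨_, Exec.seq (Exec.const _ _ _) (Exec.add _ _ _ _), ?_, ?_, rfl⟩
    · simp [eval, show r ≠ d by omega]
    · intro r' hr'; simp [show r' ≠ d by omega]
  | lit z =>
    refine ⟨_, Exec.const _ _ _, by simp [eval], ?_, rfl⟩
    intro r' hr'; simp [show r' ≠ d by omega]
  | add a b iha ihb =>
    simp only [regsBelow, Bool.and_eq_true] at he
    obtain ⟨s₁, h₁, v₁, f₁, m₁⟩ := iha he.1 d hd s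
    obtain ⟨s₂, h₂, v₂, f₂, m₂⟩ := ihb he.2 (d + 1) (by omega) s₁
    have e₂ : b.eval s₁ = b.eval s :=
      eval_congr ⟨fun r hr => f₁ r (by omega), m₁⟩ b he.2
    refine ⟨_, Exec.seq (Exec.seq h₁ h₂) (Exec.add _ _ _ _), ?_, ?_, ?_⟩
    · simp [eval, v₂, f₂ d (by omega), v₁, e₂]
    · intro r' hr'; simp [show r' ≠ d by omega, f₂ r' (by omega), f₁ r' hr']
    · simp [m₂, m₁]
  | sub a b iha ihb =>
    simp only [regsBelow, Bool.and_eq_true] at he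
    obtain ⟨s₁, h₁, v₁, f₁, m₁⟩ := iha he.1 d hd s
    obtain ⟨s₂, h₂, v₂, f₂, m₂⟩ := ihb he.2 (d + 1) (by omega) s₁
    have e₂ : b.eval s₁ = b.eval s :=
      eval_congr ⟨fun r hr => f₁ r (by omega), m₁⟩ b he.2
    refine ⟨_, Exec.seq (Exec.seq h₁ h₂) (Exec.sub _ _ _ _), ?_, ?_, ?_⟩
    · simp [eval, v₂, f₂ d (by omega), v₁, e₂]
    · intro r' hr'; simp [show r' ≠ d by omega, f₂ r' (by omega), f₁ r' hr']
    · simp [m₂, m₁]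
  | cell arr i ih =>
    obtain ⟨s₁, h₁, v₁, f₁, m₁⟩ := ih he d hd s
    refine ⟨_, Exec.seq h₁ (Exec.load _ _ _ _), ?_, ?_, ?_⟩
    · simp [eval, v₁, m₁]
    · intro r' hr'; simp [show r' ≠ d by omega, f₁ r' hr']
    · simp [m₁]

end Exp

/-- Commands; `loop i n p` runs `p` with `i = 0, …, n - 1`, where `n` is evaluated once. -/
inductive Cmd : Type
  | assign (r : ℕ) (e : Exp) : Cmd
  | put (arr : ℕ) (i e : Exp) : Cmd
  | seq (p q : Cmd) : Cmd
  /-- `if a < b then p else q` -/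
  | ifLT (a b : Exp) (p q : Cmd) : Cmd
  | skip : Cmd
  | loop (i : ℕ) (n : Exp) (p : Cmd) : Cmd

/-- The state after `k` rounds of a loop with counter `i` and body `f`. -/
def loopState (f : MachineState → MachineState) (i : ℕ) (s : MachineState) : ℕ → MachineState
  | 0 => s
  | k + 1 => f ((loopState f i s k).setReg i k)

namespace Cmd

def eval : Cmd → MachineState → MachineState
  | assign r e, s => s.setReg r (e.eval s)
  | put arr i e, s => s.setMem arr (i.eval s) (e.eval s)
  | seq p q, s => q.eval (p.eval s)
  | ifLT a b p q, s => if a.eval s < b.eval s then p.eval s else q.eval s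
  | skip, s => s
  | loop i n p, s => loopState p.eval i s (n.eval s).toNat

/-- An upper bound for the running time of the compiled command. -/
def cost : Cmd → MachineState → ℕ
  | assign _ e, _ => e.cost + 2
  | put _ i e, _ => i.cost + e.cost + 1
  | seq p q, s => p.cost s + q.cost (p.eval s)
  | ifLT a b p q, s => a.cost + b.cost + 1 + max (p.cost s) (q.cost s)
  | skip, _ => 1
  | loop i n p, s => n.cost + 2 +
      ∑ k ∈ Finset.range (n.eval s).toNat, (p.cost ((loopState p.eval i s k).setReg i k) + 5)

/-- All registers are below `U`. -/
def regsBelow (U : ℕ) : Cmd → Bool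
  | assign r e => decide (r < U) && e.regsBelow U
  | put _ i e => i.regsBelow U && e.regsBelow U
  | seq p q => p.regsBelow U && q.regsBelow U
  | ifLT a b p q => a.regsBelow U && b.regsBelow U && p.regsBelow U && q.regsBelow U
  | skip => true
  | loop i n p => decide (i < U) && n.regsBelow U && p.regsBelow U

/-- Whether register `r` is written. -/
def writesReg (r : ℕ) : Cmd → Bool
  | assign r' _ => r == r'
  | put _ _ _ => false
  | seq p q => p.writesReg r || q.writesReg r
  | ifLT _ _ p q => p.writesReg r || q.writesReg r
  | skip => false
  | loop i _ p => r == i || p.writesReg r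

/-- Whether array `a` is written. -/
def writesMem (a : ℕ) : Cmd → Bool
  | assign _ _ => false
  | put a' _ _ => a == a'
  | seq p q => p.writesMem a || q.writesMem a
  | ifLT _ _ p q => p.writesMem a || q.writesMem a
  | skip => false
  | loop _ _ p => p.writesMem a

@[simp] theorem eval_assign (r e s) : (assign r e).eval s = s.setReg r (e.eval s) := rfl
@[simp] theorem eval_put (a i e s) :
    (put a i e).eval s = s.setMem a (i.eval s) (e.eval s) := rfl
@[simp] theorem eval_seq (p q s) : (seq p q).eval s = q.eval (p.eval s) := rfl
@[simp] theorem eval_ifLT (a b p q s) :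
    (ifLT a b p q).eval s = if a.eval s < b.eval s then p.eval s else q.eval s := rfl
@[simp] theorem eval_skip (s) : skip.eval s = s := rfl

@[simp] theorem cost_assign (r e s) : (assign r e).cost s = e.cost + 2 := rfl
@[simp] theorem cost_put (a i e s) : (put a i e).cost s = i.cost + e.cost + 1 := rfl
@[simp] theorem cost_seq (p q s) : (seq p q).cost s = p.cost s + q.cost (p.eval s) := rfl
@[simp] theorem cost_ifLT (a b p q s) :
    (ifLT a b p q).cost s = a.cost + b.cost + 1 + max (p.cost s) (q.cost s) := rfl
@[simp] theorem cost_skip (s) : skip.cost s = 1 := rfl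

/-- The write test computes, so for concrete commands and registers the hypothesis is closed by
`rfl`. Together with `frame_mem` this carries facts past whole programs. -/
theorem frame_reg (p : Cmd) (s : MachineState) {r : ℕ} (h : p.writesReg r = false) :
    (p.eval s).reg r = s.reg r := by
  induction p generalizing s with
  | assign r' e => simp only [writesReg, beq_eq_false_iff_ne] at h; simp [h]
  | put => rfl
  | seq p q ihp ihq =>
    simp only [writesReg, Bool.or_eq_false_iff] at h
    simp [ihp _ h.1, ihq _ h.2]
  | ifLT a b p q ihp ihq =>
    simp only [writesReg, Bool.or_eq_false_iff] at h
    rw [eval_ifLT]; split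
    · exact ihp _ h.1
    · exact ihq _ h.2
  | skip => rfl
  | loop i n p ih =>
    simp only [writesReg, Bool.or_eq_false_iff, beq_eq_false_iff_ne] at h
    have : ∀ k, (loopState p.eval i s k).reg r = s.reg r := by
      intro k
      induction k with
      | zero => rfl
      | succ k ihk => simp [loopState, ih _ h.2, h.1, ihk]
    exact this _

theorem frame_mem (p : Cmd) (s : MachineState) {a : ℕ} (h : p.writesMem a = false) :
    (p.eval s).mem a = s.mem a := by
  induction p generalizing s with
  | assign => rfl
  | put a' i e => simp only [writesMem, beq_eq_false_iff_ne] at h; simp [h]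
  | seq p q ihp ihq =>
    simp only [writesMem, Bool.or_eq_false_iff] at h
    simp [ihp _ h.1, ihq _ h.2]
  | ifLT a b p q ihp ihq =>
    simp only [writesMem, Bool.or_eq_false_iff] at h
    rw [eval_ifLT]; split
    · exact ihp _ h.1
    · exact ihq _ h.2
  | skip => rfl
  | loop i n p ih =>
    have : ∀ k, (loopState p.eval i s k).mem a = s.mem a := by
      intro k
      induction k with
      | zero => rfl
      | succ k ihk => simp [loopState, ih _ h, ihk]
    exact this _

/-- Invariant rule for loops with round `k` of cost at most `c k`. The invariant has to mention
only what the body changes. -/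
theorem loop_rule {i : ℕ} {e : Exp} {p : Cmd} {s : MachineState} {n : ℕ} (hn : e.eval s = n)
    (Inv : ℕ → MachineState → Prop) (c : ℕ → ℕ) (h0 : Inv 0 s)
    (hstep : ∀ k < n, ∀ τ : MachineState,
      (∀ r, (loop i e p).writesReg r = false → τ.reg r = s.reg r) →
      (∀ a, p.writesMem a = false → τ.mem a = s.mem a) → Inv k τ →
      Inv (k + 1) (p.eval (τ.setReg i k)) ∧ p.cost (τ.setReg i k) ≤ c k) :
    Inv n ((loop i e p).eval s) ∧
      (loop i e p).cost s ≤ e.cost + 2 + ∑ k ∈ Finset.range n, (c k + 5) := by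
  have key : ∀ k ≤ n, Inv k (loopState p.eval i s k) ∧
      (∀ r, (loop i e p).writesReg r = false → (loopState p.eval i s k).reg r = s.reg r) ∧
      (∀ a, p.writesMem a = false → (loopState p.eval i s k).mem a = s.mem a) := by
    intro k hk
    induction k with
    | zero => exact ⟨h0, fun _ _ => rfl, fun _ _ => rfl⟩
    | succ k ih =>
      obtain ⟨h1, h2, h3⟩ := ih (by omega)
      refine ⟨(hstep k hk _ h2 h3 h1).1, fun r hr => ?_, fun a ha => ?_⟩
      · have := h2 r hr
        simp only [writesReg, Bool.or_eq_false_iff, beq_eq_false_iff_ne] at hr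
        simp [loopState, frame_reg p _ hr.2, hr.1, this]
      · simp [loopState, frame_mem p _ ha, h3 a ha]
  have hn' : (e.eval s).toNat = n := by rw [hn]; simp
  refine ⟨?_, ?_⟩
  · simp only [eval, hn']; exact (key n le_rfl).1
  · simp only [cost, hn']
    refine Nat.add_le_add_left (Finset.sum_le_sum fun k hk => ?_) _
    have hk' : k < n := by simpa using hk
    obtain ⟨h1, h2, h3⟩ := key k hk'.le
    exact Nat.add_le_add_right (hstep k hk' _ h2 h3 h1).2 _

/-- `loop_rule` with a uniform bound for the cost of a round. -/
theorem loop_rule' {i : ℕ} {e : Exp} {p : Cmd} {s : MachineState} {n : ℕ} (hn : e.eval s = n)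
    (Inv : ℕ → MachineState → Prop) (c : ℕ) (h0 : Inv 0 s)
    (hstep : ∀ k < n, ∀ τ : MachineState,
      (∀ r, (loop i e p).writesReg r = false → τ.reg r = s.reg r) →
      (∀ a, p.writesMem a = false → τ.mem a = s.mem a) → Inv k τ →
      Inv (k + 1) (p.eval (τ.setReg i k)) ∧ p.cost (τ.setReg i k) ≤ c) :
    Inv n ((loop i e p).eval s) ∧ (loop i e p).cost s ≤ e.cost + 2 + n * (c + 5) := by
  have := loop_rule hn Inv (fun _ => c) h0 hstep
  simpa using this

/-- A loop keeps its bound in `d` and its true counter in `d + 1`, uses `d + 2` as scratch, and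
compiles its body at `d + 3`. The visible counter `i` is a copy that is refreshed in every round. -/
def code (d : ℕ) : Cmd → Program
  | assign r e => .seq (e.code d) (.seq (.const (d + 1) 0) (.add r d (d + 1)))
  | put arr i e => .seq (.seq (i.code d) (e.code (d + 1))) (.store arr d (d + 1))
  | seq p q => .seq (p.code d) (q.code d)
  | ifLT a b p q => .seq (.seq (a.code d) (b.code (d + 1))) (.ifLT d (d + 1) (p.code d) (q.code d))
  | skip => .skip
  | loop i n p => .seq (n.code d) (.seq (.const (d + 1) 0) (.whileLT (d + 1) d
      (.seq (.seq (.const (d + 2) 0) (.add i (d + 1) (d + 2)))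
        (.seq (p.code (d + 3)) (.seq (.const (d + 2) 1) (.add (d + 1) (d + 1) (d + 2)))))))

/-- Scratch registers are excluded from the comparison with `p.eval σ`. The last clause, that
registers between `U` and `d` survive, is what protects the bound and the counter of an enclosing
loop. -/
theorem code_exec {U : ℕ} (p : Cmd) (hp : p.regsBelow U = true) (d : ℕ) (hd : U ≤ d)
    (s σ : MachineState) (hs : s.Agree U σ) :
    ∃ t s', Exec (p.code d) s t s' ∧ t ≤ p.cost σ ∧ s'.Agree U (p.eval σ) ∧
      ∀ r < d, U ≤ r → s'.reg r = s.reg r := by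
  induction p generalizing d s σ with
  | assign r e =>
    simp only [regsBelow, Bool.and_eq_true, decide_eq_true_eq] at hp
    obtain ⟨s₁, h₁, v₁, f₁, m₁⟩ := e.code_exec hp.2 d hd s
    refine ⟨_, _, Exec.seq h₁ (Exec.seq (Exec.const _ _ _) (Exec.add _ _ _ _)), by simp [cost],
      ⟨fun r' hr' => ?_, ?_⟩, fun r' hr' hU => ?_⟩
    · by_cases hrr : r' = r
      · simp [eval, hrr, v₁, Exp.eval_congr hs e hp.2]
      · simp [eval, hrr, show r' ≠ d + 1 by omega, f₁ r' (by omega), hs.1 r' hr']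
    · simp [eval, m₁, hs.2]
    · simp [show r' ≠ r by omega, show r' ≠ d + 1 by omega, f₁ r' (by omega)]
  | put arr i e =>
    simp only [regsBelow, Bool.and_eq_true] at hp
    obtain ⟨s₁, h₁, v₁, f₁, m₁⟩ := i.code_exec hp.1 d hd s
    obtain ⟨s₂, h₂, v₂, f₂, m₂⟩ := e.code_exec hp.2 (d + 1) (by omega) s₁
    have a₁ : s₁.Agree U σ := ⟨fun r hr => (f₁ r (by omega)).trans (hs.1 r hr), m₁.trans hs.2⟩
    refine ⟨_, _, Exec.seq (Exec.seq h₁ h₂) (Exec.store _ _ _ _), by simp [cost],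
      ⟨fun r' hr' => ?_, ?_⟩, fun r' hr' hU => ?_⟩
    · simp [eval, f₂ r' (by omega), a₁.1 r' hr']
    · funext a
      simp [eval, f₂ d (by omega), v₁, v₂, m₂, a₁.2, Exp.eval_congr hs i hp.1,
        Exp.eval_congr a₁ e hp.2]
    · simp [f₂ r' (by omega), f₁ r' hr']
  | seq p q ihp ihq =>
    simp only [regsBelow, Bool.and_eq_true] at hp
    obtain ⟨t₁, s₁, h₁, c₁, a₁, f₁⟩ := ihp hp.1 d hd s σ hs
    obtain ⟨t₂, s₂, h₂, c₂, a₂, f₂⟩ := ihq hp.2 d hd s₁ _ a₁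
    refine ⟨_, _, Exec.seq h₁ h₂, by simp only [cost]; omega, a₂, fun r hr hU => ?_⟩
    rw [f₂ r hr hU, f₁ r hr hU]
  | ifLT a b p q ihp ihq =>
    simp only [regsBelow, Bool.and_eq_true] at hp
    obtain ⟨⟨⟨ha, hb⟩, hp⟩, hq⟩ := hp
    obtain ⟨s₁, h₁, v₁, f₁, m₁⟩ := a.code_exec ha d hd s
    obtain ⟨s₂, h₂, v₂, f₂, m₂⟩ := b.code_exec hb (d + 1) (by omega) s₁
    have a₁ : s₁.Agree U σ := ⟨fun r hr => (f₁ r (by omega)).trans (hs.1 r hr), m₁.trans hs.2⟩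
    have a₂ : s₂.Agree U σ := ⟨fun r hr => (f₂ r (by omega)).trans (a₁.1 r hr), m₂.trans a₁.2⟩
    have e₁ : s₂.reg d = a.eval σ := by rw [f₂ d (by omega), v₁, Exp.eval_congr hs a ha]
    have e₂ : s₂.reg (d + 1) = b.eval σ := by rw [v₂, Exp.eval_congr a₁ b hb]
    by_cases hab : a.eval σ < b.eval σ
    · obtain ⟨t, s₃, h₃, c₃, a₃, f₃⟩ := ihp hp d hd s₂ σ a₂
      refine ⟨_, _, Exec.seq (Exec.seq h₁ h₂) (Exec.ifTrue (by rwa [e₁, e₂]) h₃), ?_, ?_, ?_⟩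
      · simp only [cost]; omega
      · simpa [eval, hab] using a₃
      · intro r hr hU; rw [f₃ r hr hU, f₂ r (by omega), f₁ r hr]
    · obtain ⟨t, s₃, h₃, c₃, a₃, f₃⟩ := ihq hq d hd s₂ σ a₂
      refine ⟨_, _, Exec.seq (Exec.seq h₁ h₂) (Exec.ifFalse (by rwa [e₁, e₂]) h₃), ?_, ?_, ?_⟩
      · simp only [cost]; omega
      · simpa [eval, hab] using a₃
      · intro r hr hU; rw [f₃ r hr hU, f₂ r (by omega), f₁ r hr]
  | skip => exact ⟨_, _, Exec.skip s, le_rfl, hs, fun _ _ _ => rfl⟩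
  | loop i e p ih =>
    simp only [regsBelow, Bool.and_eq_true, decide_eq_true_eq] at hp
    obtain ⟨⟨hi, he⟩, hp⟩ := hp
    obtain ⟨s₁, h₁, v₁, f₁, m₁⟩ := e.code_exec he d hd s
    set n := (e.eval σ).toNat with hn
    have hv : s₁.reg d = e.eval σ := by rw [v₁, Exp.eval_congr hs e he]
    -- Induction on the number `j` of rounds that remain after round `k`.
    have key : ∀ j k, j + k = n → ∀ s' : MachineState,
        s'.Agree U (loopState p.eval i σ k) → s'.reg d = e.eval σ → s'.reg (d + 1) = k →
        ∃ t s'', Exec (.whileLT (d + 1) d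
          (.seq (.seq (.const (d + 2) 0) (.add i (d + 1) (d + 2)))
            (.seq (p.code (d + 3)) (.seq (.const (d + 2) 1) (.add (d + 1) (d + 1) (d + 2))))))
          s' t s'' ∧
          t ≤ 1 + ∑ l ∈ Finset.Ico k n, (p.cost ((loopState p.eval i σ l).setReg i l) + 5) ∧
          s''.Agree U (loopState p.eval i σ n) ∧ ∀ r < d, U ≤ r → s''.reg r = s'.reg r := by
      intro j
      induction j with
      | zero =>
        intro k hk s' ha hb hc
        obtain rfl : k = n := by omega
        exact ⟨_, _, Exec.whileFalse (by rw [hb, hc]; omega), by simp, ha, fun _ _ _ => rfl⟩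
      | succ j ihj =>
        intro k hk s' ha hb hc
        set s₂ := (s'.setReg (d + 2) 0).setReg i
          ((s'.setReg (d + 2) 0).reg (d + 1) + (s'.setReg (d + 2) 0).reg (d + 2)) with hs₂
        have e₂ : s₂.Agree U ((loopState p.eval i σ k).setReg i k) := by
          refine ⟨fun r hr => ?_, by simp [hs₂, ha.2]⟩
          by_cases hri : r = i
          · simp [hs₂, hri, hc]
          · simp [hs₂, hri, show r ≠ d + 2 by omega, ha.1 r hr]
        obtain ⟨t₃, s₃, h₃, c₃, a₃, f₃⟩ := ih hp (d + 3) (by omega) s₂ _ e₂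
        have g1 : s₃.reg (d + 1) = k := by
          rw [f₃ _ (by omega) (by omega)]
          simp [hs₂, hc, show d + 1 ≠ i by omega]
        have g0 : s₃.reg d = e.eval σ := by
          rw [f₃ _ (by omega) (by omega)]
          simp [hs₂, hb, show d ≠ i by omega]
        set s₄ := (s₃.setReg (d + 2) 1).setReg (d + 1)
          ((s₃.setReg (d + 2) 1).reg (d + 1) + (s₃.setReg (d + 2) 1).reg (d + 2)) with hs₄
        obtain ⟨t₅, s₅, h₅, c₅, a₅, f₅⟩ := ihj (k + 1) (by omega) s₄
          ⟨fun r hr => by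
            simp [hs₄, show r ≠ d + 1 by omega, show r ≠ d + 2 by omega, a₃.1 r hr, loopState],
            by simp [hs₄, a₃.2, loopState]⟩
          (by simp [hs₄, g0]) (by simp [hs₄, g1])
        refine ⟨_, _, Exec.whileTrue (by rw [hb, hc]; omega) (Exec.seq (Exec.seq (Exec.const _ _ _)
          (Exec.add _ _ _ _)) (Exec.seq h₃ (Exec.seq (Exec.const _ _ _) (Exec.add _ _ _ _)))) h₅,
          ?_, a₅, ?_⟩
        · rw [Finset.sum_eq_sum_Ico_succ_bot (by omega : k < n)]
          omega
        · intro r hr hU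
          rw [f₅ r hr hU]
          simp [hs₄, show r ≠ d + 1 by omega, show r ≠ d + 2 by omega, f₃ r (by omega) hU, hs₂,
            show r ≠ i by omega]
    obtain ⟨t, s₂, h₂, c₂, a₂, f₂⟩ := key n 0 (by omega) (s₁.setReg (d + 1) 0)
      ⟨fun r hr => by simp [show r ≠ d + 1 by omega, f₁ r (by omega), hs.1 r hr, loopState],
        by simp [m₁, hs.2, loopState]⟩ (by simp [hv]) (by simp)
    refine ⟨_, _, Exec.seq h₁ (Exec.seq (Exec.const _ _ _) h₂), ?_, a₂, ?_⟩
    · simp only [cost, ← hn]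
      rw [← Finset.range_eq_Ico] at c₂
      omega
    · intro r hr hU
      rw [f₂ r hr hU]
      simp [show r ≠ d + 1 by omega, f₁ r hr]

end Cmd

infixr:60 " ;; " => Cmd.seq
infix:62 " ≔ " => Cmd.assign

/-! ### Elimination along a rooted tree of tables -/

/-- The number whose binary digits are the values of `β` on `l`. -/
def enc (β : ℤ → Bool) : List ℤ → ℕ
  | [] => 0
  | x :: l => (β x).toNat + 2 * enc β l

theorem enc_lt (β : ℤ → Bool) (l : List ℤ) : enc β l < 2 ^ l.length := by
  induction l with
  | nil => simp [enc]
  | cons x l ih =>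
    have : (β x).toNat ≤ 1 := Bool.toNat_le _
    simp only [enc, List.length_cons, pow_succ]
    omega

theorem enc_testBit (β : ℤ → Bool) {l : List ℤ} {i : ℕ} (hi : i < l.length) :
    (enc β l).testBit i = β (l.getD i 0) := by
  induction l generalizing i with
  | nil => simp at hi
  | cons x l ih =>
    cases i with
    | zero => cases h : β x <;> simp [enc, h, Nat.testBit_zero]
    | succ i =>
      have h2 : ((β x).toNat + 2 * enc β l) / 2 = enc β l := by
        have : (β x).toNat ≤ 1 := Bool.toNat_le _
        omega
      rw [enc, Nat.testBit_succ, h2, ih (by simpa using hi)]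
      simp

/-- The sum of the coefficients `a i` over the binary digits `1` of `idx` at positions `i < b`. -/
def lin (a : ℕ → ℤ) (b idx : ℕ) : ℤ := ∑ i ∈ Finset.range b, if idx.testBit i then a i else 0

/-- This and `lin_succ_high` say how a table of all values grows by one digit: the old half is kept,
and the new half is a shifted copy of it. `linearTable` doubles its table accordingly. -/
theorem lin_succ_low (a : ℕ → ℤ) {b j : ℕ} (hj : j < 2 ^ b) : lin a (b + 1) j = lin a b j := by
  simp [lin, Finset.sum_range_succ, Nat.testBit_lt_two_pow hj]

theorem lin_succ_high (a : ℕ → ℤ) {b j : ℕ} (hj : j < 2 ^ b) :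
    lin a (b + 1) (2 ^ b + j) = lin a b j + a b := by
  rw [lin, Finset.sum_range_succ, Nat.testBit_two_pow_add_eq, Nat.testBit_lt_two_pow hj, lin]
  simp only [Bool.not_false, if_true]
  congr 1
  refine Finset.sum_congr rfl fun i hi => ?_
  rw [Nat.testBit_two_pow_add_gt (by simpa using hi)]

theorem sum_digits_lt (f : ℕ → Bool) (b : ℕ) :
    ∑ i ∈ Finset.range b, (if f i then 2 ^ i else 0) < 2 ^ b := by
  induction b with
  | zero => simp
  | succ b ih => rw [Finset.sum_range_succ, pow_succ]; split <;> omega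

theorem sum_digits_inj {f g : ℕ → Bool} {b : ℕ}
    (h : ∑ i ∈ Finset.range b, (if f i then 2 ^ i else 0) =
      ∑ i ∈ Finset.range b, (if g i then 2 ^ i else 0)) : ∀ i < b, f i = g i := by
  induction b with
  | zero => simp
  | succ b ih =>
    rw [Finset.sum_range_succ, Finset.sum_range_succ] at h
    have hf := sum_digits_lt f b
    have hg := sum_digits_lt g b
    have hb : f b = g b := by
      cases hfb : f b <;> cases hgb : g b <;> simp [hfb, hgb] at h ⊢ <;> omega
    intro i hi
    rcases Nat.lt_succ_iff_lt_or_eq.1 hi with hi | rfl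
    · refine ih ?_ i hi
      rw [hb] at h
      omega
    · exact hb

/-- The coefficients that extract from an index of `B` its part on `P`. -/
def childCoef (B P : List ℤ) (i : ℕ) : ℤ :=
  ∑ l ∈ Finset.range P.length, if B.getD i 0 = P.getD l 0 then 2 ^ i else 0

/-- The coefficients that extract the same number from an index of `P`. -/
def parentCoef (B P : List ℤ) (l : ℕ) : ℤ :=
  ∑ i ∈ Finset.range B.length, if P.getD l 0 = B.getD i 0 then 2 ^ i else 0

theorem lin_enc (a : ℕ → ℤ) (β : ℤ → Bool) (l : List ℤ) :
    lin a l.length (enc β l) =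
      ∑ i ∈ Finset.range l.length, if β (l.getD i 0) then a i else 0 :=
  Finset.sum_congr rfl fun i hi => by rw [enc_testBit β (by simpa using hi)]

/-- Double counting: both sides sum `2 ^ i` over the pairs of equal entries of `B` and `P` whose
variable is true under `β`. -/
theorem lin_parentCoef (B P : List ℤ) (β : ℤ → Bool) :
    lin (parentCoef B P) P.length (enc β P) = lin (childCoef B P) B.length (enc β B) := by
  rw [lin_enc, lin_enc]
  have h1 : ∀ l, (if β (P.getD l 0) then parentCoef B P l else 0) =
      ∑ i ∈ Finset.range B.length,
        if P.getD l 0 = B.getD i 0 ∧ β (B.getD i 0) then 2 ^ i else 0 := by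
    intro l
    split_ifs with h
    · refine Finset.sum_congr rfl fun i _ => ?_
      by_cases h' : P.getD l 0 = B.getD i 0
      · rw [if_pos h', if_pos ⟨h', h' ▸ h⟩]
      · rw [if_neg h', if_neg fun hh => h' hh.1]
    · refine (Finset.sum_eq_zero fun i _ => if_neg ?_).symm
      rintro ⟨h1, h2⟩
      exact h (h1 ▸ h2)
  have h2 : ∀ i, (if β (B.getD i 0) then childCoef B P i else 0) =
      ∑ l ∈ Finset.range P.length,
        if P.getD l 0 = B.getD i 0 ∧ β (B.getD i 0) then 2 ^ i else 0 := by
    intro i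
    split_ifs with h
    · refine Finset.sum_congr rfl fun l _ => ?_
      simp only [h, and_true]
      exact if_congr eq_comm rfl rfl
    · exact (Finset.sum_eq_zero fun l _ => if_neg fun hh => h hh.2).symm
  simp only [h1, h2]
  exact Finset.sum_comm

theorem exists_getD_of_mem {l : List ℤ} {x : ℤ} (h : x ∈ l) : ∃ i < l.length, l.getD i 0 = x := by
  obtain ⟨i, hi, rfl⟩ := List.getElem_of_mem h
  exact ⟨i, hi, by simp [hi]⟩

theorem getD_mem {l : List ℤ} {i : ℕ} (h : i < l.length) : l.getD i 0 ∈ l := by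
  rw [List.getD_eq_getElem _ _ h]; exact List.getElem_mem h

theorem getD_inj {l : List ℤ} (hl : l.Nodup) {i j : ℕ} (hi : i < l.length) (hj : j < l.length)
    (h : l.getD i 0 = l.getD j 0) : i = j := by
  rw [List.getD_eq_getElem _ _ hi, List.getD_eq_getElem _ _ hj] at h
  exact (hl.getElem_inj_iff).1 h

/-- Without repetitions in `P`, an entry of `B` matches at most once. Hence `lin` with these
coefficients masks an index: digits of shared variables are kept, the others are cleared. -/
theorem childCoef_eq (B : List ℤ) {P : List ℤ} (hP : P.Nodup) (i : ℕ) :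
    childCoef B P i = if B.getD i 0 ∈ P then 2 ^ i else 0 := by
  split_ifs with h
  · obtain ⟨l, hl, hli⟩ := exists_getD_of_mem h
    rw [childCoef, Finset.sum_eq_single l]
    · rw [if_pos hli.symm]
    · intro l' hl' hne
      refine if_neg fun h' => hne (getD_inj hP (by simpa using hl') hl ?_)
      rw [← h', hli]
    · intro h'; simp [hl] at h'
  · refine Finset.sum_eq_zero fun l hl => if_neg fun h' => h ?_
    rw [h']
    exact getD_mem (by simpa using hl)

theorem lin_childCoef (B : List ℤ) {P : List ℤ} (hP : P.Nodup) (b idx : ℕ) :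
    lin (childCoef B P) b idx = ((∑ i ∈ Finset.range b,
      if (idx.testBit i && decide (B.getD i 0 ∈ P)) then 2 ^ i else 0 : ℕ) : ℤ) := by
  rw [lin, Nat.cast_sum]
  refine Finset.sum_congr rfl fun i _ => ?_
  rw [childCoef_eq B hP]
  by_cases h2 : B.getD i 0 ∈ P
  · rw [if_pos h2, decide_eq_true h2, Bool.and_true]
    split_ifs <;> simp
  · rw [if_neg h2, decide_eq_false h2, Bool.and_false]
    simp

/-- A masked index is again an index of the same table, so the minimizers of a node can be recorded
in the address range of its own table. -/
theorem lin_childCoef_range (B : List ℤ) {P : List ℤ} (hP : P.Nodup) (b idx : ℕ) :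
    ∃ k < 2 ^ b, lin (childCoef B P) b idx = (k : ℕ) :=
  ⟨_, sum_digits_lt _ b, lin_childCoef B hP b idx⟩

theorem testBit_eq_of_lin_childCoef {B P : List ℤ} (hP : P.Nodup) {b idx idx' : ℕ}
    (h : lin (childCoef B P) b idx = lin (childCoef B P) b idx') :
    ∀ i < b, B.getD i 0 ∈ P → idx.testBit i = idx'.testBit i := by
  rw [lin_childCoef B hP, lin_childCoef B hP, Nat.cast_inj] at h
  intro i hi hiP
  have := sum_digits_inj h i hi
  rwa [decide_eq_true hiP, Bool.and_true, Bool.and_true] at this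

/-- Change `β` on `l` to the binary digits of `idx`. -/
def updateBits (l : List ℤ) (idx : ℕ) (β : ℤ → Bool) : ℤ → Bool :=
  fun z => if z ∈ l then idx.testBit (l.idxOf z) else β z

theorem updateBits_getD {l : List ℤ} (hl : l.Nodup) (idx : ℕ) (β : ℤ → Bool) {i : ℕ}
    (hi : i < l.length) : updateBits l idx β (l.getD i 0) = idx.testBit i := by
  rw [updateBits, if_pos (getD_mem hi), List.getD_eq_getElem _ _ hi, hl.idxOf_getElem]

theorem enc_updateBits {l : List ℤ} (hl : l.Nodup) {idx : ℕ} (h : idx < 2 ^ l.length)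
    (β : ℤ → Bool) : enc (updateBits l idx β) l = idx := by
  refine Nat.eq_of_testBit_eq fun i => ?_
  by_cases hi : i < l.length
  · rw [enc_testBit _ hi, updateBits_getD hl _ _ hi]
  · have hp : 2 ^ l.length ≤ 2 ^ i := Nat.pow_le_pow_right (by norm_num) (by omega)
    rw [Nat.testBit_lt_two_pow (h.trans_le hp), Nat.testBit_lt_two_pow ((enc_lt _ _).trans_le hp)]

theorem enc_congr {β β' : ℤ → Bool} {l : List ℤ} (h : ∀ x ∈ l, β x = β' x) :
    enc β l = enc β' l := by
  induction l with
  | nil => rfl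
  | cons x l ih =>
    rw [enc, enc, h x (by simp), ih fun y hy => h y (by simp [hy])]

/-- A rooted tree with nodes `0, …, n` and root `n`, a list of variables for every node, and the
address at which the table of the node starts. -/
structure TableTree where
  n : ℕ
  bag : ℕ → List ℤ
  par : ℕ → ℕ
  off : ℕ → ℕ

namespace TableTree

/-- The field `last` is the running intersection property: a variable that is not passed on to the
parent occurs at no later node, so it may be minimized out when its node is eliminated. -/
structure Valid (G : TableTree) : Prop where
  nodup : ∀ t ≤ G.n, (G.bag t).Nodup
  lt_par : ∀ t < G.n, t < G.par t
  par_le : ∀ t < G.n, G.par t ≤ G.n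
  last : ∀ t < G.n, ∀ x ∈ G.bag t, x ∉ G.bag (G.par t) → ∀ s, t < s → s ≤ G.n → x ∉ G.bag s
  disjoint : ∀ s ≤ G.n, ∀ t ≤ G.n, s ≠ t →
    G.off s + 2 ^ (G.bag s).length ≤ G.off t ∨ G.off t + 2 ^ (G.bag t).length ≤ G.off s

variable (G : TableTree)

/-- Address `a` belongs to the table of node `t`. -/
def InTable (t : ℕ) (a : ℤ) : Prop :=
  (G.off t : ℤ) ≤ a ∧ a < G.off t + 2 ^ (G.bag t).length

/-- The coefficients of the part of an index of `t` that is shared with the parent. -/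
def coef (t : ℕ) : ℕ → ℤ := childCoef (G.bag t) (G.bag (G.par t))

/-- The index of `β` at `t` with the digits of the variables outside the parent's bag cleared. It
depends only on the shared variables. -/
def key (t : ℕ) (β : ℤ → Bool) : ℤ := lin (G.coef t) (G.bag t).length (enc β (G.bag t))

/-- The reassignment of the variables of node `t` that is recorded in the array `arg`. -/
def choose (arg : ℤ → ℤ) (t : ℕ) (β : ℤ → Bool) : ℤ → Bool :=
  updateBits (G.bag t) (arg (G.off t + G.key t β) - 1 - G.off t).toNat β

/-- Reassign the variables of the nodes `t - 1, …, 0`. -/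
def recon (arg : ℤ → ℤ) : ℕ → (ℤ → Bool) → (ℤ → Bool)
  | 0, β => β
  | t + 1, β => recon arg t (G.choose arg t β)

/-- The sum of the table entries of the nodes `t, …, n` for the assignment `β`. -/
def obj (T : ℤ → ℤ) (t : ℕ) (β : ℤ → Bool) : ℤ :=
  ∑ s ∈ Finset.Icc t G.n, T (G.off s + enc β (G.bag s))

/-- The effect of the elimination of node `t` on the tables and on the array of minimizers. -/
structure Push (t : ℕ) (T arg T' arg' : ℤ → ℤ) : Prop where
  argmin : ∀ β, ∃ idx : ℕ, idx < 2 ^ (G.bag t).length ∧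
    arg' (G.off t + G.key t β) = G.off t + idx + 1 ∧
    lin (G.coef t) (G.bag t).length idx = G.key t β ∧
    ∀ idx' < 2 ^ (G.bag t).length, lin (G.coef t) (G.bag t).length idx' = G.key t β →
      T (G.off t + idx) ≤ T (G.off t + idx')
  arg_frame : ∀ a, ¬ G.InTable t a → arg' a = arg a
  table : ∀ β, T' (G.off (G.par t) + enc β (G.bag (G.par t))) =
    T (G.off (G.par t) + enc β (G.bag (G.par t))) + T (arg' (G.off t + G.key t β) - 1)
  table_frame : ∀ a, ¬ G.InTable (G.par t) a → T' a = T a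

variable {G}

theorem inTable_add {t k : ℕ} (h : k < 2 ^ (G.bag t).length) : G.InTable t (G.off t + k) := by
  have : (k : ℤ) < 2 ^ (G.bag t).length := by exact_mod_cast h
  constructor <;> omega

theorem Valid.not_inTable (hG : G.Valid) {s t : ℕ} (hs : s ≤ G.n) (ht : t ≤ G.n) (hst : s ≠ t)
    {a : ℤ} (ha : G.InTable s a) : ¬ G.InTable t a := by
  rintro ⟨h1, h2⟩
  obtain ⟨h3, h4⟩ := ha
  rcases hG.disjoint s hs t ht hst with h | h
  · have : (G.off s : ℤ) + 2 ^ (G.bag s).length ≤ G.off t := by exact_mod_cast h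
    omega
  · have : (G.off t : ℤ) + 2 ^ (G.bag t).length ≤ G.off s := by exact_mod_cast h
    omega

theorem Valid.inTable_key (hG : G.Valid) {t : ℕ} (ht : t < G.n) (β : ℤ → Bool) :
    G.InTable t (G.off t + G.key t β) := by
  obtain ⟨k, hk, e⟩ := lin_childCoef_range (G.bag t) (hG.nodup _ (hG.par_le t ht))
    (G.bag t).length (enc β (G.bag t))
  rw [key, coef, e]
  exact inTable_add hk

/-- Undoing the elimination of the nodes below `t` reads only their own address ranges, so later
recordings do not disturb it. -/
theorem Valid.recon_congr (hG : G.Valid) {arg arg' : ℤ → ℤ} {t : ℕ} (ht : t ≤ G.n)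
    (h : ∀ s < t, ∀ a, G.InTable s a → arg a = arg' a) (β : ℤ → Bool) :
    G.recon arg t β = G.recon arg' t β := by
  induction t generalizing β with
  | zero => rfl
  | succ t ih =>
    rw [recon, recon, ih (by omega) (fun s hs => h s (by omega)), choose, choose,
      h t (by omega) _ (hG.inTable_key (by omega) β)]

/-- The node's table entry is replaced by its minimum over the indices with the same key, and this
minimum moves into the parent's entry. So the remaining sum can only drop, and it is attained after
switching the bag of `t` to the recorded minimizer, which leaves all later entries unchanged. -/
theorem Push.invariant (hG : G.Valid) {t : ℕ} (ht : t < G.n) {T₀ T arg T' arg' : ℤ → ℤ}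
    (hp : G.Push t T arg T' arg') (h1 : ∀ β, G.obj T t β ≤ G.obj T₀ 0 β)
    (h2 : ∀ β, G.obj T₀ 0 (G.recon arg t β) = G.obj T t β) :
    (∀ β, G.obj T' (t + 1) β ≤ G.obj T₀ 0 β) ∧
      ∀ β, G.obj T₀ 0 (G.recon arg' (t + 1) β) = G.obj T' (t + 1) β := by
  have hpar : G.par t ∈ Finset.Icc (t + 1) G.n :=
    Finset.mem_Icc.2 ⟨hG.lt_par t ht, hG.par_le t ht⟩
  have e1 : ∀ β, G.obj T t β = T (G.off t + enc β (G.bag t)) + G.obj T (t + 1) β := by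
    intro β
    rw [obj, obj, ← Finset.insert_Icc_add_one_left_eq_Icc ht.le, Finset.sum_insert (by simp)]
  -- Among the later nodes only the entry of the parent changes.
  have e2 : ∀ β, G.obj T' (t + 1) β =
      G.obj T (t + 1) β + T (arg' (G.off t + G.key t β) - 1) := by
    intro β
    rw [obj, obj, ← Finset.add_sum_erase _ _ hpar, ← Finset.add_sum_erase _ _ hpar, hp.table β]
    have : ∀ s ∈ (Finset.Icc (t + 1) G.n).erase (G.par t),
        T' (G.off s + enc β (G.bag s)) = T (G.off s + enc β (G.bag s)) := by
      intro s hs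
      simp only [Finset.mem_erase, Finset.mem_Icc] at hs
      exact hp.table_frame _ (hG.not_inTable hs.2.2 (hG.par_le t ht) hs.1
        (inTable_add (enc_lt _ _)))
    rw [Finset.sum_congr rfl this]
    ring
  refine ⟨fun β => ?_, fun β => ?_⟩
  · refine le_trans ?_ (h1 β)
    obtain ⟨idx, hidx, ha, hk, hmin⟩ := hp.argmin β
    rw [e1, e2, ha]
    have := hmin _ (enc_lt β _) rfl
    have e : (G.off t : ℤ) + idx + 1 - 1 = G.off t + idx := by ring
    rw [e]
    linarith
  · obtain ⟨idx, hidx, ha, hk, hmin⟩ := hp.argmin β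
    have hc : G.choose arg' t β = updateBits (G.bag t) idx β := by
      rw [choose, ha]
      congr 1
      omega
    -- The nodes before `t` see the old recordings, so `h2` applies to the assignment in which `t`
    -- has already been switched.
    rw [recon, hG.recon_congr ht.le (arg' := arg), h2, e1, e2, ha, hc]
    · have hn := hG.nodup t ht.le
      rw [enc_updateBits hn hidx]
      have e : (G.off t : ℤ) + idx + 1 - 1 = G.off t + idx := by ring
      rw [e, add_comm]
      congr 1
      refine Finset.sum_congr rfl fun s hs => ?_
      rw [Finset.mem_Icc] at hs
      congr 3
      refine enc_congr fun x hx => ?_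
      rw [updateBits]
      split_ifs with hxt
      -- A variable shared with the parent keeps its value because the keys agree; any other
      -- variable of `t` is absent from the later bag by `last`.
      · by_cases hxp : x ∈ G.bag (G.par t)
        · obtain ⟨i, hi, rfl⟩ := exists_getD_of_mem hxt
          have := testBit_eq_of_lin_childCoef (hG.nodup _ (hG.par_le t ht)) hk i hi hxp
          rw [List.getD_eq_getElem _ _ hi, hn.idxOf_getElem, this, enc_testBit _ hi,
            List.getD_eq_getElem _ _ hi]
        · exact absurd hx (hG.last t ht x hxt hxp s hs.1 hs.2)
      · rfl
    · intro s hs a has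
      exact hp.arg_frame a (hG.not_inTable (by omega) ht.le (by omega) has)

end TableTree

/-! ### The elimination of a node as a program -/

open Exp Cmd

attribute [-simp] List.getD_eq_getElem?_getD

/-- The list `l` is stored in array `6` from address `a` on. -/
def Segment (s : MachineState) (a : ℤ) (l : List ℤ) : Prop :=
  ∀ i < l.length, s.mem 6 (a + i) = l.getD i 0

theorem Segment.congr {s s' : MachineState} {a : ℤ} {l : List ℤ} (h : Segment s a l)
    (hm : s'.mem 6 = s.mem 6) : Segment s' a l := fun i hi => by rw [hm]; exact h i hi

/-! ### Comparing two bags: the coefficients of the index maps -/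

def matchInner (w : ℕ) : Cmd :=
  31 ≔ cell 6 (reg 22 + reg 25) ;;
  ifLT (reg 31) (reg 26) skip (ifLT (reg 26) (reg 31) skip (27 ≔ reg 27 + cell 12 (reg w)))

def matchBody (w : ℕ) : Cmd :=
  26 ≔ cell 6 (reg 20 + reg 24) ;; 27 ≔ lit 0 ;; loop 25 (reg 23) (matchInner w) ;;
  put 9 (reg 24) (reg 27)

/-- For every entry of the list at `reg 20` of length `reg 21`, add up the powers of two that
belong to equal entries of the list at `reg 22` of length `reg 23`. -/
def matchSum (w : ℕ) : Cmd := loop 24 (reg 21) (matchBody w)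

/-- The register `w` that selects the power is the outer counter (24) or the inner one (25). In this
way one routine computes both `childCoef` and `parentCoef`, where the exponent is always the
position in the child's bag. -/
theorem matchSum_spec {w : ℕ} (hw : w = 24 ∨ w = 25) {s : MachineState} {X Y : List ℤ}
    (hX : Segment s (s.reg 20) X) (hY : Segment s (s.reg 22) Y) (h21 : s.reg 21 = X.length)
    (h23 : s.reg 23 = Y.length) (hP : ∀ i < X.length, ∀ l < Y.length,
      s.mem 12 (if w = 24 then i else l : ℕ) = 2 ^ (if w = 24 then i else l)) :
    (∀ i < X.length, ((matchSum w).eval s).mem 9 i = ∑ l ∈ Finset.range Y.length,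
      if X.getD i 0 = Y.getD l 0 then 2 ^ (if w = 24 then i else l) else 0) ∧
    (matchSum w).cost s ≤ 50 * ((X.length + 1) * (Y.length + 1)) := by
  have := loop_rule' (i := 24) (e := reg 21) (p := matchBody w) (s := s) (n := X.length)
    (by simp [h21]) (fun k τ => ∀ i < k, τ.mem 9 i = ∑ l ∈ Finset.range Y.length,
      if X.getD i 0 = Y.getD l 0 then 2 ^ (if w = 24 then i else l) else 0)
    (30 + Y.length * 40) (by simp) ?_
  · refine ⟨this.1, this.2.trans ?_⟩
    simp only [cost_reg]
    nlinarith
  intro k hk τ hr hm hI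
  set τ' := (26 ≔ cell 6 (reg 20 + reg 24) ;; 27 ≔ lit 0).eval (τ.setReg 24 k) with hτ'
  have h20 : τ.reg 20 = s.reg 20 := hr 20 rfl
  have h22 : τ.reg 22 = s.reg 22 := hr 22 rfl
  have h23' : τ.reg 23 = s.reg 23 := hr 23 rfl
  have m6 : τ.mem 6 = s.mem 6 := hm 6 rfl
  have m12 : τ.mem 12 = s.mem 12 := hm 12 rfl
  have := loop_rule' (i := 25) (e := reg 23) (p := matchInner w) (s := τ') (n := Y.length)
    (by simp [hτ', h23', h23]) (fun l τ => τ.reg 27 = ∑ l ∈ Finset.range l,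
      if X.getD k 0 = Y.getD l 0 then 2 ^ (if w = 24 then k else l) else 0)
    35 (by simp [hτ']) ?_
  · refine ⟨fun i hi => ?_, ?_⟩
    · have e : (matchBody w).eval (τ.setReg 24 k) =
        (put 9 (reg 24) (reg 27)).eval ((loop 25 (reg 23) (matchInner w)).eval τ') := rfl
      have f24 : ((loop 25 (reg 23) (matchInner w)).eval τ').reg 24 = k := by
        rw [frame_reg _ _ rfl]; simp [hτ']
      have f9 : ((loop 25 (reg 23) (matchInner w)).eval τ').mem 9 = τ.mem 9 := by
        rw [frame_mem _ _ rfl]; simp [hτ']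
      rw [e]
      simp only [eval_put, eval_reg, f24, f9, this.1, MachineState.setMem_mem, if_true]
      by_cases hik : i = k
      · subst hik; simp
      · rw [Function.update_of_ne (by exact_mod_cast hik), hI i (by omega)]
    · have := this.2
      simp only [cost_reg] at this
      simp only [matchBody, cost_seq, cost_assign, cost_put, cost_cell, cost_add, cost_reg,
        cost_lit]
      change _ + (_ + ((loop 25 (reg 23) (matchInner w)).cost τ' + _)) ≤ _
      omega
  intro l hl υ hr' hm' hI'
  have g22 : υ.reg 22 = s.reg 22 := by
    rw [hr' 22 rfl]; simp [hτ', h22]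
  have g26 : υ.reg 26 = X.getD k 0 := by
    rw [hr' 26 rfl]; simp [hτ', m6, h20, hX k hk]
  have g24 : υ.reg 24 = k := by
    rw [hr' 24 rfl]; simp [hτ']
  have n6 : υ.mem 6 = s.mem 6 := by
    rw [hm' 6 rfl]; simp [hτ', m6]
  have n12 : υ.mem 12 = s.mem 12 := by
    rw [hm' 12 rfl]; simp [hτ', m12]
  have hp := hP k hk l hl
  have hw' : (υ.setReg 25 l).mem 12 ((if w = 25 then (l : ℤ) else υ.reg w)) =
      2 ^ (if w = 24 then k else l) := by
    rcases hw with rfl | rfl <;> simpa [g24, n12] using hp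
  refine ⟨?_, by simp [matchInner]⟩
  rw [Finset.sum_range_succ, ← hI']
  have hYl := hY l hl
  rcases lt_trichotomy (Y.getD l 0) (X.getD k 0) with h | h | h
  · rw [if_neg h.ne']
    simp [matchInner, g22, g26, n6, hYl, h]
  · rw [if_pos h.symm, ← hw']
    simp [matchInner, g22, g26, n6, hYl, h]
    rcases hw with rfl | rfl <;> simp
  · rw [if_neg h.ne]
    simp [matchInner, g22, g26, n6, hYl, h, h.not_gt]

theorem sum_two_pow_add_one (b : ℕ) : ∑ i ∈ Finset.range b, 2 ^ i + 1 = 2 ^ b := by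
  induction b with
  | zero => simp
  | succ b ih => rw [Finset.sum_range_succ, pow_succ]; omega

/-! ### Tabulating an index map by doubling -/

def linearInner : Cmd := put 11 (reg 28 + reg 30) (cell 11 (reg 30) + reg 31)

def linearBody : Cmd :=
  31 ≔ cell 9 (reg 29) ;; loop 30 (reg 28) linearInner ;; 28 ≔ reg 28 + reg 28

/-- Compute all sums of the first `reg 21` entries of array `9` over the binary digits of the
index. -/
def linearTable : Cmd := 28 ≔ lit 1 ;; put 11 (lit 0) (lit 0) ;; loop 29 (reg 21) linearBody

/-- Round `k` copies `2 ^ k` cells with a shift, so the costs form a geometric sum. Evaluating each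
index separately would cost a further factor `b`, which the claimed running time does not allow. -/
theorem linearTable_spec {s : MachineState} {b : ℕ} {a : ℕ → ℤ} (h21 : s.reg 21 = b)
    (ha : ∀ i < b, s.mem 9 i = a i) :
    (∀ j : ℕ, j < 2 ^ b → (linearTable.eval s).mem 11 j = lin a b j) ∧
    (linearTable.eval s).reg 28 = 2 ^ b ∧ linearTable.cost s ≤ 100 * 2 ^ b := by
  set s' := (28 ≔ lit 1 ;; put 11 (lit 0) (lit 0)).eval s with hs'
  have := loop_rule (i := 29) (e := reg 21) (p := linearBody) (s := s') (n := b)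
    (by simp [hs', h21]) (fun k τ => τ.reg 28 = 2 ^ k ∧ ∀ j : ℕ, j < 2 ^ k → τ.mem 11 j = lin a k j)
    (fun k => 20 + 2 ^ k * 20) (by simp [hs', lin]) ?_
  · refine ⟨this.1.2, this.1.1, ?_⟩
    have h2 := this.2
    simp only [linearTable, cost_seq, cost_assign, cost_put, cost_lit]
    change _ + (_ + (loop 29 (reg 21) linearBody).cost s') ≤ _
    have h3 : ∑ k ∈ Finset.range b, (20 + 2 ^ k * 20 + 5) ≤ ∑ k ∈ Finset.range b, 45 * 2 ^ k := by
      refine Finset.sum_le_sum fun k _ => ?_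
      have := Nat.one_le_two_pow (n := k)
      omega
    rw [← Finset.mul_sum] at h3
    have h4 := sum_two_pow_add_one b
    simp only [cost_reg] at h2
    omega
  rintro k hk τ hr hm ⟨hI1, hI2⟩
  set τ' := (31 ≔ cell 9 (reg 29)).eval (τ.setReg 29 k) with hτ'
  have m9 : τ.mem 9 = s.mem 9 := by rw [hm 9 rfl]; simp [hs']
  have := loop_rule' (i := 30) (e := reg 28) (p := linearInner) (s := τ') (n := 2 ^ k)
    (by simp [hτ', hI1]) (fun l υ => (∀ j : ℕ, j < 2 ^ k → υ.mem 11 j = lin a k j) ∧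
      ∀ j : ℕ, j < l → υ.mem 11 (2 ^ k + j : ℕ) = lin a k j + a k) 12
    (by simpa [hτ'] using hI2) ?_
  · obtain ⟨⟨h1, h2⟩, h3⟩ := this
    refine ⟨⟨?_, fun j hj => ?_⟩, ?_⟩
    · change ((28 ≔ reg 28 + reg 28).eval ((loop 30 (reg 28) linearInner).eval τ')).reg 28 = _
      have f28 : ((loop 30 (reg 28) linearInner).eval τ').reg 28 = 2 ^ k := by
        rw [frame_reg _ _ rfl]; simp [hτ', hI1]
      simp [f28, pow_succ]; ring
    · change ((loop 30 (reg 28) linearInner).eval τ').mem 11 j = _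
      by_cases hjk : j < 2 ^ k
      · rw [h1 j hjk, lin_succ_low _ hjk]
      · obtain ⟨j, rfl⟩ := Nat.exists_eq_add_of_le (not_lt.1 hjk)
        have : j < 2 ^ k := by rw [pow_succ] at hj; omega
        rw [h2 j this, lin_succ_high _ this]
    · simp only [linearBody, cost_seq, cost_assign, cost_cell, cost_reg, cost_add]
      change _ + ((loop 30 (reg 28) linearInner).cost τ' + _) ≤ _
      simp only [cost_reg] at h3
      omega
  rintro l hl υ hr' hm' ⟨h1, h2⟩
  have g28 : υ.reg 28 = 2 ^ k := by rw [hr' 28 rfl]; simp [hτ', hI1]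
  have g31 : υ.reg 31 = a k := by rw [hr' 31 rfl]; simp [hτ', m9, ha k hk]
  refine ⟨⟨fun j hj => ?_, fun j hj => ?_⟩, by simp [linearInner]⟩
  · have : (j : ℤ) ≠ 2 ^ k + l := by
      have : j ≠ 2 ^ k + l := by omega
      exact_mod_cast this
    simp [linearInner, g28, Function.update_of_ne this, h1 j hj]
  · by_cases hjl : j = l
    · subst hjl
      simp [linearInner, g28, g31, h1 j hl]
    · have : ((2 ^ k + j : ℕ) : ℤ) ≠ 2 ^ k + l := by
        have : 2 ^ k + j ≠ 2 ^ k + l := by omega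
        exact_mod_cast this
      have h2' := h2 j (by omega)
      push_cast at this h2'
      simp [linearInner, g28, Function.update_of_ne this, h2']

/-! ### Recording minimizers and updating the parent -/

def argminBody : Cmd :=
  33 ≔ reg 14 + cell 11 (reg 32) ;; 34 ≔ cell 8 (reg 33) ;;
  ifLT (reg 34) (lit 1) (put 8 (reg 33) (reg 14 + reg 32 + lit 1))
    (ifLT (cell 7 (reg 14 + reg 32)) (cell 7 (reg 34 - lit 1))
      (put 8 (reg 33) (reg 14 + reg 32 + lit 1)) skip)

/-- Record in array `8`, for every value in the first `reg 28` cells of array `11`, the address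
plus one of the smallest entry of the table at `reg 14` whose index has this value. -/
def argminTable : Cmd := loop 32 (reg 28) argminBody

/-- Zero means that a value has not been met yet, which is why addresses are recorded plus one and
why `h8` is needed. Ties keep the earlier index. -/
theorem argminTable_spec {s : MachineState} {o N : ℕ} {K : ℕ → ℕ} (h14 : s.reg 14 = o)
    (h28 : s.reg 28 = N) (hK : ∀ i < N, s.mem 11 i = K i) (hKN : ∀ i < N, K i < N)
    (h8 : ∀ z < N, s.mem 8 (o + z : ℕ) = 0) :
    ((∀ i < N, ∃ j < N, (argminTable.eval s).mem 8 (o + K i : ℕ) = (o + j + 1 : ℕ) ∧ K j = K i ∧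
      ∀ j' < N, K j' = K i → s.mem 7 (o + j : ℕ) ≤ s.mem 7 (o + j' : ℕ)) ∧
    ∀ a, ¬ ((o : ℤ) ≤ a ∧ a < o + N) → (argminTable.eval s).mem 8 a = s.mem 8 a) ∧
    argminTable.cost s ≤ 60 * (N + 1) := by
  have := loop_rule' (i := 32) (e := reg 28) (p := argminBody) (s := s) (n := N)
    -- The second clause keeps the cells of values not yet met at zero, so the first index with a
    -- new value is recognized.
    (by simp [h28]) (fun k τ => (∀ i < k, ∃ j < k, τ.mem 8 (o + K i : ℕ) = (o + j + 1 : ℕ) ∧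
        K j = K i ∧ ∀ j' < k, K j' = K i → s.mem 7 (o + j : ℕ) ≤ s.mem 7 (o + j' : ℕ)) ∧
      (∀ z < N, (∀ i < k, K i ≠ z) → τ.mem 8 (o + z : ℕ) = 0) ∧
      ∀ a, ¬ ((o : ℤ) ≤ a ∧ a < o + N) → τ.mem 8 a = s.mem 8 a) 50
    (by simpa using h8) ?_
  · obtain ⟨⟨h1, -, h2⟩, h3⟩ := this
    refine ⟨⟨h1, h2⟩, h3.trans ?_⟩
    simp only [cost_reg]
    omega
  rintro k hk τ hr hm ⟨h1, h2, h3⟩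
  have g14 : τ.reg 14 = o := by rw [hr 14 rfl, h14]
  have m7 : τ.mem 7 = s.mem 7 := hm 7 rfl
  have m11 : τ.mem 11 k = K k := by rw [hm 11 rfl, hK k hk]
  refine ⟨?_, by simp [argminBody]⟩
  -- the entry of `k` is either recorded or not
  have hcase : ((argminBody.eval (τ.setReg 32 k)).mem 8 =
        Function.update (τ.mem 8) (o + K k : ℕ) (o + k + 1 : ℕ) ∧
        ∀ i < k, K i = K k → s.mem 7 (o + k : ℕ) ≤ s.mem 7 (o + i : ℕ)) ∨
      ((argminBody.eval (τ.setReg 32 k)).mem 8 = τ.mem 8 ∧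
        ∃ i < k, K i = K k ∧ τ.mem 8 (o + K k : ℕ) = (o + i + 1 : ℕ) ∧
          s.mem 7 (o + i : ℕ) ≤ s.mem 7 (o + k : ℕ)) := by
    by_cases hex : ∃ i < k, K i = K k
    · obtain ⟨i, hik, hKi⟩ := hex
      obtain ⟨j, hj, e, hKj, hmin⟩ := h1 i hik
      rw [hKi] at e hKj hmin
      have e' : τ.mem 8 (o + (K k : ℤ)) = o + j + 1 := by exact_mod_cast e
      have hlt : ¬ ((o : ℤ) + j < 0) := by omega
      by_cases hl : s.mem 7 (o + k : ℕ) < s.mem 7 (o + j : ℕ)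
      · refine Or.inl ⟨?_, fun i' hi' h' => hl.le.trans (hmin i' hi' h')⟩
        have hl' : s.mem 7 ((o : ℤ) + k) < s.mem 7 ((o : ℤ) + j) := by exact_mod_cast hl
        simp [argminBody, g14, m7, m11, e', hlt, hl']
      · refine Or.inr ⟨?_, j, hj, hKj, e, not_lt.1 hl⟩
        have hl' : ¬ s.mem 7 ((o : ℤ) + k) < s.mem 7 ((o : ℤ) + j) := by exact_mod_cast hl
        simp [argminBody, g14, m7, m11, e', hlt, hl']
    · refine Or.inl ⟨?_, fun i hi h' => absurd ⟨i, hi, h'⟩ hex⟩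
      have e : τ.mem 8 (o + K k : ℕ) = 0 :=
        h2 _ (hKN k hk) fun i hi h' => hex ⟨i, hi, h'⟩
      have e' : τ.mem 8 (o + (K k : ℤ)) = 0 := by exact_mod_cast e
      simp [argminBody, g14, m11, e']
  rcases hcase with ⟨e, hmin⟩ | ⟨e, j, hj, hKj, hj8, hle⟩
  · rw [e]
    refine ⟨fun i hi => ?_, fun z hz hi => ?_, fun a ha => ?_⟩
    · by_cases hKi : K i = K k
      · refine ⟨k, by omega, by rw [hKi]; simp, hKi.symm, fun j' hj' h' => ?_⟩
        rcases Nat.lt_succ_iff_lt_or_eq.1 hj' with hj' | rfl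
        · exact hmin j' hj' (h'.trans hKi)
        · exact le_rfl
      · have hik : i < k := by
          rcases Nat.lt_succ_iff_lt_or_eq.1 hi with h | rfl
          · exact h
          · exact absurd rfl hKi
        obtain ⟨j, hj, e, hKj, hm⟩ := h1 i hik
        refine ⟨j, by omega, ?_, hKj, fun j' hj' h' => ?_⟩
        · rw [Function.update_of_ne (by simpa using hKi), e]
        · rcases Nat.lt_succ_iff_lt_or_eq.1 hj' with hj' | rfl
          · exact hm j' hj' h'
          · exact absurd h'.symm hKi
    · rw [Function.update_of_ne (by simpa using (hi k (by omega)).symm)]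
      exact h2 z hz fun i hik => hi i (by omega)
    · rw [Function.update_of_ne, h3 a ha]
      have := hKN k hk
      rintro rfl
      exact ha ⟨by push_cast; omega, by push_cast; omega⟩
  · rw [e]
    refine ⟨fun i hi => ?_, fun z hz hi => h2 z hz fun i hik => hi i (by omega), h3⟩
    -- If the recorded minimizer stays, then `k` has the same value as an earlier index and inherits
    -- its record.
    have hex : ∃ i' < k, K i' = K i := by
      rcases Nat.lt_succ_iff_lt_or_eq.1 hi with h | rfl
      · exact ⟨i, h, rfl⟩
      · exact ⟨j, hj, hKj⟩
    obtain ⟨i', hi', hKi'⟩ := hex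
    obtain ⟨j', hj', e', hKj', hm'⟩ := h1 i' hi'
    rw [hKi'] at e' hKj' hm'
    refine ⟨j', by omega, e', hKj', fun l hl hKl => ?_⟩
    rcases Nat.lt_succ_iff_lt_or_eq.1 hl with hl | rfl
    · exact hm' l hl hKl
    · exact (hm' j hj (hKj.trans hKl)).trans hle

def addBody : Cmd :=
  put 7 (reg 16 + reg 32)
    (cell 7 (reg 16 + reg 32) + cell 7 (cell 8 (reg 14 + cell 11 (reg 32)) - lit 1))

/-- Add the recorded minima to the table at `reg 16`. -/
def addTable : Cmd := loop 32 (reg 28) addBody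

/-- The update is done in place. By `hA` the added entries lie outside the block that is being
written, so they are still the original ones when they are read. -/
theorem addTable_spec {s : MachineState} {q N : ℕ} (h16 : s.reg 16 = q) (h28 : s.reg 28 = N)
    (hA : ∀ i < N, ¬ ((q : ℤ) ≤ s.mem 8 (s.reg 14 + s.mem 11 i) - 1 ∧
      s.mem 8 (s.reg 14 + s.mem 11 i) - 1 < q + N)) :
    ((∀ i < N, (addTable.eval s).mem 7 (q + i : ℕ) =
      s.mem 7 (q + i : ℕ) + s.mem 7 (s.mem 8 (s.reg 14 + s.mem 11 i) - 1)) ∧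
    ∀ a, ¬ ((q : ℤ) ≤ a ∧ a < q + N) → (addTable.eval s).mem 7 a = s.mem 7 a) ∧
    addTable.cost s ≤ 40 * (N + 1) := by
  have := loop_rule' (i := 32) (e := reg 28) (p := addBody) (s := s) (n := N)
    (by simp [h28]) (fun k τ => (∀ i < k, τ.mem 7 (q + i : ℕ) =
      s.mem 7 (q + i : ℕ) + s.mem 7 (s.mem 8 (s.reg 14 + s.mem 11 i) - 1)) ∧
      ∀ a, ¬ ((q : ℤ) ≤ a ∧ a < q + k) → τ.mem 7 a = s.mem 7 a) 30 (by simp) ?_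
  · refine ⟨this.1, this.2.trans ?_⟩
    simp only [cost_reg]
    omega
  rintro k hk τ hr hm ⟨h1, h2⟩
  have g14 : τ.reg 14 = s.reg 14 := hr 14 rfl
  have g16 : τ.reg 16 = q := by rw [hr 16 rfl, h16]
  have m8 : τ.mem 8 = s.mem 8 := hm 8 rfl
  have m11 : τ.mem 11 = s.mem 11 := hm 11 rfl
  have e1 : τ.mem 7 (s.mem 8 (s.reg 14 + s.mem 11 k) - 1) =
      s.mem 7 (s.mem 8 (s.reg 14 + s.mem 11 k) - 1) :=
    h2 _ fun h => hA k hk ⟨h.1, h.2.trans (by omega)⟩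
  have e2 : τ.mem 7 ((q : ℤ) + k) = s.mem 7 ((q : ℤ) + k) := h2 _ (by omega)
  have e : (addBody.eval (τ.setReg 32 k)).mem 7 = Function.update (τ.mem 7) ((q : ℤ) + k)
      (s.mem 7 ((q : ℤ) + k) + s.mem 7 (s.mem 8 (s.reg 14 + s.mem 11 k) - 1)) := by
    simp [addBody, g14, g16, m8, m11, e1, e2]
  refine ⟨⟨fun i hi => ?_, fun a ha => ?_⟩, by simp [addBody]⟩
  · rw [e]
    by_cases hik : i = k
    · subst hik; simp
    · rw [Function.update_of_ne (by push_cast; omega), h1 i (by omega)]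
  · rw [e, Function.update_of_ne (by rintro rfl; exact ha ⟨by omega, by push_cast; omega⟩)]
    exact h2 a fun h => ha ⟨h.1, by push_cast; omega⟩

/-- Length, address and bag of node `t` are stored in the state. -/
structure TableTree.NodeStored (G : TableTree) (s : MachineState) (t : ℕ) : Prop where
  len : s.mem 3 t = (G.bag t).length
  off : s.mem 5 t = G.off t
  bag : Segment s (G.off t) (G.bag t)

theorem TableTree.NodeStored.congr {G : TableTree} {s s' : MachineState} {t : ℕ}
    (h : G.NodeStored s t) (h3 : s'.mem 3 = s.mem 3) (h5 : s'.mem 5 = s.mem 5)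
    (h6 : s'.mem 6 = s.mem 6) : G.NodeStored s' t :=
  ⟨by rw [h3, h.len], by rw [h5, h.off], h.bag.congr h6⟩

structure TableTree.Stored (G : TableTree) (s : MachineState) : Prop where
  node : ∀ t ≤ G.n, G.NodeStored s t
  par : ∀ t < G.n, s.mem 2 t = G.par t

theorem TableTree.Stored.congr {G : TableTree} {s s' : MachineState} (h : G.Stored s)
    (h2 : s'.mem 2 = s.mem 2) (h3 : s'.mem 3 = s.mem 3) (h5 : s'.mem 5 = s.mem 5)
    (h6 : s'.mem 6 = s.mem 6) : G.Stored s' :=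
  ⟨fun t ht => (h.node t ht).congr h3 h5 h6, fun t ht => by rw [h2, h.par t ht]⟩

def powerBody : Cmd := put 12 (reg 24) (reg 28) ;; 28 ≔ reg 28 + reg 28

/-- Store the powers of two with exponent below `reg 15` in array `12`. -/
def powers : Cmd := 28 ≔ lit 1 ;; loop 24 (reg 15) powerBody

theorem powers_spec {s : MachineState} {b : ℕ} (h15 : s.reg 15 = b) :
    (∀ i < b, (powers.eval s).mem 12 i = 2 ^ i) ∧ powers.cost s ≤ 40 * (b + 1) := by
  set s' := (28 ≔ lit 1).eval s with hs'
  have := loop_rule' (i := 24) (e := reg 15) (p := powerBody) (s := s') (n := b)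
    (by simp [hs', h15]) (fun k τ => τ.reg 28 = 2 ^ k ∧ ∀ i < k, τ.mem 12 i = 2 ^ i) 30
    (by simp [hs']) ?_
  · refine ⟨this.1.2, ?_⟩
    have h := this.2
    simp only [powers, cost_seq, cost_assign, cost_lit]
    change _ + (loop 24 (reg 15) powerBody).cost s' ≤ _
    simp only [cost_reg] at h
    omega
  rintro k hk τ hr hm ⟨h1, h2⟩
  refine ⟨⟨?_, fun i hi => ?_⟩, by simp [powerBody]⟩
  · simp [powerBody, h1, pow_succ]; ring
  · by_cases hik : i = k
    · subst hik; simp [powerBody, h1]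
    · have : (i : ℤ) ≠ k := by exact_mod_cast hik
      simp [powerBody, Function.update_of_ne this, h2 i (by omega)]

/-! ### Eliminating one node -/

def enterNode : Cmd :=
  14 ≔ cell 5 (reg 13) ;; 15 ≔ cell 3 (reg 13) ;; 18 ≔ cell 2 (reg 13) ;;
  16 ≔ cell 5 (reg 18) ;; 17 ≔ cell 3 (reg 18) ;; 20 ≔ reg 14 ;; 21 ≔ reg 15 ;;
  22 ≔ reg 16 ;; 23 ≔ reg 17

def swapNodes : Cmd := 20 ≔ reg 16 ;; 21 ≔ reg 17 ;; 22 ≔ reg 14 ;; 23 ≔ reg 15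

/-- Load the data of node `reg 13` and of its parent, and compute the coefficients of the node. -/
def enter : Cmd := enterNode ;; powers ;; matchSum 24

theorem enter_spec {G : TableTree} {s : MachineState} {t : ℕ} (hG : G.Valid) (hS : G.Stored s)
    (ht : t < G.n) (h13 : s.reg 13 = t) :
    ((enter.eval s).reg 14 = G.off t ∧ (enter.eval s).reg 15 = (G.bag t).length ∧
      (enter.eval s).reg 16 = G.off (G.par t) ∧
      (enter.eval s).reg 17 = (G.bag (G.par t)).length ∧
      (enter.eval s).reg 21 = (G.bag t).length) ∧
    (∀ i < (G.bag t).length, (enter.eval s).mem 9 i = G.coef t i) ∧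
    (∀ i < (G.bag t).length, (enter.eval s).mem 12 i = 2 ^ i) ∧
    enter.cost s ≤ 150 * (((G.bag t).length + 1) * ((G.bag (G.par t)).length + 1)) := by
  obtain ⟨l1, o1, b1⟩ := hS.node t ht.le
  obtain ⟨l2, o2, b2⟩ := hS.node _ (hG.par_le t ht)
  have hp := hS.par t ht
  set s₁ := enterNode.eval s with hs₁
  have e14 : s₁.reg 14 = G.off t := by simp [hs₁, enterNode, h13, o1]
  have e15 : s₁.reg 15 = (G.bag t).length := by simp [hs₁, enterNode, h13, l1]
  have e16 : s₁.reg 16 = G.off (G.par t) := by simp [hs₁, enterNode, h13, hp, o2]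
  have e17 : s₁.reg 17 = (G.bag (G.par t)).length := by simp [hs₁, enterNode, h13, hp, l2]
  have e20 : s₁.reg 20 = G.off t := by simp [hs₁, enterNode, h13, o1]
  have e21 : s₁.reg 21 = (G.bag t).length := by simp [hs₁, enterNode, h13, l1]
  have e22 : s₁.reg 22 = G.off (G.par t) := by simp [hs₁, enterNode, h13, hp, o2]
  have e23 : s₁.reg 23 = (G.bag (G.par t)).length := by simp [hs₁, enterNode, h13, hp, l2]
  have m6 : s₁.mem 6 = s.mem 6 := by simp [hs₁, enterNode]
  obtain ⟨p12, cp⟩ := powers_spec e15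
  set s₂ := powers.eval s₁ with hs₂
  have f : ∀ r, powers.writesReg r = false → s₂.reg r = s₁.reg r := fun r hr => frame_reg _ _ hr
  have m6' : s₂.mem 6 = s.mem 6 := by rw [hs₂, frame_mem _ _ rfl, m6]
  have hM := matchSum_spec (w := 24) (Or.inl rfl) (s := s₂) (X := G.bag t) (Y := G.bag (G.par t))
    (by rw [f 20 rfl, e20]; exact b1.congr m6') (by rw [f 22 rfl, e22]; exact b2.congr m6')
    (by rw [f 21 rfl, e21]) (by rw [f 23 rfl, e23]) (by simpa using fun i hi _ _ => p12 i hi)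
  have e : enter.eval s = (matchSum 24).eval s₂ := rfl
  have g : ∀ r, (matchSum 24).writesReg r = false → (enter.eval s).reg r = s₂.reg r :=
    fun r hr => by rw [e, frame_reg _ _ hr]
  refine ⟨⟨?_, ?_, ?_, ?_, ?_⟩, ?_, ?_, ?_⟩
  · rw [g 14 rfl, f 14 rfl, e14]
  · rw [g 15 rfl, f 15 rfl, e15]
  · rw [g 16 rfl, f 16 rfl, e16]
  · rw [g 17 rfl, f 17 rfl, e17]
  · rw [g 21 rfl, f 21 rfl, e21]
  · simpa [e, TableTree.coef, childCoef] using hM.1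
  · rw [e, frame_mem _ _ rfl]
    exact p12
  · have c1 : enterNode.cost s ≤ 60 := by simp [enterNode]
    have c3 := hM.2
    have : enter.cost s = enterNode.cost s + (powers.cost s₁ + (matchSum 24).cost s₂) := rfl
    rw [this]
    nlinarith

def pushNode : Cmd :=
  enter ;; linearTable ;; argminTable ;; swapNodes ;; matchSum 25 ;; linearTable ;; addTable

theorem exists_enc_eq {l : List ℤ} (hl : l.Nodup) {i : ℕ} (hi : i < 2 ^ l.length) :
    ∃ β, enc β l = i := ⟨_, enc_updateBits hl hi fun _ => false⟩

/-- The coefficients cost a product of bag lengths, everything else is linear in the two table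
sizes. After `swapNodes` the same routines tabulate, for each index of the parent, the key under
which the child recorded its minimizer. -/
theorem pushNode_spec {G : TableTree} {s : MachineState} {t : ℕ} (hG : G.Valid) (hS : G.Stored s)
    (ht : t < G.n) (h13 : s.reg 13 = t) (h8 : ∀ a, G.InTable t a → s.mem 8 a = 0) :
    G.Push t (s.mem 7) (s.mem 8) ((pushNode.eval s).mem 7) ((pushNode.eval s).mem 8) ∧
    pushNode.cost s ≤ 300 * (((G.bag t).length + 1) * ((G.bag (G.par t)).length + 1)) +
      200 * (2 ^ (G.bag t).length + 2 ^ (G.bag (G.par t)).length) := by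
  have hpn := hG.nodup _ (hG.par_le t ht)
  obtain ⟨⟨e14, e15, e16, e17, e21⟩, e9, e12, c1⟩ := enter_spec hG hS ht h13
  set b := (G.bag t).length with hb
  set c := (G.bag (G.par t)).length with hc
  set s₁ := enter.eval s with hs₁
  obtain ⟨L1, z1, c2⟩ := linearTable_spec e21 e9
  set s₂ := linearTable.eval s₁ with hs₂
  have r₂ : ∀ r, linearTable.writesReg r = false → s₂.reg r = s₁.reg r :=
    fun r hr => frame_reg _ _ hr
  have m₂ : ∀ a, (enter ;; linearTable).writesMem a = false → s₂.mem a = s.mem a :=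
    fun a ha => frame_mem (enter ;; linearTable) s ha
  -- `K i` is the index `i` with the unshared digits cleared.
  choose! K hKlt hK using fun i => lin_childCoef_range (G.bag t) hpn b i
  change ∀ i, lin (G.coef t) b i = (K i : ℕ) at hK
  obtain ⟨⟨A1, A2⟩, c3⟩ := argminTable_spec (s := s₂) (o := G.off t) (N := 2 ^ b) (K := K)
    (by rw [r₂ 14 rfl, e14]) (by rw [z1]; push_cast; rfl)
    (fun i hi => by rw [L1 i hi, hK]) (fun i _ => hKlt i)
    (fun z hz => by
      rw [m₂ 8 rfl]; push_cast; exact h8 _ (TableTree.inTable_add hz))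
  set s₃ := argminTable.eval s₂ with hs₃
  have r₃ : ∀ r, (linearTable ;; argminTable).writesReg r = false → s₃.reg r = s₁.reg r :=
    fun r hr => frame_reg (linearTable ;; argminTable) s₁ hr
  set s₄ := swapNodes.eval s₃ with hs₄
  have m₄ : ∀ a, (enter ;; linearTable ;; argminTable ;; swapNodes).writesMem a = false →
      s₄.mem a = s.mem a :=
    fun a ha => frame_mem (enter ;; linearTable ;; argminTable ;; swapNodes) s ha
  have e20' : s₄.reg 20 = G.off (G.par t) := by simp [hs₄, swapNodes, r₃ 16 rfl, e16]
  have e21' : s₄.reg 21 = c := by simp [hs₄, swapNodes, r₃ 17 rfl, e17]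
  have e22' : s₄.reg 22 = G.off t := by simp [hs₄, swapNodes, r₃ 14 rfl, e14]
  have e23' : s₄.reg 23 = b := by simp [hs₄, swapNodes, r₃ 15 rfl, e15]
  have p12 : s₄.mem 12 = s₁.mem 12 :=
    frame_mem (linearTable ;; argminTable ;; swapNodes) s₁ rfl
  obtain ⟨M1, c5⟩ := matchSum_spec (w := 25) (Or.inr rfl) (s := s₄) (X := G.bag (G.par t))
    (Y := G.bag t)
    (by rw [e20']; exact (hS.node _ (hG.par_le t ht)).bag.congr (m₄ 6 rfl))
    (by rw [e22']; exact (hS.node t ht.le).bag.congr (m₄ 6 rfl)) e21' e23'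
    (by simpa [p12] using fun _ _ l hl => e12 l hl)
  set s₅ := (matchSum 25).eval s₄ with hs₅
  have r₅ : ∀ r, (matchSum 25).writesReg r = false → s₅.reg r = s₄.reg r :=
    fun r hr => frame_reg _ _ hr
  obtain ⟨L2, z2, c6⟩ := linearTable_spec (s := s₅) (b := c)
    (a := parentCoef (G.bag t) (G.bag (G.par t))) (by rw [r₅ 21 rfl, e21'])
    (by simpa [parentCoef] using M1)
  set s₆ := linearTable.eval s₅ with hs₆
  have r14 : s₆.reg 14 = G.off t := by
    have : s₆.reg 14 = s₁.reg 14 := frame_reg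
      (linearTable ;; argminTable ;; swapNodes ;; matchSum 25 ;; linearTable) s₁ rfl
    rw [this, e14]
  have r16 : s₆.reg 16 = G.off (G.par t) := by
    have : s₆.reg 16 = s₁.reg 16 := frame_reg
      (linearTable ;; argminTable ;; swapNodes ;; matchSum 25 ;; linearTable) s₁ rfl
    rw [this, e16]
  have m7 : s₆.mem 7 = s.mem 7 := frame_mem (enter ;; linearTable ;; argminTable ;; swapNodes ;;
    matchSum 25 ;; linearTable) s rfl
  have m7' : s₂.mem 7 = s.mem 7 := m₂ 7 rfl
  have m8 : s₆.mem 8 = s₃.mem 8 := frame_mem (swapNodes ;; matchSum 25 ;; linearTable) s₃ rfl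
  have harg : ∀ β, ∃ idx : ℕ, idx < 2 ^ b ∧ s₃.mem 8 (G.off t + G.key t β) = G.off t + idx + 1 ∧
      lin (G.coef t) b idx = G.key t β ∧ ∀ idx' : ℕ, idx' < 2 ^ b →
        lin (G.coef t) b idx' = G.key t β →
        s.mem 7 (G.off t + idx) ≤ s.mem 7 (G.off t + idx') := by
    intro β
    obtain ⟨j, hj, h1, h2, h3⟩ := A1 (enc β (G.bag t)) (enc_lt _ _)
    have hk : G.key t β = (K (enc β (G.bag t)) : ℕ) := hK _
    refine ⟨j, hj, ?_, ?_, fun j' hj' h' => ?_⟩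
    · rw [hk]; exact_mod_cast h1
    · rw [hk, hK, h2]
    · have := h3 j' hj' (by rw [hk, hK] at h'; exact_mod_cast h')
      rw [m7'] at this
      exact_mod_cast this
  -- By `lin_parentCoef` the parent's index leads to the very cell that the child's key designates.
  have hadr : ∀ β, s₆.mem 8 (s₆.reg 14 + s₆.mem 11 (enc β (G.bag (G.par t)))) =
      s₃.mem 8 (G.off t + G.key t β) := by
    intro β
    rw [m8, r14, L2 _ (enc_lt _ _), lin_parentCoef]
    rfl
  obtain ⟨⟨B1, B2⟩, c7⟩ := addTable_spec (s := s₆) (q := G.off (G.par t)) (N := 2 ^ c) r16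
    (by rw [z2]; push_cast; rfl)
    (fun i hi => by
      -- Every index of the parent is the code of some assignment, so its record points into the
      -- table of `t`, which is disjoint from the parent's table.
      obtain ⟨β, rfl⟩ := exists_enc_eq hpn hi
      obtain ⟨j, hj, h1, -⟩ := harg β
      rw [hadr, h1]
      have := hG.not_inTable ht.le (hG.par_le t ht) (hG.lt_par t ht).ne
        (TableTree.inTable_add hj)
      intro h
      refine this ⟨by linarith [h.1], ?_⟩
      have := h.2
      push_cast at this
      rw [← hc]
      linarith)
  have e8 : (pushNode.eval s).mem 8 = s₃.mem 8 := by
    change (addTable.eval s₆).mem 8 = _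
    rw [frame_mem _ _ rfl, m8]
  have e7 : (pushNode.eval s).mem 7 = (addTable.eval s₆).mem 7 := rfl
  refine ⟨⟨?_, ?_, ?_, ?_⟩, ?_⟩
  · rw [e8]; exact harg
  · intro a ha
    rw [e8, A2 a, m₂ 8 rfl]
    intro h
    exact ha ⟨h.1, by have := h.2; push_cast at this; exact this⟩
  · intro β
    have := B1 _ (enc_lt β (G.bag (G.par t)))
    rw [hadr, m7] at this
    rw [e7, e8]
    exact_mod_cast this
  · intro a ha
    rw [e7, B2 a, m7]
    intro h
    exact ha ⟨h.1, by have := h.2; push_cast at this; exact this⟩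
  · have h4 : swapNodes.cost s₃ ≤ 30 := by simp [swapNodes]
    have hpos : 1 ≤ (b + 1) * (c + 1) := Nat.mul_pos b.succ_pos c.succ_pos
    rw [mul_comm (c + 1) (b + 1)] at c5
    have hb1 : 1 ≤ 2 ^ b := Nat.one_le_two_pow
    change enter.cost s + (linearTable.cost s₁ + (argminTable.cost s₂ +
      (swapNodes.cost s₃ + ((matchSum 25).cost s₄ + (linearTable.cost s₅ +
        addTable.cost s₆))))) ≤ _
    clear_value s₁ s₂ s₃ s₄ s₅ s₆
    generalize (b + 1) * (c + 1) = x at *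
    generalize 2 ^ b = y at *
    generalize 2 ^ c = z at *
    omega

/-- Eliminate the nodes `0, …, reg 5 - 1`. -/
def forward : Cmd := loop 13 (reg 5) pushNode

/-- Iterates `Push.invariant`. Recordings of `t` stay in the address range of `t`, so nodes not yet
eliminated find their cells still zero, and the records of earlier nodes remain legible for the
backward pass. -/
theorem forward_spec {G : TableTree} {s : MachineState} {c : ℕ} (hG : G.Valid) (hS : G.Stored s)
    (h5 : s.reg 5 = G.n) (h8 : ∀ a, s.mem 8 a = 0)
    (hc : ∀ t ≤ G.n, ((G.bag t).length + 1) ^ 2 ≤ c ∧ 2 ^ (G.bag t).length ≤ c) :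
    (∀ β, G.obj ((forward.eval s).mem 7) G.n β ≤ G.obj (s.mem 7) 0 β) ∧
    (∀ β, G.obj (s.mem 7) 0 (G.recon ((forward.eval s).mem 8) G.n β) =
      G.obj ((forward.eval s).mem 7) G.n β) ∧
    (∀ t < G.n, ∀ β, ∃ idx : ℕ, idx < 2 ^ (G.bag t).length ∧
      (forward.eval s).mem 8 (G.off t + G.key t β) = G.off t + idx + 1) ∧
    forward.cost s ≤ 10 + G.n * (800 * c) := by
  have := loop_rule' (i := 13) (e := reg 5) (p := pushNode) (s := s) (n := G.n)
    (by simp [h5]) (fun t τ => (∀ u, t ≤ u → u ≤ G.n → ∀ a, G.InTable u a → τ.mem 8 a = 0) ∧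
      (∀ u < t, ∀ β, ∃ idx : ℕ, idx < 2 ^ (G.bag u).length ∧
        τ.mem 8 (G.off u + G.key u β) = G.off u + idx + 1) ∧
      (∀ β, G.obj (τ.mem 7) t β ≤ G.obj (s.mem 7) 0 β) ∧
      ∀ β, G.obj (s.mem 7) 0 (G.recon (τ.mem 8) t β) = G.obj (τ.mem 7) t β) (700 * c)
    ⟨fun _ _ _ a _ => h8 a, fun _ h => absurd h (Nat.not_lt_zero _), fun _ => le_rfl,
      fun _ => rfl⟩ ?_
  · refine ⟨this.1.2.2.1, this.1.2.2.2, this.1.2.1, this.2.trans ?_⟩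
    have : 1 ≤ c := le_trans Nat.one_le_two_pow (hc 0 (Nat.zero_le _)).2
    simp only [cost_reg]
    have : G.n * (700 * c + 5) ≤ G.n * (800 * c) := Nat.mul_le_mul_left _ (by omega)
    omega
  rintro t ht τ hr hm ⟨h1, h0, h2, h3⟩
  have hSτ : G.Stored (τ.setReg 13 t) := hS.congr (hm 2 rfl) (hm 3 rfl) (hm 5 rfl) (hm 6 rfl)
  obtain ⟨hp, hcost⟩ := pushNode_spec (s := τ.setReg 13 t) hG hSτ ht (by simp)
    (h1 t le_rfl ht.le)
  refine ⟨⟨fun u hu hun a ha => ?_, fun u hu β => ?_,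
    hp.invariant hG ht h2 h3⟩, hcost.trans ?_⟩
  · rw [hp.arg_frame a (hG.not_inTable hun ht.le (by omega) ha)]
    exact h1 u (by omega) hun a ha
  · rcases Nat.lt_succ_iff_lt_or_eq.1 hu with hu | rfl
    · rw [hp.arg_frame _ (hG.not_inTable (by omega) ht.le hu.ne (hG.inTable_key (by omega) β))]
      exact h0 u hu β
    · obtain ⟨idx, h1, h2, -⟩ := hp.argmin β
      exact ⟨idx, h1, h2⟩
  · obtain ⟨h4, h5⟩ := hc t ht.le
    obtain ⟨h6, h7⟩ := hc _ (hG.par_le t ht)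
    have : ((G.bag t).length + 1) * ((G.bag (G.par t)).length + 1) ≤ c := by nlinarith
    omega

/-- The assignment that is stored in array `1`. -/
def MachineState.output (s : MachineState) (z : ℤ) : Bool := decide (s.mem 1 z = 1)

/-! ### Reading off a minimizer -/

def keyBody : Cmd :=
  31 ≔ cell 1 (cell 6 (reg 14 + reg 24)) ;;
  ifLT (reg 31) (lit 1) skip (ifLT (lit 1) (reg 31) skip (33 ≔ reg 33 + cell 9 (reg 24)))

/-- Compute in register `33` the address at which the entry of node `reg 13` for the output
assignment is recorded. -/
def keyAddress : Cmd := 33 ≔ reg 14 ;; loop 24 (reg 15) keyBody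

theorem keyAddress_spec {s : MachineState} {l : List ℤ} {a : ℕ → ℤ}
    (hl : Segment s (s.reg 14) l) (h15 : s.reg 15 = l.length)
    (ha : ∀ i < l.length, s.mem 9 i = a i) :
    (keyAddress.eval s).reg 33 = s.reg 14 + lin a l.length (enc s.output l) ∧
    keyAddress.cost s ≤ 60 * (l.length + 1) := by
  set s' := (33 ≔ reg 14).eval s with hs'
  have := loop_rule' (i := 24) (e := reg 15) (p := keyBody) (s := s') (n := l.length)
    (by simp [hs', h15]) (fun k τ => τ.reg 33 = s.reg 14 +
      ∑ i ∈ Finset.range k, if s.output (l.getD i 0) then a i else 0) 45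
    (by simp [hs']) ?_
  · refine ⟨?_, ?_⟩
    · rw [lin_enc]; exact this.1
    · have h := this.2
      simp only [keyAddress, cost_seq, cost_assign, cost_reg]
      change _ + (loop 24 (reg 15) keyBody).cost s' ≤ _
      simp only [cost_reg] at h
      omega
  rintro k hk τ hr hm h1
  have g14 : τ.reg 14 = s.reg 14 := by rw [hr 14 rfl]; simp [hs']
  have m1 : τ.mem 1 = s.mem 1 := by rw [hm 1 rfl]; simp [hs']
  have m6 : τ.mem 6 = s.mem 6 := by rw [hm 6 rfl]; simp [hs']
  have m9 : τ.mem 9 = s.mem 9 := by rw [hm 9 rfl]; simp [hs']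
  refine ⟨?_, by simp [keyBody]⟩
  rw [Finset.sum_range_succ, ← add_assoc, ← h1, MachineState.output]
  rcases lt_trichotomy (s.mem 1 (l.getD k 0)) 1 with h | h | h
  · simp [keyBody, g14, m1, m6, hl k hk, h, h.ne]
  · simp [keyBody, g14, m1, m6, m9, hl k hk, ha k hk, h]
  · simp [keyBody, g14, m1, m6, hl k hk, h, h.ne', h.not_gt]

def decodeBody : Cmd :=
  25 ≔ reg 15 - reg 24 - lit 1 ;; 26 ≔ cell 6 (reg 14 + reg 25) ;;
  ifLT (reg 34) (cell 12 (reg 25)) (put 1 (reg 26) (lit 0))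
    (put 1 (reg 26) (lit 1) ;; 34 ≔ reg 34 - cell 12 (reg 25))

/-- Write the binary digits of `reg 34` to the output, at the variables of a node. -/
def decode : Cmd := loop 24 (reg 15) decodeBody

/-- The machine has no bit operations: digits are found from the most significant one down, by
comparing with a power of two and subtracting. The remainder after `k` rounds is `idx` modulo `2 ^
(l.length - k)`. -/
theorem decode_spec {s : MachineState} {l : List ℤ} {idx : ℕ} (hn : l.Nodup)
    (hl : Segment s (s.reg 14) l) (h15 : s.reg 15 = l.length) (h34 : s.reg 34 = idx)
    (hidx : idx < 2 ^ l.length) (hP : ∀ i < l.length, s.mem 12 i = 2 ^ i) :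
    (decode.eval s).output = updateBits l idx s.output ∧
    decode.cost s ≤ 80 * (l.length + 1) := by
  have := loop_rule' (i := 24) (e := reg 15) (p := decodeBody) (s := s) (n := l.length)
    (by simp [h15]) (fun k τ => τ.reg 34 = (idx % 2 ^ (l.length - k) : ℕ) ∧
      ∀ z, τ.output z = if z ∈ l ∧ l.length ≤ l.idxOf z + k then idx.testBit (l.idxOf z)
        else s.output z) 60 ⟨?_, fun z => ?_⟩ ?_
  · obtain ⟨⟨-, h1⟩, h2⟩ := this
    refine ⟨?_, ?_⟩
    · funext z
      rw [updateBits, decode, h1 z]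
      simp
    · simp only [cost_reg] at h2
      exact h2.trans (by omega)
  · rw [h34, Nat.sub_zero, Nat.mod_eq_of_lt hidx]
  · rw [if_neg]
    rintro ⟨h1, h2⟩
    have := List.idxOf_lt_length_of_mem h1
    omega
  rintro k hk τ hr hm ⟨h1, h2⟩
  obtain ⟨j, hj⟩ : ∃ j, l.length = j + k + 1 := ⟨l.length - k - 1, by omega⟩
  have hjl : j < l.length := by omega
  have g14 : τ.reg 14 = s.reg 14 := hr 14 rfl
  have g15 : τ.reg 15 = l.length := by rw [hr 15 rfl, h15]
  have m6 : τ.mem 6 = s.mem 6 := hm 6 rfl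
  have m12 : τ.mem 12 = s.mem 12 := hm 12 rfl
  have ej : (l.length : ℤ) - k - 1 = j := by omega
  -- The remainder splits into its leading digit, at position `j`, and the next remainder.
  have e1 : idx % 2 ^ (l.length - k) = idx % 2 ^ j + 2 ^ j * (idx.testBit j).toNat := by
    rw [show l.length - k = j + 1 by omega, Nat.mod_pow_succ, Nat.testBit_eq_decide_div_mod_eq]
    rcases Nat.mod_two_eq_zero_or_one (idx / 2 ^ j) with h | h <;> simp [h]
  have e2 : l.length - (k + 1) = j := by omega
  have hlt : idx % 2 ^ j < 2 ^ j := Nat.mod_lt _ (by positivity)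
  rw [e1] at h1
  have hlt' : ((idx % 2 ^ j : ℕ) : ℤ) < 2 ^ j := by exact_mod_cast hlt
  have hpos : (0 : ℤ) ≤ ((idx % 2 ^ j : ℕ) : ℤ) := Int.natCast_nonneg _
  generalize hrj : idx % 2 ^ j = r at *
  have hstep : (∀ z, (decodeBody.eval (τ.setReg 24 k)).mem 1 z =
      if z = l.getD j 0 then ((idx.testBit j).toNat : ℤ) else τ.mem 1 z) ∧
      (decodeBody.eval (τ.setReg 24 k)).reg 34 = r := by
    cases hb : idx.testBit j with
    | false =>
      rw [hb] at h1
      have h3 : τ.reg 34 < 2 ^ j := by rw [h1]; simpa using hlt'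
      constructor
      · intro z
        simp [decodeBody, g14, g15, m6, m12, ej, hl j hjl, hP j hjl, h3, Function.update_apply]
      · simp [decodeBody, g14, g15, m6, m12, ej, hl j hjl, hP j hjl, h3]
        simpa using h1
    | true =>
      rw [hb] at h1
      have h1' : τ.reg 34 = r + 2 ^ j := by rw [h1]; simp
      have h3 : ¬ τ.reg 34 < 2 ^ j := by rw [h1']; omega
      constructor
      · intro z
        simp [decodeBody, g14, g15, m6, m12, ej, hl j hjl, hP j hjl, h3, Function.update_apply]
      · simp [decodeBody, g14, g15, m6, m12, ej, hl j hjl, hP j hjl, h3]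
        rw [h1']
        ring
  obtain ⟨hout, hreg⟩ := hstep
  refine ⟨⟨by rw [hreg, e2, hrj], fun z => ?_⟩, by simp [decodeBody]⟩
  rw [MachineState.output, hout]
  by_cases hz : z = l.getD j 0
  · have hi : l.idxOf z = j := by
      rw [hz, List.getD_eq_getElem _ _ hjl, hn.idxOf_getElem]
    rw [if_pos hz, if_pos ⟨hz ▸ getD_mem hjl, by omega⟩, hi]
    cases idx.testBit j <;> simp
  · rw [if_neg hz]
    have h3 := h2 z
    rw [MachineState.output] at h3
    rw [h3]
    refine if_congr (and_congr_right fun hzl => ?_) rfl rfl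
    have : l.idxOf z ≠ j := by
      rintro h
      apply hz
      rw [← h, List.getD_eq_getElem _ _ (List.idxOf_lt_length_of_mem hzl), List.getElem_idxOf]
    omega

def reassign : Cmd :=
  13 ≔ reg 5 - reg 35 - lit 1 ;; enter ;; keyAddress ;;
  34 ≔ cell 8 (reg 33) - lit 1 - reg 14 ;; decode

/-- Reassign the variables of the nodes `reg 5 - 1, …, 0`. -/
def backward : Cmd := loop 35 (reg 5) reassign

/-- The initial contents of the output do not matter, since the identity from `forward_spec` holds
for every starting assignment. The invariant is that the reconstruction still to be done leads from
the current output to a fixed result. -/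
theorem backward_spec {G : TableTree} {s : MachineState} {c : ℕ} (hG : G.Valid) (hS : G.Stored s)
    (h5 : s.reg 5 = G.n) (h8 : ∀ t < G.n, ∀ β, ∃ idx : ℕ, idx < 2 ^ (G.bag t).length ∧
      s.mem 8 (G.off t + G.key t β) = G.off t + idx + 1)
    (hc : ∀ t ≤ G.n, ((G.bag t).length + 1) ^ 2 ≤ c) :
    (∃ β, (backward.eval s).output = G.recon (s.mem 8) G.n β) ∧
    backward.cost s ≤ 10 + G.n * (400 * c) := by
  have := loop_rule' (i := 35) (e := reg 5) (p := reassign) (s := s) (n := G.n)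
    (by simp [h5]) (fun k τ =>
      G.recon (s.mem 8) (G.n - k) τ.output = G.recon (s.mem 8) G.n s.output) (390 * c)
    rfl ?_
  · refine ⟨⟨s.output, ?_⟩, this.2.trans ?_⟩
    · have h := this.1
      rw [Nat.sub_self] at h
      exact h
    · have : 1 ≤ c := le_trans (Nat.one_le_pow _ _ (by omega)) (hc 0 (Nat.zero_le _))
      simp only [cost_reg]
      have : G.n * (390 * c + 5) ≤ G.n * (400 * c) := Nat.mul_le_mul_left _ (by omega)
      omega
  rintro k hk τ hr hm hI
  obtain ⟨t, ht⟩ : ∃ t, G.n = t + k + 1 := ⟨G.n - k - 1, by omega⟩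
  have htn : t < G.n := by omega
  set s₁ := (13 ≔ reg 5 - reg 35 - lit 1).eval (τ.setReg 35 k) with hs₁
  have g5 : τ.reg 5 = G.n := by rw [hr 5 rfl, h5]
  have e13 : s₁.reg 13 = t := by simp [hs₁, g5]; omega
  have m : ∀ a, reassign.writesMem a = false → s₁.mem a = s.mem a := fun a ha => by
    rw [← hm a ha]; simp [hs₁]
  have m1 : s₁.mem 1 = τ.mem 1 := by simp [hs₁]
  obtain ⟨⟨e14, e15, -, -, -⟩, e9, e12, c2⟩ := enter_spec (s := s₁) hG
    (hS.congr (m 2 rfl) (m 3 rfl) (m 5 rfl) (m 6 rfl)) htn e13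
  set s₂ := enter.eval s₁ with hs₂
  have n₂ : ∀ a, enter.writesMem a = false → s₂.mem a = s₁.mem a := fun a ha => frame_mem _ _ ha
  have hbag := (hS.node t htn.le).bag
  obtain ⟨e33, c3⟩ := keyAddress_spec (s := s₂) (l := G.bag t) (a := G.coef t)
    (by rw [e14]; exact hbag.congr (by rw [n₂ 6 rfl, m 6 rfl])) e15 e9
  set s₃ := keyAddress.eval s₂ with hs₃
  have n₃ : ∀ a, s₃.mem a = s₂.mem a := fun a => frame_mem _ _ rfl
  have o3 : s₂.output = τ.output := by
    funext z; simp only [MachineState.output, n₂ 1 rfl, m1]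
  have e14' : s₃.reg 14 = G.off t := by rw [hs₃, frame_reg _ _ rfl, e14]
  obtain ⟨idx, hidx, ha⟩ := h8 t htn τ.output
  set s₄ := (34 ≔ cell 8 (reg 33) - lit 1 - reg 14).eval s₃ with hs₄
  have e34 : s₄.reg 34 = idx := by
    have : s₃.mem 8 (s₃.reg 33) = G.off t + idx + 1 := by
      rw [e33, e14, n₃, n₂ 8 rfl, m 8 rfl, o3]
      exact ha
    simp [hs₄, this, e14']
  have n₄ : ∀ a, s₄.mem a = s₂.mem a := fun a => by simp [hs₄, n₃]
  obtain ⟨h1, c5⟩ := decode_spec (s := s₄) (l := G.bag t) (idx := idx) (hG.nodup t htn.le)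
    (by
      have : s₄.reg 14 = G.off t := by simp [hs₄, e14']
      rw [this]
      exact hbag.congr (by rw [n₄, n₂ 6 rfl, m 6 rfl]))
    (by
      have : s₃.reg 15 = s₂.reg 15 := by rw [hs₃, frame_reg _ _ rfl]
      simp [hs₄, this, e15]) e34 hidx (fun i hi => by rw [n₄, e12 i hi])
  refine ⟨?_, ?_⟩
  · have e : (reassign.eval (τ.setReg 35 k)) = decode.eval s₄ := rfl
    have o4 : s₄.output = τ.output := by
      rw [← o3]; funext z; simp only [MachineState.output, n₄ 1]
    rw [e, h1, o4, ← hI, show G.n - k = t + 1 by omega, show G.n - (k + 1) = t by omega,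
      TableTree.recon, TableTree.choose, ha]
    congr 2
    omega
  · have : reassign.cost (τ.setReg 35 k) = (13 ≔ reg 5 - reg 35 - lit 1).cost (τ.setReg 35 k) +
      (enter.cost s₁ + (keyAddress.cost s₂ +
        ((34 ≔ cell 8 (reg 33) - lit 1 - reg 14).cost s₃ + decode.cost s₄))) := rfl
    rw [this]
    simp only [cost_assign, cost_sub, cost_cell, cost_reg, cost_lit]
    have h4 := hc t htn.le
    have h6 := hc _ (hG.par_le t htn)
    have : ((G.bag t).length + 1) * ((G.bag (G.par t)).length + 1) ≤ c := by nlinarith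
    have : (G.bag t).length + 1 ≤ c := by nlinarith
    clear_value s₁ s₂ s₃ s₄
    omega

/-- Minimize the sum of the stored tables. -/
def minimize : Cmd := forward ;; backward ;; 0 ≔ cell 7 (cell 5 (reg 5))

/-- With an empty root bag, the sum that remains at the root is one table cell, independent of the
assignment. It bounds the objective from below and is attained by the reconstructed output. -/
theorem minimize_spec {G : TableTree} {s : MachineState} {c : ℕ} (hG : G.Valid) (hS : G.Stored s)
    (hroot : G.bag G.n = []) (h5 : s.reg 5 = G.n) (h8 : ∀ a, s.mem 8 a = 0)
    (hc : ∀ t ≤ G.n, ((G.bag t).length + 1) ^ 2 ≤ c ∧ 2 ^ (G.bag t).length ≤ c) :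
    (minimize.eval s).reg 0 = G.obj (s.mem 7) 0 (minimize.eval s).output ∧
    (∀ β, (minimize.eval s).reg 0 ≤ G.obj (s.mem 7) 0 β) ∧
    minimize.cost s ≤ 40 + G.n * (1200 * c) := by
  obtain ⟨h1, h2, h3, c1⟩ := forward_spec hG hS h5 h8 hc
  set s₁ := forward.eval s with hs₁
  have m₁ : ∀ a, forward.writesMem a = false → s₁.mem a = s.mem a := fun a ha => frame_mem _ _ ha
  obtain ⟨⟨β₀, hβ⟩, c2⟩ := backward_spec (s := s₁) hG
    (hS.congr (m₁ 2 rfl) (m₁ 3 rfl) (m₁ 5 rfl) (m₁ 6 rfl)) (by rw [hs₁, frame_reg _ _ rfl, h5])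
    h3 (fun t ht => (hc t ht).1)
  set s₂ := backward.eval s₁ with hs₂
  have e : minimize.eval s = (0 ≔ cell 7 (cell 5 (reg 5))).eval s₂ := rfl
  have m7 : s₂.mem 7 = s₁.mem 7 := frame_mem _ _ rfl
  have m5 : s₂.mem 5 = s.mem 5 := frame_mem (forward ;; backward) s rfl
  have r5 : s₂.reg 5 = G.n := by
    rw [← h5]; exact frame_reg (forward ;; backward) s rfl
  have hv : ∀ β, G.obj (s₁.mem 7) G.n β = s₁.mem 7 (G.off G.n) := by
    intro β; simp [TableTree.obj, hroot, enc]
  have e0 : (minimize.eval s).reg 0 = s₁.mem 7 (G.off G.n) := by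
    rw [e]; simp [r5, m5, (hS.node _ le_rfl).off, m7]
  have eo : (minimize.eval s).output = s₂.output := rfl
  refine ⟨?_, fun β => ?_, ?_⟩
  · rw [e0, eo, hβ, h2, hv]
  · rw [e0, ← hv β]; exact h1 β
  · have : minimize.cost s = forward.cost s + (backward.cost s₁ +
      (0 ≔ cell 7 (cell 5 (reg 5))).cost s₂) := rfl
    rw [this]
    simp only [cost_assign, cost_cell, cost_reg]
    have : G.n * (800 * c) + G.n * (400 * c) = G.n * (1200 * c) := by ring
    omega

/-! ### Building the tables of the constraints -/

/-- The nodes in `S` have been stored, with tables at disjoint places below `e`. -/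
structure Allocated (S : Set ℕ) (bag : ℕ → List ℤ) (off : ℕ → ℕ) (e : ℕ) (s : MachineState) :
    Prop where
  cur : s.reg 3 = e
  len : ∀ t ∈ S, s.mem 3 t = (bag t).length
  off_eq : ∀ t ∈ S, s.mem 5 t = off t
  segment : ∀ t ∈ S, Segment s (off t) (bag t)
  le : ∀ t ∈ S, off t + 2 ^ (bag t).length ≤ e
  disjoint : ∀ i ∈ S, ∀ j ∈ S, i ≠ j →
    off i + 2 ^ (bag i).length ≤ off j ∨ off j + 2 ^ (bag j).length ≤ off i

theorem Allocated.congr {S : Set ℕ} {bag : ℕ → List ℤ} {off : ℕ → ℕ} {e : ℕ}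
    {s s' : MachineState} (h : Allocated S bag off e s) (hr : s'.reg 3 = s.reg 3)
    (h3 : s'.mem 3 = s.mem 3) (h5 : s'.mem 5 = s.mem 5) (h6 : s'.mem 6 = s.mem 6) :
    Allocated S bag off e s' where
  cur := by rw [hr, h.cur]
  len t ht := by rw [h3, h.len t ht]
  off_eq t ht := by rw [h5, h.off_eq t ht]
  segment t ht := (h.segment t ht).congr h6
  le := h.le
  disjoint := h.disjoint

/-- The list of variables and the table of a node start at the same address of different arrays, so
one pointer serves both. -/
theorem Allocated.insert {S : Set ℕ} {bag : ℕ → List ℤ} {off : ℕ → ℕ} {e t : ℕ}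
    {s s' : MachineState} (h : Allocated S bag off e s) (ht : t ∉ S)
    (hr : s'.reg 3 = e + 2 ^ (bag t).length)
    (h3 : s'.mem 3 = Function.update (s.mem 3) t (bag t).length)
    (h5 : s'.mem 5 = Function.update (s.mem 5) t e)
    (h6 : ∀ a < (e : ℤ), s'.mem 6 a = s.mem 6 a) (hb : Segment s' e (bag t)) :
    Allocated (insert t S) bag (Function.update off t e) (e + 2 ^ (bag t).length) s' := by
  have hne : ∀ x ∈ S, x ≠ t := fun x hx h => ht (h ▸ hx)
  refine ⟨by rw [hr]; push_cast; rfl, ?_, ?_, ?_, ?_, ?_⟩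
  · rintro x (rfl | hx)
    · simp [h3]
    · rw [h3, Function.update_of_ne (by exact_mod_cast hne x hx), h.len x hx]
  · rintro x (rfl | hx)
    · simp [h5]
    · rw [h5, Function.update_of_ne (by exact_mod_cast hne x hx), h.off_eq x hx,
        Function.update_of_ne (hne x hx)]
  · rintro x (rfl | hx)
    · simpa using hb
    · intro i hi
      rw [Function.update_of_ne (hne x hx), h6, h.segment x hx i hi]
      have := h.le x hx
      -- A list of variables fits into the space reserved for its table.
      have h2 : (bag x).length < 2 ^ (bag x).length := Nat.lt_two_pow_self
      omega
  · rintro x (rfl | hx)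
    · simp
    · rw [Function.update_of_ne (hne x hx)]
      exact (h.le x hx).trans (Nat.le_add_right _ _)
  · rintro x (rfl | hx) y (rfl | hy) hxy
    · exact absurd rfl hxy
    · right
      rw [Function.update_self, Function.update_of_ne (hne y hy)]
      exact h.le y hy
    · left
      rw [Function.update_self, Function.update_of_ne (hne x hx)]
      exact h.le x hx
    · rw [Function.update_of_ne (hne x hx), Function.update_of_ne (hne y hy)]
      exact h.disjoint x hx y hy hxy

/-- The list of the one or two variables of a constraint. -/
def pairList (u v : ℤ) : List ℤ := if u = v then [u] else [u, v]

def emitTwo : Cmd :=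
  put 3 (reg 6) (lit 2) ;; put 6 (reg 3 + lit 1) (reg 8) ;; put 7 (reg 3 + lit 1) (reg 10) ;;
  put 7 (reg 3 + lit 2) (reg 11) ;; put 7 (reg 3 + lit 3) (reg 12) ;; 3 ≔ reg 3 + lit 4

def emitOne : Cmd :=
  put 3 (reg 6) (lit 1) ;; put 7 (reg 3 + lit 1) (reg 12) ;; 3 ≔ reg 3 + lit 2

/-- Store a node with number `reg 6`, variables `reg 7` and `reg 8`, and the table given by the
registers `9` to `12`. -/
def emit : Cmd :=
  put 5 (reg 6) (reg 3) ;; put 6 (reg 3) (reg 7) ;; put 7 (reg 3) (reg 9) ;;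
  ifLT (reg 7) (reg 8) emitTwo (ifLT (reg 8) (reg 7) emitTwo emitOne)

/-- The first `k` constraints, with variables `u j`, `v j` and value `g j` of the variables, have
been stored. -/
structure Built (u v : ℕ → ℤ) (g : ℕ → Bool → Bool → ℤ) (bag : ℕ → List ℤ) (k : ℕ) (off : ℕ → ℕ)
    (e : ℕ) (s : MachineState) : Prop where
  alloc : Allocated {j | j < k} bag off e s
  e_le : e ≤ 4 * k
  table : ∀ j < k, ∀ β : ℤ → Bool, s.mem 7 (off j + enc β (bag j)) = g j (β (u j)) (β (v j))
  zero : ∀ a, (e : ℤ) ≤ a → s.mem 7 a = 0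

/-- The first variable is the low digit, so the four values are stored in the order of registers 9
to 12. If the variables coincide, only the two diagonal values can occur; registers 10 and 11 are
then unconstrained and ignored. -/
theorem emit_spec {u v : ℕ → ℤ} {g : ℕ → Bool → Bool → ℤ} {bag : ℕ → List ℤ} {k : ℕ}
    {off : ℕ → ℕ} {e : ℕ} {s : MachineState} (h : Built u v g bag k off e s)
    (hbag : bag k = pairList (u k) (v k)) (h6 : s.reg 6 = k) (h7 : s.reg 7 = u k)
    (h8 : s.reg 8 = v k) (h9 : s.reg 9 = g k false false)
    (h10 : u k ≠ v k → s.reg 10 = g k true false)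
    (h11 : u k ≠ v k → s.reg 11 = g k false true) (h12 : s.reg 12 = g k true true) :
    (∃ off' e', Built u v g bag (k + 1) off' e' (emit.eval s)) ∧ emit.cost s ≤ 100 := by
  have h3 := h.alloc.cur
  have key : ((emit.eval s).reg 3 = e + 2 ^ (bag k).length ∧
      (emit.eval s).mem 3 = Function.update (s.mem 3) k (bag k).length ∧
      (emit.eval s).mem 5 = Function.update (s.mem 5) k e ∧
      (∀ a < (e : ℤ), (emit.eval s).mem 6 a = s.mem 6 a) ∧ Segment (emit.eval s) e (bag k)) ∧
      (bag k).length ≤ 2 ∧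
      (∀ a < (e : ℤ), (emit.eval s).mem 7 a = s.mem 7 a) ∧
      (∀ a, ((e : ℤ) + 2 ^ (bag k).length) ≤ a → (emit.eval s).mem 7 a = s.mem 7 a) ∧
      ∀ β : ℤ → Bool, (emit.eval s).mem 7 (e + enc β (bag k)) = g k (β (u k)) (β (v k)) := by
    by_cases huv : u k = v k
    · have he : emit.eval s = emitOne.eval ((put 5 (reg 6) (reg 3) ;; put 6 (reg 3) (reg 7) ;;
          put 7 (reg 3) (reg 9)).eval s) := by
        simp [emit, h7, h8, huv]
      rw [he, hbag, pairList, if_pos huv]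
      refine ⟨⟨?_, ?_, ?_, fun a ha => ?_, fun i hi => ?_⟩, by simp, fun a ha => ?_,
        fun a ha => ?_, fun β => ?_⟩
      · simp [emitOne, h3]
      · simp [emitOne, h6]
      · simp [emitOne, h6, h3]
      · simp [emitOne, h3, Function.update_of_ne ha.ne]
      · obtain rfl : i = 0 := by simpa using hi
        simp [emitOne, h3, h7, List.getD]
      · simp [emitOne, h3, Function.update_of_ne ha.ne,
          Function.update_of_ne (show a ≠ (e : ℤ) + 1 by omega)]
      · simp only [List.length_singleton, pow_one] at ha
        simp [emitOne, h3, Function.update_of_ne (show a ≠ (e : ℤ) by omega),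
          Function.update_of_ne (show a ≠ (e : ℤ) + 1 by omega)]
      · rw [← huv]
        cases hb : β (u k) <;> simp [emitOne, h3, enc, hb, h9, h12]
    · have he : emit.eval s = emitTwo.eval ((put 5 (reg 6) (reg 3) ;; put 6 (reg 3) (reg 7) ;;
          put 7 (reg 3) (reg 9)).eval s) := by
        rcases lt_or_gt_of_ne huv with hlt | hlt
        · simp [emit, h7, h8, hlt]
        · simp [emit, h7, h8, hlt]
      rw [he, hbag, pairList, if_neg huv]
      refine ⟨⟨?_, ?_, ?_, fun a ha => ?_, fun i hi => ?_⟩, by simp, fun a ha => ?_,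
        fun a ha => ?_, fun β => ?_⟩
      · simp [emitTwo, h3]
      · simp [emitTwo, h6]
      · simp [emitTwo, h6, h3]
      · simp [emitTwo, h3, Function.update_of_ne ha.ne,
          Function.update_of_ne (show a ≠ (e : ℤ) + 1 by omega)]
      · have : i = 0 ∨ i = 1 := by simp at hi; omega
        rcases this with rfl | rfl <;> simp [emitTwo, h3, h7, h8, List.getD]
      · simp [emitTwo, h3, Function.update_of_ne ha.ne,
          Function.update_of_ne (show a ≠ (e : ℤ) + 1 by omega),
          Function.update_of_ne (show a ≠ (e : ℤ) + 2 by omega),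
          Function.update_of_ne (show a ≠ (e : ℤ) + 3 by omega)]
      · simp only [List.length_cons, List.length_nil] at ha
        norm_num at ha
        simp [emitTwo, h3, Function.update_of_ne (show a ≠ (e : ℤ) by omega),
          Function.update_of_ne (show a ≠ (e : ℤ) + 1 by omega),
          Function.update_of_ne (show a ≠ (e : ℤ) + 2 by omega),
          Function.update_of_ne (show a ≠ (e : ℤ) + 3 by omega)]
      · cases hb : β (u k) <;> cases hb' : β (v k) <;>
          simp [emitTwo, h3, enc, hb, hb', h9, h10 huv, h11 huv, h12]
  obtain ⟨⟨k3, m3, m5, m6, hseg⟩, hlen, lo, hi, tab⟩ := key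
  refine ⟨⟨Function.update off k e, e + 2 ^ (bag k).length, ⟨?_, ?_, fun j hj β => ?_,
    fun a ha => ?_⟩⟩, by simp [emit, emitTwo, emitOne]⟩
  · have := h.alloc.insert (t := k) (by simp) k3 m3 m5 m6 hseg
    have hS : insert k {j | j < k} = {j | j < k + 1} := by
      ext j; simp only [Set.mem_insert_iff, Set.mem_ofPred_eq]; omega
    rwa [hS] at this
  · have := h.e_le
    have : 2 ^ (bag k).length ≤ 2 ^ 2 := Nat.pow_le_pow_right (by norm_num) hlen
    omega
  · by_cases hjk : j = k
    · subst hjk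
      rw [Function.update_self]
      exact tab β
    · rw [Function.update_of_ne hjk, lo, h.table j (by omega)]
      have h1 := h.alloc.le j (show j < k by omega)
      have h2 := enc_lt β (bag j)
      omega
  · push_cast at ha
    rw [hi a ha, h.zero a (le_trans (by simp) ha)]

def replaceBody : Cmd := ifLT (cell 7 (reg 24)) (lit 0) (put 7 (reg 24) (reg 4)) skip

/-- Replace the negative entries of all tables by `reg 4`. -/
def replaceNegative : Cmd := loop 24 (reg 3) replaceBody

/-- The substitute for `∞`, read as `-1`, depends on all finite weights, so it can be inserted only
after all constraints have been read. One sweep suffices because the tables occupy at most `4 * k`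
cells. -/
theorem replaceNegative_spec {u v : ℕ → ℤ} {g : ℕ → Bool → Bool → ℤ} {bag : ℕ → List ℤ} {k : ℕ}
    {off : ℕ → ℕ} {e : ℕ} {s : MachineState} (h : Built u v g bag k off e s) :
    Built u v (fun j a b => if g j a b < 0 then s.reg 4 else g j a b) bag k off e
      (replaceNegative.eval s) ∧ replaceNegative.cost s ≤ 200 * (k + 1) := by
  have := loop_rule' (i := 24) (e := reg 3) (p := replaceBody) (s := s) (n := e)
    (by simp [h.alloc.cur]) (fun i τ => (∀ a, (i : ℤ) ≤ a → τ.mem 7 a = s.mem 7 a) ∧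
      ∀ a : ℕ, a < i → τ.mem 7 a = if s.mem 7 a < 0 then s.reg 4 else s.mem 7 a) 40 (by simp) ?_
  · obtain ⟨⟨h1, h2⟩, h3⟩ := this
    refine ⟨⟨?_, h.e_le, fun j hj β => ?_, fun a ha => ?_⟩, h3.trans ?_⟩
    · exact h.alloc.congr (frame_reg _ _ rfl) (frame_mem _ _ rfl) (frame_mem _ _ rfl)
        (frame_mem _ _ rfl)
    · have h4 := h.alloc.le j hj
      have h5 := enc_lt β (bag j)
      have h6 := h2 (off j + enc β (bag j)) (by omega)
      push_cast at h6
      rw [h.table j hj] at h6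
      exact h6
    · exact (h1 a ha).trans (h.zero a ha)
    · have := h.e_le
      simp only [cost_reg]
      omega
  rintro i hi τ hr hm ⟨h1, h2⟩
  have g4 : τ.reg 4 = s.reg 4 := hr 4 rfl
  have e7 : (replaceBody.eval (τ.setReg 24 i)).mem 7 = Function.update (τ.mem 7) i
      (if s.mem 7 i < 0 then s.reg 4 else s.mem 7 i) := by
    have h3 := h1 i le_rfl
    by_cases hneg : s.mem 7 i < 0
    · simp [replaceBody, h3, hneg, g4]
    · simp [replaceBody, h3, hneg]
  refine ⟨⟨fun a ha => ?_, fun a ha => ?_⟩, by simp [replaceBody]⟩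
  · rw [e7, Function.update_of_ne (by push_cast at ha; omega)]
    exact h1 a (by push_cast at ha; omega)
  · rw [e7]
    by_cases hai : a = i
    · subst hai; simp
    · rw [Function.update_of_ne (by exact_mod_cast hai)]
      exact h2 a (by omega)

/-! ### Reading the tree decomposition -/

/-- The distinct entries of a list, in the order of their first occurrence. -/
def distinct (l : List ℤ) : List ℤ := l.foldl (fun acc x => if x ∈ acc then acc else acc ++ [x]) []

theorem distinct_append_singleton (l : List ℤ) (x : ℤ) :
    distinct (l ++ [x]) = if x ∈ distinct l then distinct l else distinct l ++ [x] := by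
  simp only [distinct, List.foldl_append]
  rfl

theorem mem_distinct {l : List ℤ} {x : ℤ} : x ∈ distinct l ↔ x ∈ l := by
  induction l using List.reverseRecOn with
  | nil => simp [distinct]
  | append_singleton l y ih =>
    rw [distinct_append_singleton]
    split_ifs with h
    · rw [ih, List.mem_append, List.mem_singleton]
      refine ⟨Or.inl, fun h' => h'.elim id ?_⟩
      rintro rfl
      exact ih.1 h
    · simp [ih]

theorem nodup_distinct (l : List ℤ) : (distinct l).Nodup := by
  induction l using List.reverseRecOn with
  | nil => simp [distinct]
  | append_singleton l y ih =>
    rw [distinct_append_singleton]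
    split_ifs with h
    · exact ih
    · refine ih.append (List.nodup_singleton y) ?_
      simpa using h

theorem length_distinct_le (l : List ℤ) : (distinct l).length ≤ l.length := by
  induction l using List.reverseRecOn with
  | nil => simp [distinct]
  | append_singleton l y ih =>
    rw [distinct_append_singleton]
    split_ifs with h <;> simp <;> omega

def findBody : Cmd :=
  31 ≔ cell 6 (reg 3 + reg 25) ;;
  ifLT (reg 31) (reg 26) skip (ifLT (reg 26) (reg 31) skip (27 ≔ lit 1))

/-- Test whether `reg 26` is among the first `reg 14` variables of the current bag. -/
def find : Cmd := 27 ≔ lit 0 ;; loop 25 (reg 14) findBody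

theorem find_spec {s : MachineState} {l : List ℤ} (hl : Segment s (s.reg 3) l)
    (h14 : s.reg 14 = l.length) :
    (find.eval s).reg 27 = (if s.reg 26 ∈ l then 1 else 0) ∧ find.cost s ≤ 40 * (l.length + 1) := by
  set s' := (27 ≔ lit 0).eval s with hs'
  have := loop_rule' (i := 25) (e := reg 14) (p := findBody) (s := s') (n := l.length)
    (by simp [hs', h14])
    (fun k τ => τ.reg 27 = if ∃ i < k, l.getD i 0 = s.reg 26 then 1 else 0) 30
    (by simp [hs']) ?_
  · refine ⟨?_, ?_⟩
    · refine this.1.trans (if_congr ⟨?_, exists_getD_of_mem⟩ rfl rfl)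
      rintro ⟨i, hi, h⟩
      exact h ▸ getD_mem hi
    · have h := this.2
      simp only [find, cost_seq, cost_assign, cost_lit]
      change _ + (loop 25 (reg 14) findBody).cost s' ≤ _
      simp only [cost_reg] at h
      omega
  rintro k hk τ hr hm hI
  have g3 : τ.reg 3 = s.reg 3 := by rw [hr 3 rfl]; simp [hs']
  have g26 : τ.reg 26 = s.reg 26 := by rw [hr 26 rfl]; simp [hs']
  have m6 : τ.mem 6 = s.mem 6 := by rw [hm 6 rfl]; simp [hs']
  refine ⟨?_, by simp [findBody]⟩
  have hiff : (∃ i < k + 1, l.getD i 0 = s.reg 26) ↔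
      (∃ i < k, l.getD i 0 = s.reg 26) ∨ l.getD k 0 = s.reg 26 := by
    constructor
    · rintro ⟨i, hi, h⟩
      rcases Nat.lt_succ_iff_lt_or_eq.1 hi with hi | rfl
      · exact Or.inl ⟨i, hi, h⟩
      · exact Or.inr h
    · rintro (⟨i, hi, h⟩ | h)
      · exact ⟨i, by omega, h⟩
      · exact ⟨k, by omega, h⟩
  rw [if_congr hiff rfl rfl]
  rcases lt_trichotomy (l.getD k 0) (s.reg 26) with h | h | h
  · simp only [h.ne, or_false, ← hI]
    simp [findBody, g3, g26, m6, hl k hk, h]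
  · simp [findBody, g3, g26, m6, hl k hk, h]
  · simp only [h.ne', or_false, ← hI]
    simp [findBody, g3, g26, m6, hl k hk, h, h.not_gt]

def insertEntry : Cmd :=
  (26 ≔ cell 0 (reg 20 + reg 24) ;;
    ifLT (reg 26) (lit 0) (26 ≔ cell 6 (cell 5 (lit 0 - reg 26 - lit 1))) skip) ;;
  find ;;
  ifLT (reg 27) (lit 1)
    (put 6 (reg 3 + reg 14) (reg 26) ;; 14 ≔ reg 14 + lit 1 ;; 15 ≔ reg 15 + reg 15) skip

/-- Store the variables that belong to the entries of the current bag. -/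
def collect : Cmd := 14 ≔ lit 0 ;; 15 ≔ lit 1 ;; loop 24 (reg 18) insertEntry

/-- A negative entry denotes a constraint, and its representative is the first cell of that
constraint's stored list. This cell lies below `e`, hence is not affected by writing the new bag
from `e` on. -/
theorem collect_spec {s : MachineState} {E : List ℤ} {e : ℕ} {rep : ℤ → ℤ} (h3 : s.reg 3 = e)
    (h18 : s.reg 18 = E.length) (hE : ∀ i < E.length, s.mem 0 (s.reg 20 + i) = E.getD i 0)
    (hpos : ∀ z ∈ E, 0 ≤ z → rep z = z)
    (hneg : ∀ z ∈ E, z < 0 → s.mem 5 (-z - 1) < e ∧ s.mem 6 (s.mem 5 (-z - 1)) = rep z) :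
    ((collect.eval s).reg 14 = (distinct (E.map rep)).length ∧
      (collect.eval s).reg 15 = 2 ^ (distinct (E.map rep)).length ∧
      Segment (collect.eval s) e (distinct (E.map rep)) ∧
      ∀ a < (e : ℤ), (collect.eval s).mem 6 a = s.mem 6 a) ∧
    collect.cost s ≤ 150 * (E.length + 1) ^ 2 := by
  set s' := (14 ≔ lit 0 ;; 15 ≔ lit 1).eval s with hs'
  have := loop_rule' (i := 24) (e := reg 18) (p := insertEntry) (s := s') (n := E.length)
    (by simp [hs', h18]) (fun k τ => τ.reg 14 = (distinct ((E.take k).map rep)).length ∧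
      τ.reg 15 = 2 ^ (distinct ((E.take k).map rep)).length ∧
      Segment τ e (distinct ((E.take k).map rep)) ∧ ∀ a < (e : ℤ), τ.mem 6 a = s.mem 6 a)
    (50 + 40 * (E.length + 1)) ?_ ?_
  · refine ⟨?_, ?_⟩
    · have h := this.1
      rw [List.take_length] at h
      exact h
    have h := this.2
    simp only [collect, cost_seq, cost_assign, cost_lit]
    change _ + (_ + (loop 24 (reg 18) insertEntry).cost s') ≤ _
    simp only [cost_reg] at h
    nlinarith
  · simp [hs', distinct, Segment]
  rintro k hk τ hr hm ⟨h1, h2, h4, h5⟩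
  set D := distinct ((E.take k).map rep) with hD
  have hDlen : D.length ≤ E.length :=
    (length_distinct_le _).trans (by rw [List.length_map, List.length_take]; omega)
  set z := E.getD k 0 with hz
  have hzE : z ∈ E := getD_mem hk
  have hD' : distinct ((E.take (k + 1)).map rep) = if rep z ∈ D then D else D ++ [rep z] := by
    have : E.take (k + 1) = E.take k ++ [z] := by
      rw [List.take_add_one, hz, List.getD_eq_getElem _ _ hk, List.getElem?_eq_getElem hk]
      rfl
    rw [this, List.map_append, List.map_singleton, distinct_append_singleton]
  have g3 : τ.reg 3 = e := by rw [hr 3 rfl]; simp [hs', h3]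
  have g20 : τ.reg 20 = s.reg 20 := by rw [hr 20 rfl]; simp [hs']
  have m0 : τ.mem 0 = s.mem 0 := by rw [hm 0 rfl]; simp [hs']
  have m5 : τ.mem 5 = s.mem 5 := by rw [hm 5 rfl]; simp [hs']
  set τ₁ := (26 ≔ cell 0 (reg 20 + reg 24) ;;
    ifLT (reg 26) (lit 0) (26 ≔ cell 6 (cell 5 (lit 0 - reg 26 - lit 1))) skip).eval
      (τ.setReg 24 k) with hτ₁
  have e26 : τ₁.reg 26 = rep z := by
    by_cases hz0 : z < 0
    · obtain ⟨n1, n2⟩ := hneg z hzE hz0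
      simp [hτ₁, g20, m0, hE k hk, ← hz, hz0, m5, h5 _ n1, n2]
    · simp [hτ₁, g20, m0, hE k hk, ← hz, hz0, hpos z hzE (not_lt.1 hz0)]
  have f₁ : ∀ r, r ≠ 24 → r ≠ 26 → τ₁.reg r = τ.reg r := by
    intro r h24 h26
    simp only [hτ₁, eval_seq, eval_ifLT, eval_assign, eval_skip]
    split <;> simp [h24, h26]
  have fm : τ₁.mem = τ.mem := by
    simp only [hτ₁, eval_seq, eval_ifLT, eval_assign, eval_skip]
    split <;> simp
  obtain ⟨e27, c1⟩ := find_spec (s := τ₁) (l := D)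
    (by rw [f₁ 3 (by decide) (by decide), g3]; exact h4.congr (by rw [fm]))
    (by rw [f₁ 14 (by decide) (by decide), h1])
  set τ₂ := find.eval τ₁ with hτ₂
  have p : ∀ r, find.writesReg r = false → τ₂.reg r = τ₁.reg r := fun r hr => frame_reg _ _ hr
  have pm : τ₂.mem 6 = τ.mem 6 := by rw [hτ₂, frame_mem _ _ rfl, fm]
  have p3 : τ₂.reg 3 = e := by rw [p 3 rfl, f₁ 3 (by decide) (by decide), g3]
  have p14 : τ₂.reg 14 = D.length := by rw [p 14 rfl, f₁ 14 (by decide) (by decide), h1]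
  have p15 : τ₂.reg 15 = 2 ^ D.length := by rw [p 15 rfl, f₁ 15 (by decide) (by decide), h2]
  have p26 : τ₂.reg 26 = rep z := by rw [p 26 rfl, e26]
  have ev : insertEntry.eval (τ.setReg 24 k) = (ifLT (reg 27) (lit 1)
    (put 6 (reg 3 + reg 14) (reg 26) ;; 14 ≔ reg 14 + lit 1 ;; 15 ≔ reg 15 + reg 15) skip).eval
      τ₂ := rfl
  refine ⟨?_, ?_⟩
  · rw [ev, hD']
    by_cases hzD : rep z ∈ D
    · rw [e26, if_pos hzD] at e27
      simp only [if_pos hzD, eval_ifLT, eval_reg, eval_lit, e27, lt_irrefl, if_false, eval_skip]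
      exact ⟨p14, p15, h4.congr pm, fun a ha => by rw [pm, h5 a ha]⟩
    · rw [e26, if_neg hzD] at e27
      simp only [if_neg hzD, eval_ifLT, eval_reg, eval_lit, e27, zero_lt_one, if_true]
      refine ⟨by simp [p14], by simp [p15, pow_succ]; ring, fun i hi => ?_, fun a ha => ?_⟩
      · by_cases hiD : i = D.length
        · subst hiD
          simp [p3, p14, p26, List.getD]
        · have hi' : i < D.length := by simp at hi; omega
          have : (e : ℤ) + i ≠ e + D.length := by omega
          simp only [eval_seq, eval_put, eval_add, eval_reg, eval_assign, p3, p14, p26,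
            MachineState.setReg_mem, MachineState.setMem_mem, if_true, pm]
          rw [Function.update_of_ne this, h4 i hi', List.getD_append _ _ _ _ hi']
      · have : a ≠ e + D.length := by omega
        simp [p3, p14, p26, pm, Function.update_of_ne this, h5 a ha]
  · simp only [insertEntry, cost_seq, cost_assign, cost_cell, cost_add, cost_reg, cost_ifLT,
      cost_lit, cost_sub, cost_skip, cost_put]
    change _ + (find.cost τ₁ + _) ≤ _
    norm_num
    omega

def homeClause : Cmd :=
  (33 ≔ lit 0 - reg 33 - lit 1 ;; 26 ≔ cell 6 (cell 5 (reg 33) + cell 3 (reg 33) - lit 1)) ;;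
  find ;; ifLT (reg 27) (lit 1) skip (put 2 (reg 33) (reg 13))

def homeEntry : Cmd := 33 ≔ cell 0 (reg 20 + reg 24) ;; ifLT (reg 33) (lit 0) homeClause skip

/-- Make node `reg 13` the parent of those constraints in its bag whose second variable is in the
bag, too. -/
def adopt : Cmd := loop 24 (reg 18) homeEntry

/-- Only the second variable, the last entry of the constraint's list, has to be looked up: the
first one is in the bag anyway as the representative of the constraint. -/
theorem adopt_spec {s : MachineState} {E D : List ℤ} {m : ℕ} {v : ℕ → ℤ}
    (h18 : s.reg 18 = E.length) (hE : ∀ i < E.length, s.mem 0 (s.reg 20 + i) = E.getD i 0)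
    (hD : Segment s (s.reg 3) D) (h14 : s.reg 14 = D.length) (hDE : D.length ≤ E.length)
    (hneg : ∀ z ∈ E, z < 0 → ∃ j < m, z = -(j + 1 : ℕ))
    (hv : ∀ j < m, s.mem 6 (s.mem 5 j + s.mem 3 j - 1) = v j) :
    ((∀ x, (adopt.eval s).mem 2 x = s.mem 2 x ∨ ∃ j < m, x = (j : ℕ) ∧ -((j + 1 : ℕ) : ℤ) ∈ E ∧
        v j ∈ D ∧ (adopt.eval s).mem 2 x = s.reg 13) ∧
      ∀ j < m, -((j + 1 : ℕ) : ℤ) ∈ E → v j ∈ D → (adopt.eval s).mem 2 j = s.reg 13) ∧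
    adopt.cost s ≤ 150 * (E.length + 1) ^ 2 := by
  have := loop_rule' (i := 24) (e := reg 18) (p := homeEntry) (s := s) (n := E.length)
    (by simp [h18]) (fun k τ => (∀ x, τ.mem 2 x = s.mem 2 x ∨
        ∃ j < m, x = (j : ℕ) ∧ -((j + 1 : ℕ) : ℤ) ∈ E ∧ v j ∈ D ∧ τ.mem 2 x = s.reg 13) ∧
      ∀ j < m, ∀ i < k, E.getD i 0 = -((j + 1 : ℕ) : ℤ) → v j ∈ D → τ.mem 2 j = s.reg 13)
    (70 + 40 * (E.length + 1)) ⟨fun x => Or.inl rfl, fun _ _ _ h => absurd h (Nat.not_lt_zero _)⟩ ?_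
  · refine ⟨⟨this.1.1, fun j hj hjE hjD => ?_⟩, this.2.trans ?_⟩
    · obtain ⟨i, hi, e⟩ := exists_getD_of_mem hjE
      exact this.1.2 j hj i hi e hjD
    · simp only [cost_reg]
      nlinarith
  rintro k hk τ hr hm ⟨h1, h2⟩
  set z := E.getD k 0 with hz
  have hzE : z ∈ E := getD_mem hk
  have g3 : τ.reg 3 = s.reg 3 := hr 3 rfl
  have g13 : τ.reg 13 = s.reg 13 := hr 13 rfl
  have g14 : τ.reg 14 = D.length := by rw [hr 14 rfl, h14]
  have g20 : τ.reg 20 = s.reg 20 := hr 20 rfl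
  have m0 : τ.mem 0 = s.mem 0 := hm 0 rfl
  have m3 : τ.mem 3 = s.mem 3 := hm 3 rfl
  have m5 : τ.mem 5 = s.mem 5 := hm 5 rfl
  have m6 : τ.mem 6 = s.mem 6 := hm 6 rfl
  set τ₁ := (33 ≔ cell 0 (reg 20 + reg 24)).eval (τ.setReg 24 k) with hτ₁
  have e33 : τ₁.reg 33 = z := by simp [hτ₁, g20, m0, hE k hk, hz]
  have ev : homeEntry.eval (τ.setReg 24 k) = (ifLT (reg 33) (lit 0) homeClause skip).eval τ₁ := rfl
  set τ₂ := (33 ≔ lit 0 - reg 33 - lit 1 ;;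
    26 ≔ cell 6 (cell 5 (reg 33) + cell 3 (reg 33) - lit 1)).eval τ₁ with hτ₂
  obtain ⟨e27, c1⟩ := find_spec (s := τ₂) (l := D)
    (by
      have : τ₂.reg 3 = s.reg 3 := by simp [hτ₂, hτ₁, g3]
      rw [this]
      exact hD.congr (by simp [hτ₂, hτ₁, m6])) (by simp [hτ₂, hτ₁, g14])
  set τ₃ := find.eval τ₂ with hτ₃
  have ev' : homeClause.eval τ₁ = (ifLT (reg 27) (lit 1) skip (put 2 (reg 33) (reg 13))).eval τ₃ :=
    rfl
  have m2 : τ₃.mem 2 = τ.mem 2 := by rw [hτ₃, frame_mem _ _ rfl]; simp [hτ₂, hτ₁]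
  refine ⟨?_, ?_⟩
  · rw [ev, eval_ifLT, eval_reg, eval_lit, e33]
    split_ifs with hz0
    · obtain ⟨j, hj, hzj⟩ := hneg z hzE hz0
      have a33 : (0 : ℤ) - z - 1 = j := by rw [hzj]; push_cast; ring
      have e33' : τ₃.reg 33 = j := by
        rw [hτ₃, frame_reg _ _ rfl]
        simp [hτ₂, e33, hzj]
      have e13 : τ₃.reg 13 = s.reg 13 := by
        rw [hτ₃, frame_reg _ _ rfl]
        simp [hτ₂, hτ₁, g13]
      have e26 : τ₂.reg 26 = v j := by
        have hh : τ₁.mem 6 (τ₁.mem 5 j + τ₁.mem 3 j - 1) = v j := by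
          simp only [hτ₁, eval_assign, MachineState.setReg_mem, m6, m5, m3]
          exact hv j hj
        simp only [hτ₂, eval_seq, eval_assign, eval_sub, eval_lit, eval_reg, eval_cell, eval_add,
          MachineState.setReg_reg, MachineState.setReg_mem, e33, a33, if_true, hh]
      rw [ev', eval_ifLT, eval_reg, eval_lit, e27, e26]
      by_cases hjD : v j ∈ D
      · simp only [if_pos hjD, lt_irrefl, if_false, eval_put, eval_reg, e33', e13,
          MachineState.setMem_mem, if_true, m2]
        refine ⟨fun x => ?_, fun j' hj' i hi hij hj'D => ?_⟩
        · by_cases hx : x = j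
          · exact Or.inr ⟨j, hj, hx, by rwa [← hzj], hjD, by simp [hx]⟩
          · rw [Function.update_of_ne hx]
            exact h1 x
        · by_cases hjj : j' = j
          · rw [hjj]; simp
          · rw [Function.update_of_ne (by exact_mod_cast hjj)]
            rcases Nat.lt_succ_iff_lt_or_eq.1 hi with hi | rfl
            · exact h2 j' hj' i hi hij hj'D
            · rw [← hz, hzj] at hij
              push_cast at hij
              omega
      · simp only [if_neg hjD, zero_lt_one, if_true, eval_skip, m2]
        refine ⟨h1, fun j' hj' i hi hij hj'D => ?_⟩
        rcases Nat.lt_succ_iff_lt_or_eq.1 hi with hi | rfl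
        · exact h2 j' hj' i hi hij hj'D
        · rw [← hz, hzj] at hij
          have : j' = j := by push_cast at hij; omega
          exact absurd (this ▸ hj'D) hjD
    · refine ⟨h1, fun j' hj' i hi hij hj'D => ?_⟩
      rcases Nat.lt_succ_iff_lt_or_eq.1 hi with hi | rfl
      · exact h2 j' hj' i hi hij hj'D
      · rw [← hz] at hij
        omega
  · have : homeEntry.cost (τ.setReg 24 k) = 8 + (4 + max (homeClause.cost τ₁) 1) := by
      simp [homeEntry, hτ₁]
    have h' : homeClause.cost τ₁ = (33 ≔ lit 0 - reg 33 - lit 1 ;;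
        26 ≔ cell 6 (cell 5 (reg 33) + cell 3 (reg 33) - lit 1)).cost τ₁ + (find.cost τ₂ +
        (ifLT (reg 27) (lit 1) skip (put 2 (reg 33) (reg 13))).cost τ₃) := rfl
    rw [this, h']
    simp only [cost_seq, cost_assign, cost_cell, cost_add, cost_reg, cost_ifLT,
      cost_lit, cost_sub, cost_skip, cost_put]
    norm_num
    omega

/-- The data of a tree decomposition as a program reads it: constraints `0, …, m - 1` with
variables `u j` and `v j`, and nodes `0, …, N - 1` with parents `P t` and encoded bags `E t`. -/
structure TreeData where
  m : ℕ
  N : ℕ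
  u : ℕ → ℤ
  v : ℕ → ℤ
  P : ℕ → ℕ
  E : ℕ → List ℤ

namespace TreeData

variable (d : TreeData)

/-- The variable that represents an entry of a bag: a constraint is represented by its first
variable. -/
def rep (z : ℤ) : ℤ := if z < 0 then d.u (-z - 1).toNat else z

/-- The nodes of the table tree in the order of elimination: first the constraints, then the nodes
of the decomposition from the last to the first, then an empty root. -/
def bag (x : ℕ) : List ℤ :=
  if x < d.m then pairList (d.u x) (d.v x)
  else if x < d.m + d.N then distinct ((d.E (d.m + d.N - 1 - x)).map d.rep)
  else []

def pos (t : ℕ) : ℕ := ∑ i ∈ Finset.range t, ((d.E i).length + 2)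

/-- The encoding of the tree decomposition is in the input from address `a` on. -/
structure Encoded (s : MachineState) (a : ℤ) : Prop where
  size : s.mem 0 a = d.N
  parent : ∀ t < d.N, s.mem 0 (a + 1 + d.pos t) = d.P t
  length : ∀ t < d.N, s.mem 0 (a + 1 + d.pos t + 1) = (d.E t).length
  entry : ∀ t < d.N, ∀ i < (d.E t).length, s.mem 0 (a + 1 + d.pos t + 2 + i) = (d.E t).getD i 0

/-- Both variables of constraint `j` are in the bag of node `t`. -/
def Adopts (t j : ℕ) : Prop :=
  -((j + 1 : ℕ) : ℤ) ∈ d.E t ∧ d.v j ∈ d.bag (d.m + d.N - 1 - t)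

theorem bag_constraint {j : ℕ} (hj : j < d.m) : d.bag j = pairList (d.u j) (d.v j) := if_pos hj

theorem bag_node {t : ℕ} (ht : t < d.N) :
    d.bag (d.m + d.N - 1 - t) = distinct ((d.E t).map d.rep) := by
  rw [bag, if_neg (by omega), if_pos (by omega)]
  congr 3
  omega

theorem bag_root : d.bag (d.m + d.N) = [] := by
  rw [bag, if_neg (by omega), if_neg (by omega)]

end TreeData

/-- The constraints and the nodes with numbers below `t` are allocated. -/
def TreeData.done (d : TreeData) (t : ℕ) : Set ℕ :=
  {x | x < d.m ∨ (d.m + d.N - t ≤ x ∧ x < d.m + d.N)}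

/-! ### Reading one node of the decomposition -/

def nodeHeader : Cmd :=
  13 ≔ reg 5 - reg 35 - lit 1 ;; put 2 (reg 13) (reg 5 - cell 0 (reg 1) - lit 1) ;;
  ifLT (reg 35) (lit 1) (put 2 (reg 13) (reg 5)) skip ;;
  18 ≔ cell 0 (reg 1 + lit 1) ;; 20 ≔ reg 1 + lit 2 ;; 1 ≔ reg 20 + reg 18 ;;
  put 5 (reg 13) (reg 3)

def readNode : Cmd :=
  nodeHeader ;; collect ;; put 3 (reg 13) (reg 14) ;; adopt ;; 3 ≔ reg 3 + reg 15

theorem pairList_getD_zero (u v : ℤ) : (pairList u v).getD 0 0 = u := by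
  rw [pairList]; split_ifs <;> rfl

theorem pairList_length_pos (u v : ℤ) : 0 < (pairList u v).length := by
  rw [pairList]; split_ifs <;> simp

theorem pairList_getD_last (u v : ℤ) : (pairList u v).getD ((pairList u v).length - 1) 0 = v := by
  rw [pairList]; split_ifs with h
  · exact h
  · rfl

/-- Node `t` gets the number `m + N - 1 - t`. Since parents precede children in the input, this puts
children before parents; node `0` is attached to the additional root `m + N`. -/
theorem readNode_spec {d : TreeData} {s : MachineState} {off : ℕ → ℕ} {e t K : ℕ} {a : ℤ}
    (hA : Allocated (d.done t) d.bag off e s) (ht : t < d.N) (hd : d.Encoded s a)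
    (h1 : s.reg 1 = a + 1 + d.pos t) (h5 : s.reg 5 = (d.m + d.N : ℕ)) (h35 : s.reg 35 = t)
    (hE : ∀ z ∈ d.E t, z < 0 → ∃ j < d.m, z = -((j + 1 : ℕ) : ℤ)) (hK : (d.E t).length ≤ K) :
    (Allocated (d.done (t + 1)) d.bag (Function.update off (d.m + d.N - 1 - t) e)
        (e + 2 ^ (d.bag (d.m + d.N - 1 - t)).length) (readNode.eval s) ∧
      (readNode.eval s).reg 1 = a + 1 + d.pos (t + 1)) ∧
    ((readNode.eval s).mem 2 (d.m + d.N - 1 - t : ℕ) =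
        (if t = 0 then ((d.m + d.N : ℕ) : ℤ) else (d.m + d.N : ℕ) - (d.P t : ℤ) - 1) ∧
      (∀ x : ℕ, d.m + d.N - t ≤ x → (readNode.eval s).mem 2 x = s.mem 2 x) ∧
      (∀ j < d.m, (readNode.eval s).mem 2 j = s.mem 2 j ∨
        d.Adopts t j ∧ (readNode.eval s).mem 2 j = (d.m + d.N - 1 - t : ℕ)) ∧
      ∀ j < d.m, d.Adopts t j → (readNode.eval s).mem 2 j = (d.m + d.N - 1 - t : ℕ)) ∧
    readNode.cost s ≤ 400 * (K + 1) ^ 2 := by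
  set id := d.m + d.N - 1 - t with hid
  have hid' : ((d.m + d.N : ℕ) : ℤ) - t - 1 = (id : ℕ) := by omega
  have hidm : d.m ≤ id := by omega
  have hnot : id ∉ d.done t := by simp only [TreeData.done, Set.mem_ofPred_eq]; omega
  have hcons : ∀ j < d.m, j ∈ d.done t := fun j hj => Or.inl hj
  have hB : d.bag id = distinct ((d.E t).map d.rep) := d.bag_node ht
  set s₁ := nodeHeader.eval s with hs₁
  have a3 : s₁.reg 3 = e := by rw [hs₁, frame_reg _ _ rfl, hA.cur]
  have a13 : s₁.reg 13 = id := by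
    rw [← hid']
    simp only [hs₁, nodeHeader, eval_seq, eval_ifLT, eval_assign, eval_skip, eval_put]
    split <;> simp [h5, h35]
  have n0 : s₁.mem 0 = s.mem 0 := by rw [hs₁, frame_mem _ _ rfl]
  have n3 : s₁.mem 3 = s.mem 3 := by rw [hs₁, frame_mem _ _ rfl]
  have n6 : s₁.mem 6 = s.mem 6 := by rw [hs₁, frame_mem _ _ rfl]
  have h1' := h1
  have a18 : s₁.reg 18 = (d.E t).length := by
    rw [← hd.length t ht, ← h1]
    simp only [hs₁, nodeHeader, eval_seq, eval_ifLT, eval_assign, eval_skip, eval_put]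
    split <;> simp
  have a20 : s₁.reg 20 = a + 1 + d.pos t + 2 := by
    rw [← h1]
    simp only [hs₁, nodeHeader, eval_seq, eval_ifLT, eval_assign, eval_skip, eval_put]
    split <;> simp
  have a1 : s₁.reg 1 = a + 1 + d.pos (t + 1) := by
    have : s₁.reg 1 = s₁.reg 20 + s₁.reg 18 := by
      simp only [hs₁, nodeHeader, eval_seq, eval_assign, eval_put]
      simp
    rw [this, a20, a18, TreeData.pos, TreeData.pos, Finset.sum_range_succ]
    push_cast
    ring
  have n5 : s₁.mem 5 = Function.update (s.mem 5) id e := by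
    rw [← hA.cur, ← a13]
    simp only [hs₁, nodeHeader, eval_seq, eval_ifLT, eval_assign, eval_skip, eval_put]
    split <;> simp
  have n2 : s₁.mem 2 = Function.update (s.mem 2) id
      (if t = 0 then ((d.m + d.N : ℕ) : ℤ) else (d.m + d.N : ℕ) - (d.P t : ℤ) - 1) := by
    by_cases ht0 : t = 0
    · rw [if_pos ht0]
      simp only [hs₁, nodeHeader, eval_seq, eval_ifLT, eval_assign, eval_skip, eval_put]
      simp [h5, h35, ← hid', ht0]
    · rw [if_neg ht0, ← hd.parent t ht, ← h1]
      simp only [hs₁, nodeHeader, eval_seq, eval_ifLT, eval_assign, eval_skip, eval_put]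
      simp [h5, h35, ← hid', ht0]
  have hoff : ∀ j < d.m, s₁.mem 5 j = off j := fun j hj => by
    rw [n5, Function.update_of_ne (by omega), hA.off_eq j (hcons j hj)]
  have hlt : ∀ j < d.m, ∀ i < (d.bag j).length, off j + i < e := fun j hj i hi => by
    have := hA.le j (hcons j hj)
    have h2 : (d.bag j).length < 2 ^ (d.bag j).length := Nat.lt_two_pow_self
    omega
  obtain ⟨⟨b14, b15, bseg, b6⟩, c2⟩ := collect_spec (s := s₁) (E := d.E t) (rep := d.rep) a3 a18
    (fun i hi => by rw [a20, n0, hd.entry t ht i hi])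
    (fun z _ hz => by rw [TreeData.rep, if_neg (not_lt.2 hz)])
    (fun z hz hz0 => by
      obtain ⟨j, hj, rfl⟩ := hE z hz hz0
      have e1 : -(-((j + 1 : ℕ) : ℤ)) - 1 = j := by push_cast; ring
      have hp : 0 < (d.bag j).length := by
        rw [d.bag_constraint hj]; exact pairList_length_pos _ _
      rw [TreeData.rep, if_pos hz0, e1, hoff j hj, n6]
      refine ⟨by have := hlt j hj 0 hp; omega, ?_⟩
      have := hA.segment j (hcons j hj) 0 hp
      rw [d.bag_constraint hj, pairList_getD_zero] at this
      simpa using this)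
  rw [← hB] at b14 b15 bseg
  set s₂ := collect.eval s₁ with hs₂
  set s₃ := (put 3 (reg 13) (reg 14)).eval s₂ with hs₃
  have r₃ : ∀ r, collect.writesReg r = false → s₃.reg r = s₁.reg r :=
    fun r hr => frame_reg (collect ;; put 3 (reg 13) (reg 14)) s₁ (by
      simp only [writesReg, hr, Bool.or_false])
  have m3 : s₃.mem 3 = Function.update (s.mem 3) id (d.bag id).length := by
    have : s₂.mem 3 = s.mem 3 := by rw [hs₂, frame_mem _ _ rfl, n3]
    have h13 : s₂.reg 13 = id := by rw [hs₂, frame_reg _ _ rfl, a13]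
    simp [hs₃, this, h13, b14]
  have m5 : s₃.mem 5 = s₁.mem 5 := frame_mem (collect ;; put 3 (reg 13) (reg 14)) s₁ rfl
  have m6 : s₃.mem 6 = s₂.mem 6 := frame_mem (put 3 (reg 13) (reg 14)) s₂ rfl
  have m0 : s₃.mem 0 = s.mem 0 :=
    (frame_mem (collect ;; put 3 (reg 13) (reg 14)) s₁ rfl).trans n0
  have m2 : s₃.mem 2 = s₁.mem 2 := frame_mem (collect ;; put 3 (reg 13) (reg 14)) s₁ rfl
  obtain ⟨⟨h2a, h2b⟩, c4⟩ := adopt_spec (s := s₃) (E := d.E t) (D := d.bag id) (m := d.m) (v := d.v)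
    (by rw [r₃ 18 rfl, a18])
    (fun i hi => by rw [r₃ 20 rfl, a20, m0, hd.entry t ht i hi])
    (by rw [r₃ 3 rfl, a3]; exact bseg.congr m6)
    (by simp [hs₃, b14])
    (by rw [hB]; exact (length_distinct_le _).trans (by simp)) hE
    (fun j hj => by
      have hp : 0 < (d.bag j).length := by
        rw [d.bag_constraint hj]; exact pairList_length_pos _ _
      have hl := hlt j hj ((d.bag j).length - 1) (by omega)
      rw [m5, hoff j hj, m3, Function.update_of_ne (by omega), hA.len j (hcons j hj), m6]
      have e1 : (off j : ℤ) + (d.bag j).length - 1 = off j + ((d.bag j).length - 1 : ℕ) := by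
        omega
      rw [e1, b6 _ (by omega), n6, hA.segment j (hcons j hj) _ (by omega), d.bag_constraint hj,
        pairList_getD_last])
  rw [r₃ 13 rfl, a13] at h2a h2b
  set s₄ := adopt.eval s₃ with hs₄
  have ev : readNode.eval s = (3 ≔ reg 3 + reg 15).eval s₄ := rfl
  have q2 : (readNode.eval s).mem 2 = s₄.mem 2 := rfl
  have q : ∀ a, adopt.writesMem a = false → (readNode.eval s).mem a = s₃.mem a := fun a ha => by
    rw [ev, eval_assign, MachineState.setReg_mem, hs₄, frame_mem _ _ ha]
  have hdone : insert id (d.done t) = d.done (t + 1) := by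
    ext x; simp only [TreeData.done, Set.mem_insert_iff, Set.mem_ofPred_eq]; omega
  refine ⟨⟨?_, ?_⟩, ⟨?_, ?_, ?_, ?_⟩, ?_⟩
  · rw [← hdone]
    refine hA.insert hnot ?_ ?_ ?_ ?_ ?_
    · rw [ev]
      have g3 : s₄.reg 3 = e := by rw [hs₄, frame_reg _ _ rfl, r₃ 3 rfl, a3]
      have g15 : s₄.reg 15 = 2 ^ (d.bag id).length := by
        rw [hs₄, frame_reg _ _ rfl]
        simp [hs₃, b15]
      simp [g3, g15]
    · rw [q 3 rfl, m3]
    · rw [q 5 rfl, m5, n5]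
    · intro x hx
      rw [q 6 rfl, m6, b6 x hx, n6]
    · exact bseg.congr (by rw [q 6 rfl, m6])
  · have : (readNode.eval s).reg 1 = s₁.reg 1 :=
      frame_reg (collect ;; put 3 (reg 13) (reg 14) ;; adopt ;; 3 ≔ reg 3 + reg 15) s₁ rfl
    rw [this, a1]
  · rw [q2]
    -- Adoption writes only to constraints, whose numbers are below `m ≤ id`.
    rcases h2a id with h | ⟨j, hj, hji, -⟩
    · rw [h, m2, n2, Function.update_self]
    · omega
  · intro x hx
    rw [q2]
    rcases h2a x with h | ⟨j, hj, hji, -⟩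
    · rw [h, m2, n2, Function.update_of_ne (by omega)]
    · omega
  · intro j hj
    rw [q2]
    rcases h2a j with h | ⟨j', hj', hjj, h3, h4, h5⟩
    · left
      rw [h, m2, n2, Function.update_of_ne (by omega)]
    · obtain rfl : j = j' := by exact_mod_cast hjj
      exact Or.inr ⟨⟨h3, h4⟩, h5⟩
  · intro j hj hja
    rw [q2]
    exact h2b j hj hja.1 hja.2
  · have c1 : nodeHeader.cost s ≤ 60 := by simp [nodeHeader]
    have : readNode.cost s = nodeHeader.cost s + (collect.cost s₁ +
      ((put 3 (reg 13) (reg 14)).cost s₂ + (adopt.cost s₃ + (3 ≔ reg 3 + reg 15).cost s₄))) := rfl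
    rw [this]
    simp only [cost_put, cost_assign, cost_add, cost_reg]
    have h6 : ((d.E t).length + 1) ^ 2 ≤ (K + 1) ^ 2 := Nat.pow_le_pow_left (by omega) 2
    have h7 : 1 ≤ (K + 1) ^ 2 := Nat.one_le_pow _ _ (by omega)
    clear_value s₁ s₂ s₃ s₄
    omega

/-- Read the tree decomposition that starts at address `reg 1` of the input. -/
def readTree : Cmd :=
  (36 ≔ cell 0 (reg 1) ;; 1 ≔ reg 1 + lit 1 ;; 5 ≔ reg 2 + reg 36) ;; loop 35 (reg 36) readNode ;;
  put 3 (reg 5) (lit 0) ;; put 5 (reg 5) (reg 3) ;; 3 ≔ reg 3 + lit 1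

/-- A constraint may be adopted several times, and the last adopter overwrites the others. Any of
them would do, so only the existence of an adopter that is the final parent is claimed. -/
theorem readTree_spec {d : TreeData} {s : MachineState} {off : ℕ → ℕ} {e K : ℕ}
    (hA : Allocated {j | j < d.m} d.bag off e s) (hd : d.Encoded s (s.reg 1))
    (h2 : s.reg 2 = d.m)
    (hE : ∀ t < d.N, ∀ z ∈ d.E t, z < 0 → ∃ j < d.m, z = -((j + 1 : ℕ) : ℤ))
    (hK : ∀ t < d.N, (d.E t).length ≤ K) :
    (∃ off' e', Allocated {x | x ≤ d.m + d.N} d.bag off' e' (readTree.eval s) ∧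
      (∀ j < d.m, off' j = off j) ∧ ∀ x, d.m ≤ x → x ≤ d.m + d.N → e ≤ off' x) ∧
    (readTree.eval s).reg 5 = (d.m + d.N : ℕ) ∧
    ((∀ t < d.N, (readTree.eval s).mem 2 (d.m + d.N - 1 - t : ℕ) =
        (if t = 0 then ((d.m + d.N : ℕ) : ℤ) else (d.m + d.N : ℕ) - (d.P t : ℤ) - 1)) ∧
      ∀ j < d.m, ∀ t < d.N, d.Adopts t j →
        ∃ t' < d.N, d.Adopts t' j ∧ (readTree.eval s).mem 2 j = (d.m + d.N - 1 - t' : ℕ)) ∧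
    readTree.cost s ≤ 50 + d.N * (410 * (K + 1) ^ 2) := by
  set s₁ := (36 ≔ cell 0 (reg 1) ;; 1 ≔ reg 1 + lit 1 ;; 5 ≔ reg 2 + reg 36).eval s with hs₁
  have h36 : s₁.reg 36 = d.N := by simp [hs₁, hd.size]
  have h5 : s₁.reg 5 = (d.m + d.N : ℕ) := by simp [hs₁, h2, hd.size]
  have hA₁ : Allocated (d.done 0) d.bag off e s₁ := by
    have : d.done 0 = {j | j < d.m} := by
      ext x; simp only [TreeData.done, Set.mem_ofPred_eq]; omega
    rw [this]
    exact hA.congr (by simp [hs₁]) rfl rfl rfl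
  have := loop_rule' (i := 35) (e := reg 36) (p := readNode) (s := s₁) (n := d.N) (by simp [h36])
    (fun t τ => (∃ off' e', Allocated (d.done t) d.bag off' e' τ ∧ e ≤ e' ∧
        (∀ j < d.m, off' j = off j) ∧ ∀ x ∈ d.done t, d.m ≤ x → e ≤ off' x) ∧
      τ.reg 1 = s.reg 1 + 1 + d.pos t ∧
      (∀ t' < t, τ.mem 2 (d.m + d.N - 1 - t' : ℕ) =
        (if t' = 0 then ((d.m + d.N : ℕ) : ℤ) else (d.m + d.N : ℕ) - (d.P t' : ℤ) - 1)) ∧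
      ∀ j < d.m, ∀ t' < t, d.Adopts t' j →
        ∃ t'' < t, d.Adopts t'' j ∧ τ.mem 2 j = (d.m + d.N - 1 - t'' : ℕ))
    (400 * (K + 1) ^ 2) ⟨⟨off, e, hA₁, le_rfl, fun _ _ => rfl, fun x hx hmx => ?_⟩,
      by simp [hs₁, TreeData.pos], fun _ h => absurd h (Nat.not_lt_zero _),
      fun _ _ _ h => absurd h (Nat.not_lt_zero _)⟩ ?_
  · set s₂ := (loop 35 (reg 36) readNode).eval s₁ with hs₂
    obtain ⟨⟨⟨off', e', hA₂, hee, hoff, hge⟩, -, hpar, had⟩, hc⟩ := this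
    have h5' : s₂.reg 5 = (d.m + d.N : ℕ) := by rw [hs₂, frame_reg _ _ rfl, h5]
    have ev : readTree.eval s = (put 3 (reg 5) (lit 0) ;; put 5 (reg 5) (reg 3) ;;
      3 ≔ reg 3 + lit 1).eval s₂ := rfl
    have hroot := d.bag_root
    have h3 := hA₂.cur
    -- The empty root has a table with a single cell.
    refine ⟨⟨Function.update off' (d.m + d.N) e', e' + 1, ?_, fun j hj => ?_, fun x hx hx' => ?_⟩,
      ?_, ⟨?_, ?_⟩, ?_⟩
    · have := hA₂.insert (t := d.m + d.N) (s' := readTree.eval s)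
        (by simp only [TreeData.done, Set.mem_ofPred_eq]; omega)
        (by rw [ev, hroot]; simp [h3]) (by rw [ev, hroot]; simp [h5'])
        (by rw [ev]; simp [h5', h3]) (by rw [ev]; simp) (by rw [hroot]; simp [Segment])
      rw [hroot] at this
      have hset : insert (d.m + d.N) (d.done d.N) = {x | x ≤ d.m + d.N} := by
        ext x; simp only [TreeData.done, Set.mem_insert_iff, Set.mem_ofPred_eq]; omega
      rw [hset] at this
      exact this
    · rw [Function.update_of_ne (by omega), hoff j hj]
    · by_cases hx0 : x = d.m + d.N
      · rw [hx0, Function.update_self]; exact hee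
      · rw [Function.update_of_ne hx0]
        exact hge x (by simp only [TreeData.done, Set.mem_ofPred_eq]; omega) hx
    · rw [ev]; simp [h5']
    · rw [ev]; simpa using hpar
    · rw [ev]; simpa using had
    · have : readTree.cost s = (36 ≔ cell 0 (reg 1) ;; 1 ≔ reg 1 + lit 1 ;;
        5 ≔ reg 2 + reg 36).cost s + ((loop 35 (reg 36) readNode).cost s₁ +
        (put 3 (reg 5) (lit 0) ;; put 5 (reg 5) (reg 3) ;; 3 ≔ reg 3 + lit 1).cost s₂) := rfl
      rw [this]
      simp only [cost_seq, cost_put, cost_assign, cost_add, cost_reg, cost_cell, cost_lit] at hc ⊢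
      have h7 : 1 ≤ (K + 1) ^ 2 := Nat.one_le_pow _ _ (by omega)
      have h8 : d.N * (400 * (K + 1) ^ 2 + 5) ≤ d.N * (410 * (K + 1) ^ 2) :=
        Nat.mul_le_mul_left _ (by omega)
      omega
  · simp only [TreeData.done, Set.mem_ofPred_eq] at hx
    omega
  rintro t ht τ hr hm ⟨⟨off', e', hA₂, hee, hoff, hge⟩, h1, hpar, had⟩
  have m0 : τ.mem 0 = s.mem 0 := by rw [hm 0 rfl]; simp [hs₁]
  obtain ⟨⟨hA₃, r1⟩, ⟨p1, p2, p3, p4⟩, hc⟩ := readNode_spec (s := τ.setReg 35 t) (K := K)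
    (hA₂.congr (s' := τ.setReg 35 t) (by simp) rfl rfl rfl) ht
    (a := s.reg 1) ⟨by simp [m0, hd.size], fun t ht => by simpa [m0] using hd.parent t ht,
      fun t ht => by simpa [m0] using hd.length t ht,
      fun t ht i hi => by simpa [m0] using hd.entry t ht i hi⟩
    (by simp [h1]) (by simp [hr 5 rfl, h5]) (by simp) (hE t ht) (hK t ht)
  refine ⟨⟨⟨_, _, hA₃, hee.trans (Nat.le_add_right _ _), fun j hj => ?_, fun x hx hmx => ?_⟩, r1,
    fun t' ht' => ?_,
    fun j hj t' ht' hja => ?_⟩, hc⟩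
  · rw [Function.update_of_ne (by omega), hoff j hj]
  · by_cases hx0 : x = d.m + d.N - 1 - t
    · rw [hx0, Function.update_self]; exact hee
    · rw [Function.update_of_ne hx0]
      refine hge x ?_ hmx
      simp only [TreeData.done, Set.mem_ofPred_eq] at hx ⊢
      omega
  · rcases Nat.lt_succ_iff_lt_or_eq.1 ht' with ht' | rfl
    · rw [p2 _ (by omega)]; exact hpar t' ht'
    · exact p1
  · by_cases hjt : d.Adopts t j
    · exact ⟨t, by omega, hjt, p4 j hj hjt⟩
    · rcases Nat.lt_succ_iff_lt_or_eq.1 ht' with ht' | rfl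
      · obtain ⟨t'', h1, h2, h3⟩ := had j hj t' ht' hja
        rcases p3 j hj with h | ⟨h, -⟩
        · exact ⟨t'', by omega, h2, by rw [h]; exact h3⟩
        · exact absurd h hjt
      · exact absurd hja hjt

/-- The properties of a tree decomposition on which dynamic programming relies. -/
structure TreeData.Decomposes (d : TreeData) : Prop where
  parent_lt : ∀ t < d.N, t ≠ 0 → d.P t < t
  entry_neg : ∀ t < d.N, ∀ z ∈ d.E t, z < 0 → ∃ j < d.m, z = -((j + 1 : ℕ) : ℤ)
  adopted : ∀ j < d.m, ∃ t < d.N, d.Adopts t j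
  top : ∀ t < d.N, ∀ z ∈ (d.E t).map d.rep, (t = 0 ∨ z ∉ (d.E (d.P t)).map d.rep) →
    ∀ s < d.N, z ∈ (d.E s).map d.rep → t ≤ s

theorem TreeData.mem_bag_node {d : TreeData} {t : ℕ} (ht : t < d.N) {z : ℤ} :
    z ∈ d.bag (d.m + d.N - 1 - t) ↔ z ∈ (d.E t).map d.rep := by
  rw [d.bag_node ht, mem_distinct]

theorem TreeData.nodup_bag (d : TreeData) (x : ℕ) : (d.bag x).Nodup := by
  rw [TreeData.bag]
  split_ifs with h1 h2
  · rw [pairList]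
    split_ifs with h
    · exact List.nodup_singleton _
    · simpa using h
  · exact nodup_distinct _
  · exact List.nodup_nil

/-- The bound is `k + 2` and not `k + 1` because it also covers the constraints, which may have two
variables even if `k = 0`. -/
theorem TreeData.length_bag_le {d : TreeData} {k : ℕ} (hk : ∀ t < d.N, (d.E t).length ≤ k + 1)
    (x : ℕ) : (d.bag x).length ≤ k + 2 := by
  rw [TreeData.bag]
  split_ifs with h1 h2
  · rw [pairList]
    split_ifs <;> simp
  · refine (length_distinct_le _).trans ?_
    rw [List.length_map]
    have := hk (d.m + d.N - 1 - x) (by omega)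
    omega
  · simp

theorem TreeData.Adopts.subset {d : TreeData} {t j : ℕ} (ht : t < d.N) (h : d.Adopts t j) {z : ℤ}
    (hz : z ∈ pairList (d.u j) (d.v j)) : z ∈ d.bag (d.m + d.N - 1 - t) := by
  have hu : d.u j ∈ d.bag (d.m + d.N - 1 - t) := by
    rw [TreeData.mem_bag_node ht]
    refine List.mem_map.2 ⟨_, h.1, ?_⟩
    rw [TreeData.rep, if_pos (by omega)]
    congr 1
    omega
  have : z = d.u j ∨ z = d.v j := by
    rw [pairList] at hz
    split_ifs at hz <;> simp at hz <;> tauto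
  rcases this with rfl | rfl
  · exact hu
  · exact h.2

/-- This absorbs the quadratic cost of comparing bags of length at most `k + 2`. -/
theorem add_three_sq_le (k : ℕ) : (k + 3) ^ 2 ≤ 16 * 2 ^ k := by
  induction k with
  | zero => norm_num
  | succ k ih =>
    have : (k + 1 + 3) ^ 2 + (k ^ 2 + 4 * k + 2) = 2 * (k + 3) ^ 2 := by ring
    rw [pow_succ 2 k]
    omega

/-- Read the tree decomposition and minimize. -/
def solve : Cmd := readTree ;; minimize

/-- The stored data form a valid `TableTree` whose objective is the sum of the constraints: the
tables of the decomposition nodes are zero at the start and only collect minima. -/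
theorem solve_spec {d : TreeData} {g : ℕ → Bool → Bool → ℤ} {s : MachineState} {off : ℕ → ℕ}
    {e k : ℕ} (hd : d.Decomposes) (hB : Built d.u d.v g d.bag d.m off e s)
    (hE : d.Encoded s (s.reg 1)) (h2 : s.reg 2 = d.m) (h8 : ∀ a, s.mem 8 a = 0)
    (hk : ∀ t < d.N, (d.E t).length ≤ k + 1) :
    (solve.eval s).reg 0 = ∑ j ∈ Finset.range d.m,
      g j ((solve.eval s).output (d.u j)) ((solve.eval s).output (d.v j)) ∧
    (∀ β : ℤ → Bool, (solve.eval s).reg 0 ≤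
      ∑ j ∈ Finset.range d.m, g j (β (d.u j)) (β (d.v j))) ∧
    solve.cost s ≤ 100 + (d.m + d.N) * (30000 * 2 ^ k) := by
  obtain ⟨⟨off', e', hA, hoff, hge⟩, h5, ⟨hpar, had⟩, c1⟩ :=
    readTree_spec hB.alloc hE h2 hd.entry_neg hk
  set s₁ := readTree.eval s with hs₁
  have m : ∀ a, readTree.writesMem a = false → s₁.mem a = s.mem a := fun a ha => frame_mem _ _ ha
  -- The parents are taken from the memory, since the adopter of a constraint is determined only by
  -- the run.
  let G : TableTree := ⟨d.m + d.N, d.bag, fun x => (s₁.mem 2 x).toNat, off'⟩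
  have hcons : ∀ j < d.m, ∃ t < d.N, d.Adopts t j ∧ s₁.mem 2 j = (d.m + d.N - 1 - t : ℕ) := by
    intro j hj
    obtain ⟨t, ht, h⟩ := hd.adopted j hj
    exact had j hj t ht h
  have hnode : ∀ x, d.m ≤ x → x < d.m + d.N → ∃ t < d.N, x = d.m + d.N - 1 - t :=
    fun x h1 h2 => ⟨d.m + d.N - 1 - x, by omega, by omega⟩
  have hparG : ∀ x < d.m + d.N, s₁.mem 2 x = G.par x ∧ x < G.par x ∧ G.par x ≤ d.m + d.N := by
    intro x hx
    change s₁.mem 2 x = ((s₁.mem 2 x).toNat : ℕ) ∧ x < (s₁.mem 2 x).toNat ∧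
      (s₁.mem 2 x).toNat ≤ d.m + d.N
    rcases lt_or_ge x d.m with hxm | hxm
    · obtain ⟨t, ht, -, h⟩ := hcons x hxm
      rw [h]
      omega
    · obtain ⟨t, ht, rfl⟩ := hnode x hxm hx
      rw [hpar t ht]
      split_ifs with h0
      · omega
      · have := hd.parent_lt t ht h0
        omega
  have hG : G.Valid := by
    refine ⟨fun t _ => d.nodup_bag t, fun t ht => (hparG t ht).2.1, fun t ht => (hparG t ht).2.2,
      ?_, hA.disjoint⟩
    intro x hx z hz hzp y hxy hyn hzy
    change x < d.m + d.N at hx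
    change y ≤ d.m + d.N at hyn
    change z ∈ d.bag x at hz
    change z ∉ d.bag (s₁.mem 2 x).toNat at hzp
    change z ∈ d.bag y at hzy
    rcases lt_or_ge x d.m with hxm | hxm
    · obtain ⟨t, ht, ha, h⟩ := hcons x hxm
      rw [h, Int.toNat_natCast] at hzp
      rw [d.bag_constraint hxm] at hz
      -- A constraint passes all its variables on to its adopter.
      exact hzp (ha.subset ht hz)
    · obtain ⟨t, ht, rfl⟩ := hnode x hxm hx
      rcases hyn.eq_or_lt with rfl | hyn
      · rw [d.bag_root] at hzy
        simp at hzy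
      · obtain ⟨t', ht', rfl⟩ := hnode y (by omega) hyn
        rw [TreeData.mem_bag_node ht] at hz
        rw [TreeData.mem_bag_node ht'] at hzy
        -- A later number in the elimination means `t' < t`, contrary to `t` being topmost for `z`.
        have := hd.top t ht z hz ?_ t' ht' hzy
        · omega
        · by_cases h0 : t = 0
          · exact Or.inl h0
          · right
            have hp := hd.parent_lt t ht h0
            have he : (((d.m + d.N : ℕ) : ℤ) - (d.P t : ℤ) - 1).toNat =
                d.m + d.N - 1 - d.P t := by omega
            rw [hpar t ht, if_neg h0, he, TreeData.mem_bag_node (hp.trans ht)] at hzp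
            exact hzp
  have hS : G.Stored s₁ := ⟨fun t ht => ⟨hA.len t ht, hA.off_eq t ht, hA.segment t ht⟩,
    fun t ht => (hparG t ht).1⟩
  have hobj : ∀ β, G.obj (s₁.mem 7) 0 β =
      ∑ j ∈ Finset.range d.m, g j (β (d.u j)) (β (d.v j)) := by
    intro β
    have hI : Finset.Icc 0 G.n = Finset.range (d.m + (d.N + 1)) := by
      ext x; simp only [Finset.mem_Icc, Finset.mem_range, G]; omega
    rw [TableTree.obj, hI, Finset.sum_range_add]
    -- All tables of decomposition nodes lie beyond `e`, where array `7` is still zero.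
    have hz : ∑ x ∈ Finset.range (d.N + 1), s₁.mem 7 (G.off (d.m + x) +
        enc β (G.bag (d.m + x))) = 0 := by
      refine Finset.sum_eq_zero fun x hx => ?_
      rw [Finset.mem_range] at hx
      rw [m 7 rfl]
      refine hB.zero _ ?_
      have := hge (d.m + x) (by omega) (by omega)
      change (e : ℤ) ≤ (off' (d.m + x) : ℤ) + _
      omega
    rw [hz, add_zero]
    refine Finset.sum_congr rfl fun j hj => ?_
    rw [Finset.mem_range] at hj
    rw [m 7 rfl, ← hB.table j hj β, ← hoff j hj]
  obtain ⟨r1, r2, c2⟩ := minimize_spec (c := 16 * 2 ^ k) hG hS d.bag_root h5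
    (fun a => by rw [m 8 rfl, h8 a]) (fun t _ => by
      have h1 := TreeData.length_bag_le hk t
      have h2 := add_three_sq_le k
      change ((d.bag t).length + 1) ^ 2 ≤ _ ∧ 2 ^ (d.bag t).length ≤ _
      constructor
      · exact (Nat.pow_le_pow_left (by omega) 2).trans h2
      · refine (Nat.pow_le_pow_right (by norm_num) h1).trans ?_
        rw [pow_add]
        omega)
  refine ⟨r1.trans (hobj _), fun β => (r2 β).trans_eq (hobj β), ?_⟩
  have : solve.cost s = readTree.cost s + minimize.cost s₁ := rfl
  rw [this]
  have h3 : d.N * (410 * (k + 1 + 1) ^ 2) ≤ d.N * (410 * (16 * 2 ^ k)) :=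
    Nat.mul_le_mul_left _ (Nat.mul_le_mul_left _
      ((Nat.pow_le_pow_left (by omega) 2).trans (add_three_sq_le k)))
  change minimize.cost s₁ ≤ 40 + (d.m + d.N) * (1200 * (16 * 2 ^ k)) at c2
  nlinarith [Nat.zero_le (d.m * 2 ^ k), Nat.zero_le (d.N * 2 ^ k)]

/-! ### Tree decompositions -/

namespace TreeDecomposition

variable {V : Type} {G : SimpleGraph V} (D : TreeDecomposition G)

/-- `t` is an ancestor of `s`, or equal to it. -/
def Above (t s : Fin D.numNodes) : Prop := ∃ n, D.parent^[n] s = t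

/-- `t` is the topmost node whose bag contains `v`. -/
def IsTop (v : V) (t : Fin D.numNodes) : Prop :=
  v ∈ D.bag t ∧ (t.val = 0 ∨ v ∉ D.bag (D.parent t))

variable {D}

theorem parent_le (t : Fin D.numNodes) : D.parent t ≤ t := by
  by_cases h : t.val = 0
  · rw [D.parent_root t h]
  · exact (D.parent_lt t h).le

theorem Above.le {t s : Fin D.numNodes} (h : D.Above t s) : t ≤ s := by
  obtain ⟨n, rfl⟩ := h
  induction n with
  | zero => exact le_rfl
  | succ n ih => rw [Function.iterate_succ_apply']; exact (parent_le _).trans ih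

/-- The nodes of a vertex that is not in the bag of the parent of `t` are below `t` if one of them
is. -/
theorem Above.of_mem_bag {t w s : Fin D.numNodes} {v : V} (h : D.Above t w)
    (ht : t.val = 0 ∨ v ∉ D.bag (D.parent t)) (hw : v ∈ D.bag w) (hs : v ∈ D.bag s) :
    D.Above t s := by
  have hr := (D.connectedness v).preconnected ⟨w, hw⟩ ⟨s, hs⟩
  rw [SimpleGraph.reachable_iff_reflTransGen] at hr
  suffices ∀ x : {t | v ∈ D.bag t}, Relation.ReflTransGen _ ⟨w, hw⟩ x → D.Above t x.val from
    this _ hr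
  intro x hx
  induction hx with
  | refl => exact h
  | @tail a b _ hab ih =>
    obtain ⟨hne, hab⟩ : a.val ≠ b.val ∧ (D.parent b.val = a.val ∨ D.parent a.val = b.val) := hab
    obtain ⟨n, hn⟩ := ih
    rcases hab with hab | hab
    · exact ⟨n + 1, by rw [Function.iterate_succ_apply, hab, hn]⟩
    · cases n with
      | zero =>
        have hat : a.val = t := hn
        rcases ht with ht | ht
        · rw [hat, D.parent_root t ht] at hab
          exact absurd (hat.trans hab) hne
        · rw [hat] at hab
          exact absurd (hab ▸ b.property) ht
      | succ n => exact ⟨n, by rw [← hab, ← Function.iterate_succ_apply, hn]⟩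

theorem IsTop.le {v : V} {t s : Fin D.numNodes} (ht : D.IsTop v t) (hs : v ∈ D.bag s) : t ≤ s :=
  (Above.of_mem_bag ⟨0, rfl⟩ ht.2 ht.1 hs).le

theorem exists_mem_bag (D : TreeDecomposition G) (v : V) : ∃ t, v ∈ D.bag t := by
  obtain ⟨⟨t, ht⟩⟩ := (D.connectedness v).nonempty
  exact ⟨t, ht⟩

theorem exists_isTop (D : TreeDecomposition G) (v : V) : ∃ t, D.IsTop v t := by
  by_contra! hno
  have : ∀ n, ∀ t : Fin D.numNodes, t.val = n → v ∉ D.bag t := by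
    intro n
    induction n using Nat.strong_induction_on with
    | _ n ih =>
      intro t htn hv
      apply hno t
      refine ⟨hv, ?_⟩
      by_cases h0 : t.val = 0
      · exact Or.inl h0
      · exact Or.inr (ih _ (htn ▸ D.parent_lt t h0) _ rfl)
  obtain ⟨t, ht⟩ := D.exists_mem_bag v
  exact this _ t rfl ht

/-- Following parents stays in `A` and decreases the number until `r` is reached, so every node of
`A` is joined to `r`. -/
theorem connected_of_top {n : ℕ} {parent : Fin n → Fin n} {A : Set (Fin n)} {r : Fin n}
    (hr : r ∈ A) (h : ∀ t ∈ A, t ≠ r → parent t ∈ A ∧ parent t < t) :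
    ((SimpleGraph.fromRel fun s t => parent t = s).induce A).Connected := by
  have key : ∀ k, ∀ t : A, t.val.val = k →
      ((SimpleGraph.fromRel fun s t => parent t = s).induce A).Reachable t ⟨r, hr⟩ := by
    intro k
    induction k using Nat.strong_induction_on with
    | _ k ih =>
      rintro ⟨t, ht⟩ hk
      by_cases htr : t = r
      · subst htr; exact SimpleGraph.Reachable.refl _
      · obtain ⟨h1, h2⟩ := h t ht htr
        refine SimpleGraph.Reachable.trans (SimpleGraph.Adj.reachable ?_)
          (ih (parent t).val (by rw [← hk]; exact h2) ⟨parent t, h1⟩ rfl)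
        exact ⟨h2.ne', Or.inr rfl⟩
  have : Nonempty A := ⟨⟨r, hr⟩⟩
  exact ⟨fun a b => (key _ a rfl).trans (key _ b rfl).symm⟩

/-- A node that is not topmost for any vertex can be contracted into its parent. -/
theorem exists_numNodes_le [Fintype V] (D : TreeDecomposition G) :
    ∃ D' : TreeDecomposition G, D'.width ≤ D.width ∧ D'.numNodes ≤ Fintype.card V + 1 := by
  classical
  choose top htop using D.exists_isTop
  -- Kept are the root and, for every vertex, its topmost node; this gives at most one node more
  -- than there are vertices.
  set K : Finset (Fin D.numNodes) := insert ⟨0, D.numNodes_pos⟩ (Finset.univ.image top) with hK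
  have h0K : (⟨0, D.numNodes_pos⟩ : Fin D.numNodes) ∈ K := Finset.mem_insert_self _ _
  have htK : ∀ v, top v ∈ K := fun v =>
    Finset.mem_insert_of_mem (Finset.mem_image_of_mem _ (Finset.mem_univ v))
  -- If a discarded node had a vertex missing in its parent, it would be topmost for that vertex and
  -- hence kept. So its bag is contained in the parent's bag, and going up leads to a kept node with
  -- a larger bag.
  have hanc : ∀ k, ∀ t : Fin D.numNodes, t.val = k → ∃ a : K, a.val ≤ t ∧ D.bag t ⊆ D.bag a := by
    intro k
    induction k using Nat.strong_induction_on with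
    | _ k ih =>
      intro t hk
      by_cases htK' : t ∈ K
      · exact ⟨⟨t, htK'⟩, le_rfl, fun _ h => h⟩
      · have h0 : t.val ≠ 0 := by
          intro h
          apply htK'
          convert h0K
        have hlt := D.parent_lt t h0
        obtain ⟨a, ha, hsub⟩ := ih _ (by rw [← hk]; exact hlt) (D.parent t) rfl
        refine ⟨a, ha.trans hlt.le, fun v hv => hsub ?_⟩
        by_contra hvp
        have h1 : D.IsTop v t := ⟨hv, Or.inr hvp⟩
        have h2 : t = top v := le_antisymm (h1.le (htop v).1) ((htop v).le hv)
        exact htK' (h2 ▸ htK v)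
  choose anc hle hsub using fun t : Fin D.numNodes => hanc _ t rfl
  -- An increasing renumbering keeps parents before children.
  let ι : Fin K.card ≃o K := K.orderIsoOfFin rfl
  have hι : ∀ i : Fin K.card, i.val ≠ 0 → (ι i).val.val ≠ 0 := by
    intro i hi h
    have hpos : 0 < K.card := Finset.card_pos.2 ⟨_, h0K⟩
    have hlt : ι ⟨0, hpos⟩ < ι i := ι.lt_iff_lt.2 (Fin.mk_lt_of_lt_val (Nat.pos_of_ne_zero hi))
    have : (ι ⟨0, hpos⟩).val.val < (ι i).val.val := hlt
    omega
  let par : Fin K.card → Fin K.card :=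
    fun i => if i.val = 0 then i else ι.symm (anc (D.parent (ι i).val))
  have hpar : ∀ i : Fin K.card, i.val ≠ 0 → par i = ι.symm (anc (D.parent (ι i).val)) :=
    fun i hi => if_neg hi
  have hplt : ∀ i : Fin K.card, i.val ≠ 0 → par i < i := by
    intro i hi
    rw [hpar i hi]
    refine (ι.symm_apply_lt).2 ?_
    exact lt_of_le_of_lt (b := D.parent (ι i).val) (hle _) (D.parent_lt _ (hι i hi))
  let D' : TreeDecomposition G :=
    { numNodes := K.card
      numNodes_pos := Finset.card_pos.2 ⟨_, h0K⟩
      parent := par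
      parent_root := fun t ht => if_pos ht
      parent_lt := hplt
      bag := fun i => D.bag (ι i).val
      connectedness := by
        intro v
        refine connected_of_top (r := ι.symm ⟨top v, htK v⟩) ?_ fun i hi hne => ?_
        · simpa using (htop v).1
        · have hne' : (ι i).val ≠ top v := by
            intro h
            apply hne
            rw [OrderIso.eq_symm_apply]
            exact Subtype.ext h
          have hvp : v ∈ D.bag (D.parent (ι i).val) ∧ (ι i).val.val ≠ 0 := by
            by_contra hcon
            have : D.IsTop v (ι i).val := by
              refine ⟨hi, ?_⟩
              by_cases h0 : (ι i).val.val = 0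
              · exact Or.inl h0
              · exact Or.inr fun h => hcon ⟨h, h0⟩
            exact hne' (le_antisymm (this.le (htop v).1) ((htop v).le hi))
          have hi0 : i.val ≠ 0 := by
            intro h
            apply hvp.2
            have hz : ι i ≤ ⟨⟨0, D.numNodes_pos⟩, h0K⟩ := by
              rw [← OrderIso.le_symm_apply]
              exact Fin.mk_le_of_le_val (by omega)
            have : (ι i).val.val ≤ 0 := hz
            omega
          refine ⟨?_, hplt i hi0⟩
          rw [hpar i hi0]
          simpa using hsub _ hvp.1
      covering := by
        intro a b hab
        obtain ⟨t, h1, h2⟩ := D.covering a b hab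
        exact ⟨ι.symm (anc t), by simpa using hsub t h1, by simpa using hsub t h2⟩ }
  refine ⟨D', ?_, ?_⟩
  · refine Nat.sub_le_sub_right (Finset.sup_le fun i _ => ?_) 1
    exact Finset.le_sup (f := fun t => (D.bag t).card) (Finset.mem_univ (ι i).val)
  · refine (Finset.card_insert_le _ _).trans (Nat.add_le_add_right ?_ 1)
    exact Finset.card_image_le

/-- The decomposition with one node. -/
def trivial [Fintype V] (G : SimpleGraph V) : TreeDecomposition G where
  numNodes := 1
  numNodes_pos := one_pos
  parent t := t
  parent_root _ _ := rfl
  parent_lt t ht := absurd (by omega) ht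
  bag _ := Finset.univ
  connectedness v := connected_of_top (r := 0) (Finset.mem_univ v)
    fun t _ ht => absurd (Subsingleton.elim t 0) ht
  covering u v _ := ⟨0, Finset.mem_univ u, Finset.mem_univ v⟩

theorem exists_width_eq_treewidth [Fintype V] (G : SimpleGraph V) :
    ∃ D : TreeDecomposition G, D.width = treewidth G ∧ D.numNodes ≤ Fintype.card V + 1 := by
  obtain ⟨D, hD⟩ := Nat.sInf_mem (s := {w | ∃ D : TreeDecomposition G, D.width = w})
    ⟨_, trivial G, rfl⟩
  obtain ⟨D', h1, h2⟩ := D.exists_numNodes_le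
  exact ⟨D', le_antisymm (h1.trans_eq hD) (Nat.sInf_le ⟨D', rfl⟩), h2⟩

theorem card_bag_le (D : TreeDecomposition G) (t : Fin D.numNodes) :
    (D.bag t).card ≤ D.width + 1 := by
  have := Finset.le_sup (f := fun t => (D.bag t).card) (Finset.mem_univ t)
  simp only [width]
  omega

end TreeDecomposition

/-! ### The data of a decomposition of an incidence graph -/

section

variable {κ : Type} {S : Finset κ} {sc : κ → Finset ℕ}

/-- The members of the listing `cs` contain the variables `u j` and `v j`, or none. -/
def Scopes (cs : List κ) (sc : κ → Finset ℕ) (u v : ℕ → ℤ) : Prop :=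
  ∀ j, ∀ hj : j < cs.length, (∀ x : ℕ, x ∈ sc cs[j] ↔ (x : ℤ) = u j ∨ (x : ℤ) = v j) ∧
    (0 ≤ u j ∧ 0 ≤ v j ∨ u j = -((j + 1 : ℕ) : ℤ) ∧ v j = -((j + 1 : ℕ) : ℤ))

theorem incidenceGraph_adj {x : {x : ℕ // x ∈ occurringVars S sc}} {c : {c : κ // c ∈ S}} :
    (incidenceGraph S sc).Adj (Sum.inl x) (Sum.inr c) ↔ x.val ∈ sc c.val := by
  simp [incidenceGraph]

variable [DecidableEq κ]

def treeData (cs : List κ) (u v : ℕ → ℤ) (D : TreeDecomposition (incidenceGraph S sc))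
    (bags : Fin D.numNodes → List (IncidenceVertex S sc)) : TreeData where
  m := cs.length
  N := D.numNodes
  u := u
  v := v
  P t := if h : t < D.numNodes then (D.parent ⟨t, h⟩).val else 0
  E t := if h : t < D.numNodes then (bags ⟨t, h⟩).map (encodeVertex cs) else []

variable {cs : List κ} {u v : ℕ → ℤ} {D : TreeDecomposition (incidenceGraph S sc)}
  {bags : Fin D.numNodes → List (IncidenceVertex S sc)}

theorem treeData_P (t : Fin D.numNodes) :
    (treeData cs u v D bags).P t.val = (D.parent t).val := dif_pos t.isLt

theorem treeData_E (t : Fin D.numNodes) :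
    (treeData cs u v D bags).E t.val = (bags t).map (encodeVertex cs) := dif_pos t.isLt

/-- The variable that represents a vertex. -/
def vertexRep (cs : List κ) (u : ℕ → ℤ) : IncidenceVertex S sc → ℤ
  | Sum.inl x => (x.val : ℤ)
  | Sum.inr c => u (cs.idxOf c.val)

theorem rep_encodeVertex (w : IncidenceVertex S sc) :
    (treeData cs u v D bags).rep (encodeVertex cs w) = vertexRep cs u w := by
  rcases w with x | c
  · exact if_neg (by simp [encodeVertex])
  · rw [TreeData.rep, encodeVertex, if_pos (by omega)]
    simp [treeData, vertexRep]

theorem mem_map_rep (hbags : ∀ t, ListingOf (bags t) (D.bag t)) (t : Fin D.numNodes) (z : ℤ) :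
    z ∈ ((treeData cs u v D bags).E t.val).map (treeData cs u v D bags).rep ↔
      ∃ w ∈ D.bag t, vertexRep cs u w = z := by
  rw [treeData_E, List.map_map, List.mem_map]
  simp only [Function.comp, rep_encodeVertex, (hbags t).2]

/-- The vertices with one representative form a star: the variable itself and the constraints that
have it as first variable. An empty clause is alone, since negative representatives are distinct. -/
theorem exists_hub (hcs : ListingOf cs S) (hsc : Scopes cs sc u v) (w₀ : IncidenceVertex S sc) :
    ∃ h : IncidenceVertex S sc, vertexRep cs u h = vertexRep cs u w₀ ∧
      ∀ w, vertexRep cs u w = vertexRep cs u w₀ →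
      w = h ∨ (incidenceGraph S sc).Adj h w := by
  have hidx : ∀ c : {c : κ // c ∈ S}, cs.idxOf c.val < cs.length := fun c =>
    List.idxOf_lt_length_iff.2 ((hcs.2 _).2 c.property)
  have hvar : ∀ x : {x : ℕ // x ∈ occurringVars S sc}, ∀ w : IncidenceVertex S sc,
      vertexRep cs u w = x.val → w = Sum.inl x ∨ (incidenceGraph S sc).Adj (Sum.inl x) w := by
    rintro x (y | c) hw
    · left
      rw [Subtype.ext (Int.ofNat_inj.1 hw)]
    · right
      have := ((hsc _ (hidx c)).1 x.val).2 (Or.inl hw.symm)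
      rw [List.getElem_idxOf] at this
      exact incidenceGraph_adj.2 this
  rcases w₀ with x | c
  · exact ⟨_, rfl, hvar x⟩
  · rcases (hsc _ (hidx c)).2 with ⟨h0, _⟩ | ⟨h0, _⟩
    · obtain ⟨x, hx⟩ := Int.eq_ofNat_of_zero_le h0
      have hm := ((hsc _ (hidx c)).1 x).2 (Or.inl hx.symm)
      rw [List.getElem_idxOf] at hm
      refine ⟨Sum.inl ⟨x, Finset.mem_biUnion.2 ⟨_, c.property, hm⟩⟩, hx.symm,
        fun w hw => hvar _ w ?_⟩
      rw [hw]; exact hx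
    · refine ⟨Sum.inr c, rfl, fun w hw => Or.inl ?_⟩
      rcases w with y | c'
      · simp only [vertexRep] at hw; omega
      · simp only [vertexRep] at hw
        have : cs.idxOf c'.val = cs.idxOf c.val := by
          rcases (hsc _ (hidx c')).2 with h1 | h1 <;> omega
        rw [Subtype.ext ((List.idxOf_inj ((hcs.2 _).2 c'.property)).1 this)]

/-- Contracting each constraint into its first variable preserves the decomposition. Covering the
edge to the second variable yields an adopter, and the nodes of a star are connected because each
leaf shares a bag with the hub. -/
theorem treeData_decomposes (hcs : ListingOf cs S) (hbags : ∀ t, ListingOf (bags t) (D.bag t))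
    (hsc : Scopes cs sc u v) : (treeData cs u v D bags).Decomposes := by
  refine ⟨?_, ?_, ?_, ?_⟩
  · intro t ht h0
    have := treeData_P (cs := cs) (u := u) (v := v) (bags := bags) ⟨t, ht⟩
    rw [this]
    exact D.parent_lt ⟨t, ht⟩ h0
  · intro t ht z hz hneg
    rw [treeData_E ⟨t, ht⟩, List.mem_map] at hz
    obtain ⟨x | c, hw, rfl⟩ := hz
    · simp only [encodeVertex] at hneg; omega
    · refine ⟨cs.idxOf c.val, List.idxOf_lt_length_iff.2 ((hcs.2 _).2 c.property), ?_⟩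
      simp [encodeVertex]
  · intro j hj
    have hj' : j < cs.length := hj
    set c : {c : κ // c ∈ S} := ⟨cs[j], (hcs.2 _).1 (List.getElem_mem hj')⟩ with hc
    have hidx : cs.idxOf c.val = j := hcs.1.idxOf_getElem j hj'
    have hadopt : ∀ t : Fin D.numNodes, Sum.inr c ∈ D.bag t →
        (∃ w ∈ D.bag t, vertexRep cs u w = v j) →
        ∃ t < D.numNodes, (treeData cs u v D bags).Adopts t j := by
      intro t h1 h2
      refine ⟨t.val, t.isLt, ?_, ?_⟩
      · rw [treeData_E, List.mem_map]
        refine ⟨_, ((hbags t).2 _).2 h1, ?_⟩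
        simp only [encodeVertex, hidx]
        push_cast; rfl
      · rw [TreeData.mem_bag_node t.isLt]
        exact (mem_map_rep hbags t _).2 h2
    rcases (hsc j hj').2 with ⟨_, h0⟩ | ⟨h0, h1⟩
    · obtain ⟨x, hx⟩ := Int.eq_ofNat_of_zero_le h0
      have hm := ((hsc j hj').1 x).2 (Or.inr hx.symm)
      obtain ⟨t, h1, h2⟩ := D.covering (Sum.inl ⟨x, Finset.mem_biUnion.2 ⟨_, c.property, hm⟩⟩)
        (Sum.inr c) (incidenceGraph_adj.2 hm)
      exact hadopt t h2 ⟨_, h1, hx.symm⟩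
    · obtain ⟨t, ht⟩ := D.exists_mem_bag (Sum.inr c)
      exact hadopt t ht ⟨_, ht, by rw [vertexRep, hidx, h0, h1]⟩
  · intro t ht z hz htop s hs hzs
    obtain ⟨w, hw, hwz⟩ := (mem_map_rep hbags ⟨t, ht⟩ z).1 hz
    obtain ⟨w', hw', hwz'⟩ := (mem_map_rep hbags ⟨s, hs⟩ z).1 hzs
    obtain ⟨h, hhz, hh⟩ := exists_hub hcs hsc w
    have hno : ∀ x, vertexRep cs u x = z →
        (⟨t, ht⟩ : Fin D.numNodes).val = 0 ∨ x ∉ D.bag (D.parent ⟨t, ht⟩) := by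
      intro x hx
      rcases htop with h0 | hn
      · exact Or.inl h0
      · right
        intro hmem
        apply hn
        rw [treeData_P ⟨t, ht⟩]
        exact (mem_map_rep hbags _ z).2 ⟨x, hmem, hx⟩
    have hshare : ∀ x, vertexRep cs u x = z → ∃ q, x ∈ D.bag q ∧ h ∈ D.bag q := by
      intro x hx
      rcases hh x (hx.trans hwz.symm) with rfl | hadj
      · obtain ⟨q, hq⟩ := D.exists_mem_bag x
        exact ⟨q, hq, hq⟩
      · obtain ⟨q, h1, h2⟩ := D.covering _ _ hadj
        exact ⟨q, h2, h1⟩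
    obtain ⟨q, hq, hqh⟩ := hshare w hwz
    obtain ⟨q', hq', hqh'⟩ := hshare w' hwz'
    -- From `t` to `s` inside the subtrees of `w`, the hub and `w'` in turn; none of the three is in
    -- the parent's bag, so the walk stays below `t`.
    have h1 : D.Above ⟨t, ht⟩ q := TreeDecomposition.Above.of_mem_bag ⟨0, rfl⟩ (hno w hwz) hw hq
    have h2 : D.Above ⟨t, ht⟩ q' := h1.of_mem_bag (hno h (hhz.trans hwz)) hqh hqh'
    exact (h2.of_mem_bag (hno w' hwz') hq' hw').le

theorem length_treeData_E_le (hbags : ∀ t, ListingOf (bags t) (D.bag t)) {t : ℕ}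
    (ht : t < D.numNodes) : ((treeData cs u v D bags).E t).length ≤ D.width + 1 := by
  classical
  rw [treeData_E ⟨t, ht⟩, List.length_map, ← List.toFinset_card_of_nodup (hbags ⟨t, ht⟩).1]
  refine le_trans (Finset.card_le_card fun w hw => ?_) (D.card_bag_le ⟨t, ht⟩)
  exact ((hbags _).2 w).1 (List.mem_toFinset.1 hw)

end

/-! ### Reading encoded lists -/

/-- The words `l` are in the input from address `a` on. -/
def Holds (s : MachineState) (a : ℤ) (l : List ℤ) : Prop :=
  ∀ k < l.length, s.mem 0 (a + k) = l.getD k 0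

theorem holds_init (l : List ℤ) : Holds (MachineState.init l) 0 l := by
  intro k _
  simp [MachineState.init]

theorem Holds.congr {s s' : MachineState} {a : ℤ} {l : List ℤ} (h : Holds s a l)
    (h0 : s'.mem 0 = s.mem 0) : Holds s' a l := fun k hk => by rw [h0, h k hk]

theorem Holds.head {s : MachineState} {a x : ℤ} {l : List ℤ} (h : Holds s a (x :: l)) :
    s.mem 0 a = x := by
  simpa [List.getD_cons_zero] using h 0 (by simp)

theorem Holds.tail {s : MachineState} {a x : ℤ} {l : List ℤ} (h : Holds s a (x :: l)) :
    Holds s (a + 1) l := by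
  intro k hk
  have := h (k + 1) (by simpa using hk)
  rw [List.getD_cons_succ] at this
  rw [← this]
  push_cast; ring_nf

theorem Holds.left {s : MachineState} {a : ℤ} {l l' : List ℤ} (h : Holds s a (l ++ l')) :
    Holds s a l := by
  intro k hk
  rw [h k (by rw [List.length_append]; omega), List.getD_append _ _ _ _ hk]

theorem Holds.right {s : MachineState} {a : ℤ} {l l' : List ℤ} (h : Holds s a (l ++ l')) :
    Holds s (a + l.length) l' := by
  intro k hk
  have := h (l.length + k) (by rw [List.length_append]; omega)
  rw [List.getD_append_right _ _ _ _ (by omega), Nat.add_sub_cancel_left] at this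
  rw [← this]
  push_cast; ring_nf

theorem Holds.flatMap {α : Type*} {s : MachineState} {f : α → List ℤ} (len : ℕ → ℕ)
    {L : List α} {a : ℤ} (h : Holds s a (L.flatMap f))
    (hlen : ∀ i, ∀ hi : i < L.length, (f L[i]).length = len i) {i : ℕ} (hi : i < L.length) :
    Holds s (a + (∑ j ∈ Finset.range i, len j : ℕ)) (f L[i]) := by
  induction L generalizing a len i with
  | nil => simp at hi
  | cons x L ih =>
    rw [List.flatMap_cons] at h
    cases i with
    | zero => simpa using h.left
    | succ i =>
      have h0 : (f x).length = len 0 := hlen 0 (by simp)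
      have := ih (fun j => len (j + 1)) h.right
        (fun j hj => hlen (j + 1) (by simpa using hj)) (i := i) (by simpa using hi)
      rw [Finset.sum_range_succ', ← h0]
      simp only [List.getElem_cons_succ]
      convert this using 1
      push_cast; ring

theorem flatMap_singleton_eq_map {α : Type*} (f : α → ℤ) (l : List α) :
    (l.flatMap fun x => [f x]) = l.map f := by
  induction l <;> simp_all

theorem encodeList_singleton {α : Type} (f : α → ℤ) (l : List α) :
    encodeList (fun x => [f x]) l = (l.length : ℤ) :: l.map f := by
  rw [encodeList, flatMap_singleton_eq_map]

theorem TreeData.encoded_of_holds {κ : Type} [DecidableEq κ] {S : Finset κ} {sc : κ → Finset ℕ}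
    {cs : List κ} {u v : ℕ → ℤ} {D : TreeDecomposition (incidenceGraph S sc)}
    {bags : Fin D.numNodes → List (IncidenceVertex S sc)} {s : MachineState} {a : ℤ}
    (h : Holds s a (encodeDecomposition cs D bags)) :
    (treeData cs u v D bags).Encoded s a := by
  have hnode : ∀ t : Fin D.numNodes, Holds s (a + 1 + (treeData cs u v D bags).pos t.val)
      (((D.parent t).val : ℤ) :: ((bags t).length : ℤ) :: (treeData cs u v D bags).E t.val) := by
    intro t
    have := h.tail.flatMap (fun t => ((treeData cs u v D bags).E t).length + 2) ?_
      (i := t.val) (by simp)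
    · simpa [encodeList_singleton, treeData_E, TreeData.pos] using this
    · intro i hi
      have : i < D.numNodes := by simpa using hi
      have hE := treeData_E (cs := cs) (u := u) (v := v) (bags := bags) ⟨i, this⟩
      simp only at hE
      simp [encodeList_singleton, hE]
  refine ⟨?_, ?_, ?_, ?_⟩
  · rw [h.head, List.length_finRange]; rfl
  · intro t ht
    rw [(hnode ⟨t, ht⟩).head, ← treeData_P ⟨t, ht⟩]
  · intro t ht
    rw [(hnode ⟨t, ht⟩).tail.head, treeData_E ⟨t, ht⟩, List.length_map]
  · intro t ht i hi
    have := (hnode ⟨t, ht⟩).tail.tail i hi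
    rw [← this]
    ring_nf

theorem sum_range_listing {κ M : Type*} [AddCommMonoid M] {cs : List κ} {f : κ → M} {F : ℕ → M}
    (hF : ∀ j, ∀ hj : j < cs.length, F j = f cs[j]) :
    ∑ j ∈ Finset.range cs.length, F j = (cs.map f).sum := by
  induction cs generalizing F with
  | nil => rfl
  | cons c cs ih =>
    rw [List.length_cons, Finset.sum_range_succ', List.map_cons, List.sum_cons, add_comm,
      hF 0 (by simp), ih fun j hj => hF (j + 1) (by simpa using hj)]
    rfl

theorem ListingOf.sum_eq {κ M : Type} [DecidableEq κ] [AddCommMonoid M] {cs : List κ}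
    {S : Finset κ} (h : ListingOf cs S) (f : κ → M) : (cs.map f).sum = ∑ c ∈ S, f c := by
  have : cs.toFinset = S := by ext; simp [h.2]
  rw [← this, List.sum_toFinset _ h.1]

theorem ListingOf.length_eq {κ : Type} {cs : List κ} {S : Finset κ} (h : ListingOf cs S) :
    cs.length = S.card := by
  classical
  have : cs.toFinset = S := by ext; simp [h.2]
  rw [← this, List.toFinset_card_of_nodup h.1]

/-- Store the constraints that are read by `body`. -/
def build (body : Cmd) : Cmd := loop 6 (reg 2) (body ;; emit)

/-- The part common to both problems: `pos k` is the input address after `k` constraints, and `M k`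
is whatever the reader has accumulated in register 4. -/
theorem build_spec {body : Cmd} {s : MachineState} {u v : ℕ → ℤ} {g : ℕ → Bool → Bool → ℤ}
    {bag : ℕ → List ℤ} {m c : ℕ} {pos M : ℕ → ℤ} (hbag : ∀ k < m, bag k = pairList (u k) (v k))
    (hr : ∀ r, r = 3 ∨ r = 6 → body.writesReg r = false) (hm : ∀ a, body.writesMem a = false)
    (h2 : s.reg 2 = m) (h3 : s.reg 3 = 0) (h7 : ∀ a, s.mem 7 a = 0) (h1 : s.reg 1 = pos 0)
    (h4 : s.reg 4 = M 0)
    (hbody : ∀ k < m, ∀ τ : MachineState, τ.mem 0 = s.mem 0 → τ.reg 6 = k → τ.reg 1 = pos k →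
      τ.reg 4 = M k → ((body.eval τ).reg 1 = pos (k + 1) ∧ (body.eval τ).reg 4 = M (k + 1)) ∧
        ((body.eval τ).reg 7 = u k ∧ (body.eval τ).reg 8 = v k) ∧
        ((body.eval τ).reg 9 = g k false false ∧ (body.eval τ).reg 10 = g k true false ∧
          (body.eval τ).reg 11 = g k false true ∧ (body.eval τ).reg 12 = g k true true) ∧
        body.cost τ ≤ c) :
    ((∃ off e, Built u v g bag m off e ((build body).eval s)) ∧
      ((build body).eval s).reg 1 = pos m ∧ ((build body).eval s).reg 4 = M m) ∧
    (build body).cost s ≤ 10 + m * (c + 200) := by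
  have := loop_rule' (i := 6) (e := reg 2) (p := body ;; emit) (s := s) (n := m) (by simp [h2])
    (fun k τ => (∃ off e, Built u v g bag k off e τ) ∧ τ.reg 1 = pos k ∧ τ.reg 4 = M k) (c + 101)
    ⟨⟨fun _ => 0, 0, ⟨h3, by simp, by simp, by simp, by simp, by simp⟩, by simp, by simp,
      fun a _ => h7 a⟩, h1, h4⟩ ?_
  · refine ⟨this.1, this.2.trans ?_⟩
    simp only [cost_reg]
    nlinarith
  rintro k hk τ - hmem ⟨⟨off, e, hB⟩, k1, k4⟩
  obtain ⟨⟨b1, b4⟩, ⟨b7, b8⟩, ⟨b9, b10, b11, b12⟩, bc⟩ := hbody k hk (τ.setReg 6 k)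
    (hmem 0 (by simp [writesMem, hm]; rfl)) (by simp) (by simpa using k1) (by simpa using k4)
  set τ₁ := body.eval (τ.setReg 6 k) with hτ₁
  have hmm : ∀ a, τ₁.mem a = τ.mem a := fun a => by rw [hτ₁, frame_mem _ _ (hm a)]; rfl
  have hB' : Built u v g bag k off e τ₁ := by
    refine ⟨hB.alloc.congr ?_ (hmm 3) (hmm 5) (hmm 6), hB.e_le, fun j hj β => ?_, fun a ha => ?_⟩
    · rw [hτ₁, frame_reg _ _ (hr 3 (by simp))]; simp
    · rw [hmm, hB.table j hj]
    · rw [hmm, hB.zero a ha]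
  have b6 : τ₁.reg 6 = k := by rw [hτ₁, frame_reg _ _ (hr 6 (by simp))]; simp
  obtain ⟨hE, hc⟩ := emit_spec hB' (hbag k hk) b6 b7 b8 b9 (fun _ => b10) (fun _ => b11) b12
  refine ⟨⟨hE, ?_, ?_⟩, ?_⟩
  · rw [eval_seq, frame_reg _ _ rfl, b1]
  · rw [eval_seq, frame_reg _ _ rfl, b4]
  · rw [cost_seq, ← hτ₁]; omega

/-- The number of distinct variables is at most the number of their occurrences. -/
theorem card_incidenceVertex_le {κ : Type} (S : Finset κ) (sc : κ → Finset ℕ) :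
    Fintype.card (IncidenceVertex S sc) ≤ ∑ c ∈ S, ((sc c).card + 1) := by
  rw [Fintype.card_sum, Fintype.card_coe, Fintype.card_coe, Finset.sum_add_distrib,
    Finset.sum_const, smul_eq_mul, mul_one]
  exact Nat.add_le_add_right Finset.card_biUnion_le _

/-! ### QUBO -/

namespace Qubo

def readTerm : Cmd :=
  7 ≔ cell 0 (reg 1) ;; 8 ≔ cell 0 (reg 1 + lit 1) ;; 12 ≔ cell 0 (reg 1 + lit 2) ;;
  9 ≔ lit 0 ;; 10 ≔ lit 0 ;; 11 ≔ lit 0 ;; 1 ≔ reg 1 + lit 3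

def solver : Cmd := 2 ≔ cell 0 (lit 1) ;; 1 ≔ lit 2 ;; build readTerm ;; solve

/-- A linear term is the diagonal case of a product, since `x i && x i = x i`; so all terms have the
same shape. -/
theorem energy_eq (H : Qubo) (x : Fin H.n → Bool) :
    H.energy x = ∑ p ∈ H.terms, if x p.1 && x p.2 then H.w p.1 p.2 else 0 := by
  have h1 : (∑ p ∈ H.terms, if x p.1 && x p.2 then H.w p.1 p.2 else 0) =
      ∑ i, ∑ j, if i ≤ j then (if x i && x j then H.w i j else 0) else 0 := by
    rw [terms, Finset.sum_filter, ← Finset.univ_product_univ, Finset.sum_product]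
    refine Finset.sum_congr rfl fun i _ => Finset.sum_congr rfl fun j _ => ?_
    by_cases hij : i ≤ j <;> by_cases hw : H.w i j = 0 <;> simp [hij, hw]
  rw [h1, energy, ← Finset.sum_add_distrib]
  refine Finset.sum_congr rfl fun i _ => ?_
  have h2 : ∀ j, (if i ≤ j then (if x i && x j then H.w i j else 0) else 0) =
      (if i = j then H.w i i * (if x i then 1 else 0) else 0) +
        if i < j then H.w i j * (if x i then 1 else 0) * (if x j then 1 else 0) else 0 := by
    intro j
    rcases lt_trichotomy i j with h | h | h
    · cases hi : x i <;> cases hj : x j <;> simp [h, h.le, h.ne]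
    · subst h; cases hi : x i <;> simp
    · simp [h.not_ge, h.ne', h.not_gt]
  rw [Finset.sum_congr rfl fun j _ => h2 j, Finset.sum_add_distrib, Finset.sum_ite_eq,
    if_pos (Finset.mem_univ i), Finset.sum_filter]

theorem solver_spec (H : Qubo) (D : TreeDecomposition H.incGraph) (ts : List (Fin H.n × Fin H.n))
    (bags : Fin D.numNodes → List (IncidenceVertex H.terms termVars)) (hts : ListingOf ts H.terms)
    (hbags : ∀ t, ListingOf (bags t) (D.bag t)) (s : MachineState)
    (hs : s = MachineState.init (H.encode ts ++ encodeDecomposition ts D bags)) :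
    H.IsSolution (solver.eval s) ∧
      solver.cost s ≤ 40000 * 2 ^ D.width * (H.size + D.numNodes) := by
  have hH : Holds s 0 (H.encode ts ++ encodeDecomposition ts D bags) := hs ▸ holds_init _
  have r3 : s.reg 3 = 0 := by rw [hs]; rfl
  have m7 : ∀ a, s.mem 7 a = 0 := fun a => by rw [hs]; simp [MachineState.init]
  have m8 : ∀ a, s.mem 8 a = 0 := fun a => by rw [hs]; simp [MachineState.init]
  clear hs
  let u : ℕ → ℤ := fun j => if h : j < ts.length then (ts[j].1.val : ℤ) else 0
  let v : ℕ → ℤ := fun j => if h : j < ts.length then (ts[j].2.val : ℤ) else 0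
  let w : ℕ → ℤ := fun j => if h : j < ts.length then H.w ts[j].1 ts[j].2 else 0
  let g : ℕ → Bool → Bool → ℤ := fun j a b => if a && b then w j else 0
  have hu : ∀ j, ∀ h : j < ts.length, u j = ts[j].1.val := fun j h => dif_pos h
  have hv : ∀ j, ∀ h : j < ts.length, v j = ts[j].2.val := fun j h => dif_pos h
  have hw : ∀ j, ∀ h : j < ts.length, w j = H.w ts[j].1 ts[j].2 := fun j h => dif_pos h
  have hsc : Scopes ts termVars u v := by
    intro j hj
    rw [hu j hj, hv j hj]
    refine ⟨fun x => ?_, Or.inl ⟨by positivity, by positivity⟩⟩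
    simp [termVars]
  set d := treeData ts u v D bags with hd
  have hdec : d.Decomposes := treeData_decomposes hts hbags hsc
  have hterm : ∀ k, ∀ h : k < ts.length, Holds s (2 + 3 * k) [u k, v k, w k] := by
    intro k hk
    have := hH.left.tail.tail.flatMap (fun _ => 3) (fun _ _ => rfl) hk
    rw [hu k hk, hv k hk, hw k hk]
    convert this using 1
    simp; ring
  set s₁ := (2 ≔ cell 0 (lit 1) ;; 1 ≔ lit 2).eval s with hs₁
  have k2 : s₁.reg 2 = ts.length := by
    have := hH.left.tail.head
    rw [← this, hs₁]; simp
  have km : s₁.mem = s.mem := rfl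
  obtain ⟨⟨⟨off, e, hB⟩, k1, -⟩, hc⟩ := build_spec (body := readTerm) (s := s₁) (u := u) (v := v)
    -- Two words precede the terms, namely the number of variables and the number of terms; each
    -- term takes three words.
    (g := g) (bag := d.bag) (m := ts.length) (c := 100) (pos := fun k => 2 + 3 * (k : ℤ))
    (M := fun _ => s₁.reg 4) (fun k hk => d.bag_constraint hk) (by rintro r (rfl | rfl) <;> rfl)
    (fun _ => rfl) k2 r3 m7 rfl rfl (by
      intro k hk τ t0 _ t1 t4
      have h := hterm k hk
      have e0 : τ.mem 0 (2 + 3 * k) = u k := by rw [t0, km, h.head]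
      have e1 : τ.mem 0 (2 + 3 * k + 1) = v k := by rw [t0, km, h.tail.head]
      have e2 : τ.mem 0 (2 + 3 * k + 2) = w k := by
        rw [t0, km, ← h.tail.tail.head]; ring_nf
      refine ⟨⟨?_, ?_⟩, ⟨?_, ?_⟩, ⟨?_, ?_, ?_, ?_⟩, ?_⟩
      · simp [readTerm, t1]; ring
      all_goals simp [readTerm, t1, t4, e0, e1, e2, g])
  set s₂ := (build readTerm).eval s₁ with hs₂
  have q2 : s₂.reg 2 = ts.length := by rw [hs₂, frame_reg _ _ rfl, k2]
  have q0 : s₂.mem 0 = s.mem 0 := by rw [hs₂, frame_mem _ _ rfl, km]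
  have q8 : s₂.mem 8 = s.mem 8 := by rw [hs₂, frame_mem _ _ rfl, km]
  have hE : d.Encoded s₂ (s₂.reg 1) := by
    refine TreeData.encoded_of_holds ?_
    have := (hH.congr q0).right
    rw [k1]
    convert this using 1
    simp [encode, encodeList]; ring
  obtain ⟨f1, f2, f3⟩ := solve_spec hdec hB hE q2 (fun a => by rw [q8, m8])
    fun t ht => length_treeData_E_le hbags ht
  have hev : solver.eval s = solve.eval s₂ := rfl
  have hcost : solver.cost s = (2 ≔ cell 0 (lit 1) ;; 1 ≔ lit 2).cost s +
    (build readTerm).cost s₁ + solve.cost s₂ := by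
    rw [hs₂, hs₁]; simp only [solver, cost_seq, eval_seq]; ring
  have hval : ∀ (β : ℤ → Bool) (x : Fin H.n → Bool), (∀ i, β (i.val : ℤ) = x i) →
      ∑ j ∈ Finset.range d.m, g j (β (d.u j)) (β (d.v j)) = H.energy x := by
    intro β x hx
    rw [energy_eq, ← hts.sum_eq]
    refine sum_range_listing fun j hj => ?_
    change (if β (u j) && β (v j) then w j else 0) = _
    rw [hu j hj, hv j hj, hw j hj, hx, hx]
  rw [← hev] at f1 f2
  have hout : (solver.eval s).reg 0 = H.energy fun i => (solver.eval s).outputAssignment i.val :=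
    f1.trans (hval _ _ fun _ => rfl)
  refine ⟨⟨fun y => ?_, hout⟩, ?_⟩
  · let β : ℤ → Bool := fun z => if h : z.toNat < H.n then y ⟨z.toNat, h⟩ else false
    rw [← hout, ← hval β y fun i => by simp [β]]
    exact f2 β
  · have hm : ts.length + 1 ≤ H.size := by
      rw [hts.length_eq, size, Finset.card_eq_sum_ones]
      exact Nat.add_le_add_right (Finset.sum_le_sum fun _ _ => Nat.le_add_left _ _) 1
    have h2 : 1 ≤ 2 ^ D.width := Nat.one_le_two_pow
    have h3 : (2 ≔ cell 0 (lit 1) ;; 1 ≔ lit 2).cost s ≤ 50 := by simp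
    have hdm : d.m = ts.length := rfl
    have hdN : d.N = D.numNodes := rfl
    rw [hdm, hdN] at f3
    have h4 : ts.length ≤ ts.length * 2 ^ D.width := Nat.le_mul_of_pos_right _ h2
    have h5 : (ts.length + 1 + D.numNodes) * 2 ^ D.width ≤ (H.size + D.numNodes) * 2 ^ D.width :=
      Nat.mul_le_mul_right _ (by omega)
    rw [hcost]
    nlinarith

end Qubo

/-! ### Max2SAT -/

namespace WCNF

/-- Each sign pattern of the two literals has exactly one falsifying pair of values, and the weight
goes to the register of this pair. -/
def readLiterals : Cmd :=
  ifLT (lit 0) (reg 14)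
    (7 ≔ reg 14 - lit 1 ;; ifLT (lit 0) (reg 15)
      (8 ≔ reg 15 - lit 1 ;; 9 ≔ reg 16) (8 ≔ lit 0 - reg 15 - lit 1 ;; 11 ≔ reg 16))
    (7 ≔ lit 0 - reg 14 - lit 1 ;; ifLT (lit 0) (reg 15)
      (8 ≔ reg 15 - lit 1 ;; 10 ≔ reg 16) (8 ≔ lit 0 - reg 15 - lit 1 ;; 12 ≔ reg 16))

/-- The clause is always false. It becomes a constant table over the pseudo-variable `-(k + 1)`,
which is also the encoding of the clause in the bags. -/
def emptyClause : Cmd :=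
  7 ≔ lit 0 - reg 6 - lit 1 ;; 8 ≔ reg 7 ;; 9 ≔ reg 16 ;; 10 ≔ reg 16 ;; 11 ≔ reg 16 ;;
  12 ≔ reg 16

/-- `reg 4` accumulates the finite weights. -/
def readClause : Cmd :=
  13 ≔ cell 0 (reg 1) ;; 14 ≔ cell 0 (reg 1 + lit 1) ;; 15 ≔ cell 0 (reg 1 + reg 13) ;;
  16 ≔ cell 0 (reg 1 + reg 13 + lit 1) ;; 1 ≔ reg 1 + reg 13 + lit 2 ;;
  9 ≔ lit 0 ;; 10 ≔ lit 0 ;; 11 ≔ lit 0 ;; 12 ≔ lit 0 ;;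
  ifLT (reg 16) (lit 0) skip (4 ≔ reg 4 + reg 16) ;;
  ifLT (reg 13) (lit 1) emptyClause readLiterals

/-- Register 4 starts at one, so it ends strictly above the sum of the finite weights. A minimum
that is not below it stands for `∞` and is reported as `-1`. -/
def solver : Cmd :=
  2 ≔ cell 0 (lit 0) ;; 1 ≔ lit 1 ;; 4 ≔ lit 1 ;; build readClause ;; replaceNegative ;; solve ;;
  ifLT (reg 0) (reg 4) skip (0 ≔ lit (-1))

def firstLit (l : List Literal) : Literal := l.getD 0 (0, true)

def lastLit (l : List Literal) : Literal := l.getD (l.length - 1) (0, true)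

/-- The literals in `l` are false when the variables of the first and of the last one have the
values `a` and `b`. -/
def falsifies (l : List Literal) (a b : Bool) : Bool :=
  l.isEmpty || (a != (firstLit l).2 && b != (lastLit l).2)

theorem readLiterals_spec {τ : MachineState} {x y : Literal} (h14 : τ.reg 14 = encodeLiteral x)
    (h15 : τ.reg 15 = encodeLiteral y) (h9 : τ.reg 9 = 0) (h10 : τ.reg 10 = 0)
    (h11 : τ.reg 11 = 0) (h12 : τ.reg 12 = 0) :
    ((readLiterals.eval τ).reg 7 = x.1 ∧ (readLiterals.eval τ).reg 8 = y.1) ∧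
    ((readLiterals.eval τ).reg 9 = (if false != x.2 && false != y.2 then τ.reg 16 else 0) ∧
      (readLiterals.eval τ).reg 10 = (if true != x.2 && false != y.2 then τ.reg 16 else 0) ∧
      (readLiterals.eval τ).reg 11 = (if false != x.2 && true != y.2 then τ.reg 16 else 0) ∧
      (readLiterals.eval τ).reg 12 = (if true != x.2 && true != y.2 then τ.reg 16 else 0)) := by
  obtain ⟨a, b⟩ := x
  obtain ⟨c, d⟩ := y
  have ha : (0 : ℤ) < a + 1 := by positivity
  have hc : (0 : ℤ) < c + 1 := by positivity
  have ha' : ¬ (0 : ℤ) < -1 + -a := by omega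
  have hc' : ¬ (0 : ℤ) < -1 + -c := by omega
  cases b <;> cases d <;> simp [encodeLiteral] at h14 h15 <;>
    simp [readLiterals, *]

theorem readClause_spec {τ : MachineState} {l : List Literal} {k : ℕ} {p W : ℤ}
    (h : Holds τ p (encodeList (fun l => [encodeLiteral l]) l ++ [W])) (h6 : τ.reg 6 = k)
    (h1 : τ.reg 1 = p) :
    ((readClause.eval τ).reg 1 = p + (l.length + 2) ∧
      (readClause.eval τ).reg 4 = τ.reg 4 + if W < 0 then 0 else W) ∧
    ((readClause.eval τ).reg 7 = (if l.isEmpty then -((k + 1 : ℕ) : ℤ) else (firstLit l).1) ∧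
      (readClause.eval τ).reg 8 = (if l.isEmpty then -((k + 1 : ℕ) : ℤ) else (lastLit l).1)) ∧
    ((readClause.eval τ).reg 9 = (if falsifies l false false then W else 0) ∧
      (readClause.eval τ).reg 10 = (if falsifies l true false then W else 0) ∧
      (readClause.eval τ).reg 11 = (if falsifies l false true then W else 0) ∧
      (readClause.eval τ).reg 12 = (if falsifies l true true then W else 0)) ∧
    readClause.cost τ ≤ 300 := by
  rw [encodeList_singleton] at h
  have e13 : τ.mem 0 p = l.length := h.left.head
  have e16 : τ.mem 0 (p + l.length + 1) = W := by
    rw [← h.right.head]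
    simp; ring_nf
  set pre : Cmd := 13 ≔ cell 0 (reg 1) ;; 14 ≔ cell 0 (reg 1 + lit 1) ;;
    15 ≔ cell 0 (reg 1 + reg 13) ;; 16 ≔ cell 0 (reg 1 + reg 13 + lit 1) ;;
    1 ≔ reg 1 + reg 13 + lit 2 ;; 9 ≔ lit 0 ;; 10 ≔ lit 0 ;; 11 ≔ lit 0 ;; 12 ≔ lit 0 with hpre
  set wt : Cmd := ifLT (reg 16) (lit 0) skip (4 ≔ reg 4 + reg 16) with hwt
  set τ₁ := wt.eval (pre.eval τ) with hτ₁
  have p16 : (pre.eval τ).reg 16 = W := by simp [hpre, h1, e13, e16]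
  have p4 : (pre.eval τ).reg 4 = τ.reg 4 := frame_reg _ _ rfl
  have a4 : τ₁.reg 4 = τ.reg 4 + if W < 0 then 0 else W := by
    simp only [hτ₁, hwt, eval_ifLT, eval_reg, eval_lit, p16]
    split_ifs <;> simp [p4, p16]
  have fr : ∀ r, r ≠ 4 → τ₁.reg r = (pre.eval τ).reg r := by
    intro r hr
    rw [hτ₁, frame_reg]
    simp [hwt, writesReg, hr]
  have a1 : τ₁.reg 1 = p + (l.length + 2) := by
    rw [fr _ (by decide)]; simp [hpre, h1, e13]; ring
  have a6 : τ₁.reg 6 = k := by rw [fr _ (by decide), frame_reg _ _ rfl, h6]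
  have a13 : τ₁.reg 13 = l.length := by rw [fr _ (by decide)]; simp [hpre, h1, e13]
  have a14 : τ₁.reg 14 = τ.mem 0 (p + 1) := by rw [fr _ (by decide)]; simp [hpre, h1]
  have a15 : τ₁.reg 15 = τ.mem 0 (p + l.length) := by
    rw [fr _ (by decide)]; simp [hpre, h1, e13]
  have a16 : τ₁.reg 16 = W := by rw [fr _ (by decide), p16]
  have z9 : τ₁.reg 9 = 0 := by rw [fr _ (by decide)]; simp [hpre]
  have z10 : τ₁.reg 10 = 0 := by rw [fr _ (by decide)]; simp [hpre]
  have z11 : τ₁.reg 11 = 0 := by rw [fr _ (by decide)]; simp [hpre]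
  have z12 : τ₁.reg 12 = 0 := by rw [fr _ (by decide)]; simp [hpre]
  have hev : readClause.eval τ = (ifLT (reg 13) (lit 1) emptyClause readLiterals).eval τ₁ := rfl
  have hcost : readClause.cost τ ≤ 300 := by
    simp [readClause, emptyClause, readLiterals]
  rw [hev]
  cases l with
  -- Here registers 14 and 15 hold no literals, and `emptyClause` does not use them.
  | nil =>
    have : (ifLT (reg 13) (lit 1) emptyClause readLiterals).eval τ₁ = emptyClause.eval τ₁ := by
      simp [a13]
    rw [this]
    simp only [emptyClause, eval_seq, eval_assign]
    simp [a1, a4, a6, a16, falsifies, hcost]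
    ring
  | cons x l =>
    have b14 : τ.mem 0 (p + 1) = encodeLiteral (firstLit (x :: l)) := h.left.tail.head
    have b15 : τ.mem 0 (p + (x :: l).length) = encodeLiteral (lastLit (x :: l)) := by
      have := h.left.tail l.length (by simp)
      rw [List.getD_eq_getElem _ _ (by simp), List.getElem_map] at this
      rw [lastLit, List.getD_eq_getElem _ _ (by simp)]
      simp only [List.length_cons, Nat.add_sub_cancel, Nat.cast_add, Nat.cast_one]
      rw [← this]
      ring_nf
    have : (ifLT (reg 13) (lit 1) emptyClause readLiterals).eval τ₁ = readLiterals.eval τ₁ := by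
      simp [a13]
    rw [this]
    rw [b14] at a14
    rw [b15] at a15
    obtain ⟨hv, hg⟩ := readLiterals_spec a14 a15 z9 z10 z11 z12
    rw [a16] at hg
    refine ⟨⟨?_, ?_⟩, hv, hg, hcost⟩
    · rw [frame_reg _ _ rfl, a1]
    · rw [frame_reg _ _ rfl, a4]

end WCNF

/-! ### Correctness for Max2SAT -/

namespace WCNF

theorem mem_clause_iff {c : Clause} {l : List Literal} (hl : ListingOf l c) (hc : c.card ≤ 2)
    (hne : l ≠ []) (y : Literal) : y ∈ c ↔ y = firstLit l ∨ y = lastLit l := by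
  rw [← hl.2]
  rw [← hl.length_eq] at hc
  match l, hne, hc with
  | [a], _, _ => simp [firstLit, lastLit, List.getD]
  | [a, b], _, _ => simp [firstLit, lastLit, List.getD]

theorem not_sat_iff {c : Clause} {l : List Literal} (hl : ListingOf l c) (hc : c.card ≤ 2)
    (β : ℕ → Bool) :
    ¬ Clause.Sat c β ↔ falsifies l (β (firstLit l).1) (β (lastLit l).1) = true := by
  by_cases hne : l = []
  · subst hne
    simp [falsifies, Clause.Sat, ← hl.2]
  · simp only [Clause.Sat, mem_clause_iff hl hc hne]
    simp [falsifies, hne]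

theorem mem_vars_iff {c : Clause} {l : List Literal} (hl : ListingOf l c) (hc : c.card ≤ 2)
    (hne : l ≠ []) (x : ℕ) : x ∈ Clause.vars c ↔ x = (firstLit l).1 ∨ x = (lastLit l).1 := by
  simp only [Clause.vars, Finset.mem_image, mem_clause_iff hl hc hne]
  constructor
  · rintro ⟨y, rfl | rfl, rfl⟩ <;> simp
  · rintro (rfl | rfl)
    · exact ⟨_, Or.inl rfl, rfl⟩
    · exact ⟨_, Or.inr rfl, rfl⟩

/-- A number that exceeds all finite costs. -/
noncomputable def bound (φ : WCNF) : ℤ :=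
  1 + ∑ c ∈ φ.clauses, if encodeWeight (φ.weight c) < 0 then 0 else encodeWeight (φ.weight c)

/-- The weight of a clause, with `∞` replaced by a large number. -/
noncomputable def boundedWeight (φ : WCNF) (c : Clause) : ℤ :=
  if encodeWeight (φ.weight c) < 0 then φ.bound else encodeWeight (φ.weight c)

open Classical in
noncomputable def boundedCost (φ : WCNF) (β : ℕ → Bool) : ℤ :=
  ∑ c ∈ φ.clauses with ¬ Clause.Sat c β, φ.boundedWeight c

theorem encodeWeight_coe (n : ℕ) : encodeWeight (n : ℕ∞) = n := rfl

theorem encodeWeight_top : encodeWeight ⊤ = -1 := rfl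

theorem one_le_bound (φ : WCNF) : 1 ≤ φ.bound := by
  refine le_add_of_nonneg_right (Finset.sum_nonneg fun c _ => ?_)
  split_ifs <;> omega

theorem boundedWeight_nonneg (φ : WCNF) (c : Clause) : 0 ≤ φ.boundedWeight c := by
  have := φ.one_le_bound
  rw [boundedWeight]
  split_ifs <;> omega

/-- The bound exceeds the sum of all finite weights, while a single falsified clause of weight `∞`
already contributes the whole bound. -/
theorem cost_cases (φ : WCNF) (β : ℕ → Bool) :
    (∃ n : ℕ, φ.cost β = n ∧ φ.boundedCost β = n ∧ (n : ℤ) < φ.bound) ∨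
      φ.cost β = ⊤ ∧ φ.bound ≤ φ.boundedCost β := by
  classical
  by_cases h : ∃ c ∈ φ.clauses.filter (fun c => ¬ Clause.Sat c β), φ.weight c = ⊤
  · obtain ⟨c, hc, hw⟩ := h
    right
    constructor
    · rw [cost]
      refine top_le_iff.1 (hw.ge.trans ?_)
      convert Finset.single_le_sum (f := φ.weight) (fun _ _ => zero_le) hc
    · have : φ.bound = φ.boundedWeight c := by simp [boundedWeight, hw, encodeWeight_top]
      rw [this, boundedCost]
      convert Finset.single_le_sum (fun c _ => φ.boundedWeight_nonneg c) hc
  · push Not at h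
    have h1 : ∀ c ∈ φ.clauses.filter (fun c => ¬ Clause.Sat c β),
        φ.weight c = ((φ.weight c).toNat : ℕ∞) := fun c hc => (ENat.natCast_toNat (h c hc)).symm
    have h2 : φ.boundedCost β =
        (∑ c ∈ φ.clauses with ¬ Clause.Sat c β, (φ.weight c).toNat : ℕ) := by
      rw [boundedCost, Nat.cast_sum]
      refine Finset.sum_congr (by congr) fun c hc => ?_
      have : encodeWeight (φ.weight c) = (φ.weight c).toNat := by
        conv_lhs => rw [h1 c (by convert hc)]
        rfl
      rw [boundedWeight, this, if_neg (by omega)]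
    refine Or.inl ⟨_, ?_, h2, ?_⟩
    · rw [cost, Nat.cast_sum]
      exact Finset.sum_congr (by congr) fun c hc => h1 c (by convert hc)
    · rw [bound, Nat.cast_sum, add_comm, Int.lt_add_one_iff]
      refine le_trans (Finset.sum_le_sum fun c hc => ?_) (Finset.sum_le_sum_of_subset_of_nonneg
        (Finset.filter_subset (fun c => ¬ Clause.Sat c β) _) fun c _ _ => ?_)
      · have : encodeWeight (φ.weight c) = (φ.weight c).toNat := by
          conv_lhs => rw [h1 c hc]
          rfl
        rw [this, if_neg (by omega)]
      · split_ifs <;> omega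

theorem isSolution_of_boundedCost {φ : WCNF} {s : MachineState}
    (hmin : ∀ β, φ.boundedCost s.outputAssignment ≤ φ.boundedCost β)
    (h0 : s.reg 0 = if φ.boundedCost s.outputAssignment < φ.bound then
      φ.boundedCost s.outputAssignment else -1) : φ.IsSolution s := by
  have hopt : φ.cost s.outputAssignment = φ.optCost := by
    refine le_antisymm (le_iInf fun β => ?_) (iInf_le _ _)
    rcases φ.cost_cases β with ⟨n, h1, h2, h3⟩ | ⟨h1, -⟩
    · have := hmin β
      rcases φ.cost_cases s.outputAssignment with ⟨n', h1', h2', h3'⟩ | ⟨-, h2'⟩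
      · rw [h1, h1']
        exact_mod_cast (by omega : n' ≤ n)
      -- An infinite cost at the minimum would put the bounded cost at or above the bound, although
      -- `β` stays below it.
      · omega
    · rw [h1]; exact le_top
  refine ⟨hopt, ?_⟩
  rw [h0, ← hopt]
  rcases φ.cost_cases s.outputAssignment with ⟨n, h1, h2, h3⟩ | ⟨h1, h2⟩
  · rw [h1, h2, if_pos h3, encodeWeight_coe]
  · rw [h1, if_neg h2.not_gt, encodeWeight_top]

theorem solver_spec (φ : WCNF) (hφ : φ.IsBinary) (D : TreeDecomposition φ.incGraph)
    (cs : List Clause) (lits : Clause → List Literal)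
    (bags : Fin D.numNodes → List (IncidenceVertex φ.clauses Clause.vars))
    (hcs : ListingOf cs φ.clauses) (hlits : ∀ c ∈ φ.clauses, ListingOf (lits c) c)
    (hbags : ∀ t, ListingOf (bags t) (D.bag t)) (s : MachineState)
    (hs : s = MachineState.init (φ.encode cs lits ++ encodeDecomposition cs D bags)) :
    φ.IsSolution (solver.eval s) ∧
      solver.cost s ≤ 40000 * 2 ^ D.width * (φ.size + D.numNodes) := by
  have hH : Holds s 0 (φ.encode cs lits ++ encodeDecomposition cs D bags) := hs ▸ holds_init _
  have r3 : s.reg 3 = 0 := by rw [hs]; rfl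
  have m7 : ∀ a, s.mem 7 a = 0 := fun a => by rw [hs]; simp [MachineState.init]
  have m8 : ∀ a, s.mem 8 a = 0 := fun a => by rw [hs]; simp [MachineState.init]
  clear hs
  let c : ℕ → Clause := fun j => cs.getD j ∅
  let l : ℕ → List Literal := fun j => lits (c j)
  let W : ℕ → ℤ := fun j => encodeWeight (φ.weight (c j))
  let u : ℕ → ℤ := fun j => if (l j).isEmpty then -((j + 1 : ℕ) : ℤ) else (firstLit (l j)).1
  let v : ℕ → ℤ := fun j => if (l j).isEmpty then -((j + 1 : ℕ) : ℤ) else (lastLit (l j)).1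
  let g : ℕ → Bool → Bool → ℤ := fun j a b => if falsifies (l j) a b then W j else 0
  let M : ℕ → ℤ := fun k => 1 + ∑ j ∈ Finset.range k, if W j < 0 then 0 else W j
  have hc : ∀ j, ∀ h : j < cs.length, c j = cs[j] := fun j h => List.getD_eq_getElem _ _ h
  have hmem : ∀ j < cs.length, c j ∈ φ.clauses := fun j h =>
    (hcs.2 _).1 (hc j h ▸ List.getElem_mem h)
  have hl : ∀ j < cs.length, ListingOf (l j) (c j) := fun j h => hlits _ (hmem j h)
  have hsc : Scopes cs Clause.vars u v := by
    intro j hj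
    rw [← hc j hj]
    by_cases he : l j = []
    · refine ⟨fun x => ?_, Or.inr (by simp [u, v, he])⟩
      have : c j = ∅ := by
        ext y; rw [← (hl j hj).2, he]; simp
      simp [u, v, he, this, Clause.vars]
      omega
    · refine ⟨fun x => ?_, Or.inl (by simp [u, v, he])⟩
      rw [mem_vars_iff (hl j hj) (hφ _ (hmem j hj)) he]
      simp [u, v, he]
  set d := treeData cs u v D bags with hd
  have hdec : d.Decomposes := treeData_decomposes hcs hbags hsc
  let pos : ℕ → ℤ := fun k => 1 + (∑ j ∈ Finset.range k, ((l j).length + 2) : ℕ)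
  have hclause : ∀ k, ∀ h : k < cs.length,
      Holds s (pos k) (encodeList (fun l => [encodeLiteral l]) (l k) ++ [W k]) := by
    intro k hk
    have := hH.left.tail.flatMap (fun j => (l j).length + 2) (fun j hj => ?_) hk
    · rw [← hc k hk] at this
      simpa [pos] using this
    · rw [← hc j hj]
      simp [encodeList_singleton, l]
  set s₁ := (2 ≔ cell 0 (lit 0) ;; 1 ≔ lit 1 ;; 4 ≔ lit 1).eval s with hs₁
  have k2 : s₁.reg 2 = cs.length := by
    have := hH.left.head
    rw [← this, hs₁]; simp
  have km : s₁.mem = s.mem := rfl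
  obtain ⟨⟨⟨off, e, hB⟩, k1, k4⟩, cost₁⟩ := build_spec (body := readClause) (s := s₁) (u := u)
    (v := v) (g := g) (bag := d.bag) (m := cs.length) (c := 300) (pos := pos)
    (M := M) (fun k hk => d.bag_constraint hk) (by rintro r (rfl | rfl) <;> rfl)
    (fun a => by rfl) k2 r3 m7 rfl rfl (by
      intro k hk τ t0 t6 t1 t4
      obtain ⟨⟨b1, b4⟩, b⟩ := readClause_spec ((hclause k hk).congr t0) t6 t1
      refine ⟨⟨?_, ?_⟩, b⟩
      · rw [b1]
        simp only [pos, Finset.sum_range_succ]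
        push_cast; ring
      · rw [b4, t4]
        simp only [M, Finset.sum_range_succ]
        ring)
  set s₂ := (build readClause).eval s₁ with hs₂
  obtain ⟨hB', cost₂⟩ := replaceNegative_spec hB
  set s₃ := replaceNegative.eval s₂ with hs₃
  have q1 : s₃.reg 1 = pos cs.length := by rw [hs₃, frame_reg _ _ rfl, k1]
  have q2 : s₃.reg 2 = cs.length := by
    rw [hs₃, frame_reg _ _ rfl, hs₂, frame_reg _ _ rfl, k2]
  have q4 : s₃.reg 4 = M cs.length := by rw [hs₃, frame_reg _ _ rfl, k4]
  have q0 : s₃.mem 0 = s.mem 0 := by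
    rw [hs₃, frame_mem _ _ rfl, hs₂, frame_mem _ _ rfl, km]
  have q8 : s₃.mem 8 = s.mem 8 := by
    rw [hs₃, frame_mem _ _ rfl, hs₂, frame_mem _ _ rfl, km]
  have hM : M cs.length = φ.bound := by
    rw [bound, ← hcs.sum_eq]
    refine congrArg (1 + ·) (sum_range_listing fun j hj => ?_)
    simp only [W, hc j hj]
  have hE : d.Encoded s₃ (s₃.reg 1) := by
    refine TreeData.encoded_of_holds ?_
    have := (hH.congr q0).right
    rw [q1]
    convert this using 1
    have : (cs.flatMap fun c => encodeList (fun l => [encodeLiteral l]) (lits c) ++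
        [encodeWeight (φ.weight c)]).length = ∑ j ∈ Finset.range cs.length, ((l j).length + 2) := by
      rw [List.length_flatMap]
      refine (sum_range_listing fun j hj => ?_).symm
      simp [encodeList_singleton, l, hc j hj]
    simp only [encode, encodeList] at this ⊢
    rw [List.length_cons, this]
    simp only [pos]
    push_cast; ring
  obtain ⟨f1, f2, f3⟩ := solve_spec hdec hB' hE q2 (fun a => by rw [q8, m8])
    fun t ht => length_treeData_E_le hbags ht
  set s₄ := solve.eval s₃ with hs₄
  have g4 : s₄.reg 4 = φ.bound := by rw [hs₄, frame_reg _ _ rfl, q4, hM]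
  have hev : solver.eval s = (ifLT (reg 0) (reg 4) skip (0 ≔ lit (-1))).eval s₄ := rfl
  -- A table entry is negative only if the clause is falsified and has weight `∞`, so the
  -- replacement turns exactly these entries into the bound.
  have hval : ∀ (β : ℤ → Bool) (b : ℕ → Bool), (∀ x : ℕ, β x = b x) →
      (∑ j ∈ Finset.range d.m, if g j (β (d.u j)) (β (d.v j)) < 0 then s₂.reg 4 else
        g j (β (d.u j)) (β (d.v j))) = φ.boundedCost b := by
    classical
    intro β b hb
    have hbd := φ.one_le_bound
    rw [boundedCost, Finset.sum_filter, ← hcs.sum_eq]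
    refine sum_range_listing fun j hj => ?_
    have hfal : ¬ Clause.Sat (c j) b ↔ falsifies (l j) (β (u j)) (β (v j)) = true := by
      rw [not_sat_iff (hl j hj) (hφ _ (hmem j hj))]
      by_cases he : l j = []
      · simp [falsifies, he]
      · simp [u, v, he, hb]
    rw [← hc j hj, k4, hM]
    change (if (if falsifies (l j) (β (u j)) (β (v j)) then W j else 0) < 0 then φ.bound else
      if falsifies (l j) (β (u j)) (β (v j)) then W j else 0) = _
    by_cases hf : falsifies (l j) (β (u j)) (β (v j)) = true
    · rw [if_pos (hfal.2 hf)]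
      simp only [hf, if_true, boundedWeight, W]
    · rw [if_neg (fun h => hf (hfal.1 h))]
      simp [hf]
  have hout : s₄.reg 0 = φ.boundedCost s₄.outputAssignment := f1.trans (hval _ _ fun _ => rfl)
  have ho : (solver.eval s).outputAssignment = s₄.outputAssignment := by
    have : (solver.eval s).mem 1 = s₄.mem 1 := by rw [hev, frame_mem _ _ rfl]
    funext x
    rw [MachineState.outputAssignment, this, MachineState.outputAssignment]
  constructor
  · apply isSolution_of_boundedCost
    · intro b
      rw [ho, ← hout, ← hval (fun z => b z.toNat) b fun x => by simp]
      exact f2 fun z => b z.toNat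
    · rw [ho, hev, ← hout, ← g4, eval_ifLT]
      simp only [eval_reg]
      by_cases h : s₄.reg 0 < s₄.reg 4 <;> simp [h]
  · have hcost : solver.cost s = (2 ≔ cell 0 (lit 0) ;; 1 ≔ lit 1 ;; 4 ≔ lit 1).cost s +
        (build readClause).cost s₁ + replaceNegative.cost s₂ + solve.cost s₃ +
        (ifLT (reg 0) (reg 4) skip (0 ≔ lit (-1))).cost s₄ := by
      rw [hs₄, hs₃, hs₂, hs₁]; simp only [solver, cost_seq, eval_seq]; ring
    have hm : cs.length + 1 ≤ φ.size := by
      rw [hcs.length_eq, size, Finset.card_eq_sum_ones]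
      exact Nat.add_le_add_right (Finset.sum_le_sum fun _ _ => Nat.le_add_left _ _) 1
    have h2 : 1 ≤ 2 ^ D.width := Nat.one_le_two_pow
    have h3 : (2 ≔ cell 0 (lit 0) ;; 1 ≔ lit 1 ;; 4 ≔ lit 1).cost s ≤ 50 := by simp
    have h3' : (ifLT (reg 0) (reg 4) skip (0 ≔ lit (-1))).cost s₄ ≤ 50 := by simp
    have hdm : d.m = cs.length := rfl
    have hdN : d.N = D.numNodes := rfl
    rw [hdm, hdN] at f3
    have h4 : cs.length ≤ cs.length * 2 ^ D.width := Nat.le_mul_of_pos_right _ h2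
    have h5 : (cs.length + 1 + D.numNodes) * 2 ^ D.width ≤ (φ.size + D.numNodes) * 2 ^ D.width :=
      Nat.mul_le_mul_right _ (by omega)
    rw [hcost]
    nlinarith

end WCNF

/-! ### The main theorem -/

/-- All registers of the solvers are below 40, so compilation may use those from 40 on as scratch.
Only register 0 and the memory matter for the output. -/
theorem Cmd.solvesWithin {p : Cmd} (hp : p.regsBelow 40 = true) {input : List ℤ} {T : ℕ}
    {good : MachineState → Prop} (hT : p.cost (MachineState.init input) ≤ T)
    (hgood : ∀ s, s.reg 0 = (p.eval (MachineState.init input)).reg 0 →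
      s.mem = (p.eval (MachineState.init input)).mem → good s) :
    SolvesWithin (p.code 40) input T good := by
  obtain ⟨t, s, h1, h2, h3, -⟩ := p.code_exec hp 40 le_rfl _ (MachineState.init input)
    ⟨fun _ _ => rfl, rfl⟩
  exact ⟨t, s, h1, h2.trans hT, hgood s (h3.1 0 (by norm_num)) h3.2⟩

theorem WCNF.IsSolution.congr {φ : WCNF} {s s' : MachineState} (h : φ.IsSolution s)
    (h0 : s'.reg 0 = s.reg 0) (hm : s'.mem = s.mem) : φ.IsSolution s' := by
  have : s'.outputAssignment = s.outputAssignment := by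
    funext x; simp only [MachineState.outputAssignment, hm]
  rwa [WCNF.IsSolution, this, h0]

theorem Qubo.IsSolution.congr {H : Qubo} {s s' : MachineState} (h : H.IsSolution s)
    (h0 : s'.reg 0 = s.reg 0) (hm : s'.mem = s.mem) : H.IsSolution s' := by
  have : s'.outputAssignment = s.outputAssignment := by
    funext x; simp only [MachineState.outputAssignment, hm]
  rwa [Qubo.IsSolution, this, h0]

theorem WCNF.solvedWithin {φ : WCNF} (hφ : φ.IsBinary) (D : TreeDecomposition φ.incGraph) {T : ℕ}
    (hT : 40000 * 2 ^ D.width * (φ.size + D.numNodes) ≤ T) :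
    φ.SolvedWithin (WCNF.solver.code 40) D T := by
  intro cs lits bags hcs hlits hbags
  obtain ⟨h1, h2⟩ := WCNF.solver_spec φ hφ D cs lits bags hcs hlits hbags _ rfl
  exact Cmd.solvesWithin rfl (h2.trans hT) fun s h0 hm => h1.congr h0 hm

theorem Qubo.solvedWithin (H : Qubo) (D : TreeDecomposition H.incGraph) {T : ℕ}
    (hT : 40000 * 2 ^ D.width * (H.size + D.numNodes) ≤ T) :
    H.SolvedWithin (Qubo.solver.code 40) D T := by
  intro ts bags hts hbags
  obtain ⟨h1, h2⟩ := Qubo.solver_spec H D ts bags hts hbags _ rfl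
  exact Cmd.solvesWithin rfl (h2.trans hT) fun s h0 hm => h1.congr h0 hm

theorem time_le {k w N n : ℕ} (hw : k = w) (hN : N ≤ n) :
    40000 * 2 ^ k * (n + N) ≤ 80000 * 2 ^ w * n := by
  subst hw
  calc 40000 * 2 ^ k * (n + N) ≤ 40000 * 2 ^ k * (n + n) := by gcongr
    _ = 80000 * 2 ^ k * n := by ring

theorem mainTheorem6 :
    (∃ (P : Program) (C : ℕ), ∀ φ : WCNF, φ.IsBinary →
      (∀ D : TreeDecomposition φ.incGraph,
        φ.SolvedWithin P D (C * 2 ^ D.width * (φ.size + D.numNodes))) ∧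
      (∀ D : TreeDecomposition φ.incGraph, D.width = φ.itw → D.numNodes ≤ φ.size →
        φ.SolvedWithin P D (C * 2 ^ φ.itw * φ.size)) ∧
      (∃ D : TreeDecomposition φ.incGraph, D.width = φ.itw ∧ D.numNodes ≤ φ.size)) ∧
    (∃ (P : Program) (C : ℕ), ∀ H : Qubo,
      (∀ D : TreeDecomposition H.incGraph,
        H.SolvedWithin P D (C * 2 ^ D.width * (H.size + D.numNodes))) ∧
      (∀ D : TreeDecomposition H.incGraph, D.width = H.itw → D.numNodes ≤ H.size →
        H.SolvedWithin P D (C * 2 ^ H.itw * H.size)) ∧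
      (∃ D : TreeDecomposition H.incGraph, D.width = H.itw ∧ D.numNodes ≤ H.size)) := by
  refine ⟨⟨WCNF.solver.code 40, 80000, fun φ hφ => ⟨fun D => ?_, fun D hw hN => ?_, ?_⟩⟩,
    ⟨Qubo.solver.code 40, 80000, fun H => ⟨fun D => ?_, fun D hw hN => ?_, ?_⟩⟩⟩
  · exact WCNF.solvedWithin hφ D (by gcongr; norm_num)
  · exact WCNF.solvedWithin hφ D (time_le hw hN)
  · obtain ⟨D, hw, hN⟩ := TreeDecomposition.exists_width_eq_treewidth φ.incGraph
    refine ⟨D, hw, hN.trans (Nat.add_le_add_right ?_ 1)⟩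
    exact (card_incidenceVertex_le _ _).trans
      (Finset.sum_le_sum fun c _ => Nat.add_le_add_right Finset.card_image_le 1)
  · exact H.solvedWithin D (by gcongr; norm_num)
  · exact H.solvedWithin D (time_le hw hN)
  · obtain ⟨D, hw, hN⟩ := TreeDecomposition.exists_width_eq_treewidth H.incGraph
    exact ⟨D, hw, hN.trans (Nat.add_le_add_right (card_incidenceVertex_le _ _) 1)⟩
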